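/- Let $d\ge 1$ be an integer and let $p_0>p_1>\frac4d$ be real. For $u\in H^1(\mathbb R^d)\cap L^{p_0+2}(\mathbb R^d)$ (complex valued) put $M(u)=\int_{\mathbb R^d}|u|^2\,dx$, $$E(u)=\int_{\mathbb R^d}|\nabla u|^2-\frac{2}{p_1+2}|u|^{p_1+2}+\frac{2}{p_0+2}|u|^{p_0+2}\,dx,$$ $$\Phi(u)=\int_{\mathbb R^d}|\nabla u|^2-\frac{dp_1}{2(p_1+2)}|u|^{p_1+2}+\frac{dp_0}{2(p_0+2)}|u|^{p_0+2}\,dx,$$ and, for $m\ge 0$, let $I(m)$ and $\tilde I(m)$ be the infima of $E(u)$ and of $\Phi(u)$, respectively, over all $u\in H^1(\mathbb R^d)\cap L^{p_0+2}(\mathbb R^d)$ with $M(u)=m$. Then $I(m)$ and $\tilde I(m)$ are finite for every $m\ge0$. There is a (necessarily unique) critical mass $m_c>0$ such that $I(m)=0$ for $0\le m\le m_c$ and $I(m)<0$ for $m>m_c$. Set $$\tilde m_c=\left(\frac{p_0}{p_1}\right)^{\frac{p_1d-4}{2(p_0-p_1)}}\left(\frac{4}{dp_1}\right)^{\frac d2}m_c>0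 .$$ The following hold. (a) The function $m\mapsto\tilde I(m)$ is concave and nonincreasing on $[0,\infty)$. (b) $\tilde I(m)=0$ for all $0\le m\le\tilde m_c$. (c) $\tilde I$ is negative and strictly decreasing on $(\tilde m_c,\infty)$. (d) For every $m\ge\tilde m_c$ there is $\tilde u\in H^1(\mathbb R^d)\cap L^{p_0+2}(\mathbb R^d)$ with $M(\tilde u)=m$ and $\Phi(\tilde u)=\tilde I(m)$ which is positive, radial and radially (strictly) decreasing, that is, $\tilde u(x)=f(|x|)$ with $f:[0,\infty)\to(0,\infty)$ strictly decreasing. (e) For every $0<m<\tilde m_c$ there is $\tilde\delta(m)>0$ such that $\Phi(u)\ge\tilde\delta(m)\,\|\nabla u\|_{L^2}^2$ for all $u\in H^1(\mathbb R^d)\cap L^{p_0+2}(\mathbb R^d)$ with $M(u)=m$. -/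

import Mathlib

open MeasureTheory Set
open scoped ContDiff

noncomputable section

namespace DoublePowerNLS

/-- The Euclidean space `ℝᵈ`. -/
abbrev Space (d : ℕ) : Type := EuclideanSpace ℝ (Fin d)

/-- `G` is a weak (distributional) gradient of `u : ℝᵈ → ℂ`: both are locally integrable and
`∫ u ∂ᵢφ = - ∫ φ Gᵢ` for every test function `φ` and every coordinate `i`. -/
def IsWeakGradient {d : ℕ} (u : Space d → ℂ) (G : Space d → EuclideanSpace ℂ (Fin d)) : Prop :=
  LocallyIntegrable u volume ∧ LocallyIntegrable G volume ∧
    ∀ φ : Space d → ℝ, ContDiff ℝ ∞ φ → HasCompactSupport φ → ∀ i : Fin d,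
      ∫ x, (fderiv ℝ φ x (EuclideanSpace.single i 1)) • u x = - ∫ x, φ x • G x i

/-- Two weak gradients of the same function agree almost everywhere. -/
theorem IsWeakGradient.ae_eq {d : ℕ} {u : Space d → ℂ} {G H : Space d → EuclideanSpace ℂ (Fin d)}
    (hG : IsWeakGradient u G) (hH : IsWeakGradient u H) : ∀ᵐ x, G x = H x := by
  have hcoord : ∀ {K : Space d → EuclideanSpace ℂ (Fin d)}, LocallyIntegrable K volume →
      ∀ i : Fin d, LocallyIntegrable (fun x => K x i) volume := by
    intro K hK i x
    obtain ⟨s, hs, hi⟩ := hK x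
    exact ⟨s, hs, (EuclideanSpace.proj (𝕜 := ℂ) i).integrable_comp hi⟩
  have key : ∀ i : Fin d, ∀ᵐ x, G x i = H x i := by
    intro i
    refine ae_eq_of_integral_contDiff_smul_eq (hcoord hG.2.1 i) (hcoord hH.2.1 i) ?_
    intro φ hφ hc
    have h1 := hG.2.2 φ hφ hc i
    have h2 := hH.2.2 φ hφ hc i
    exact neg_injective (h1.symm.trans h2)
  filter_upwards [ae_all_iff.2 key] with x hx
  ext i
  exact hx i

/-- The Sobolev space `H¹(ℝᵈ)`: `u ∈ L²`, with a weak gradient in `L²`. -/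
def MemH1 {d : ℕ} (u : Space d → ℂ) : Prop :=
  MemLp u 2 volume ∧ ∃ G : Space d → EuclideanSpace ℂ (Fin d),
    MemLp G 2 volume ∧ IsWeakGradient u G

open Classical in
/-- The weak gradient `∇u` (unique up to null sets; the value `0` is used if there is none). -/
def weakGrad {d : ℕ} (u : Space d → ℂ) : Space d → EuclideanSpace ℂ (Fin d) :=
  if h : ∃ G, IsWeakGradient u G then h.choose else 0

/-- Any weak gradient of `u` agrees with `weakGrad u` almost everywhere. -/
theorem IsWeakGradient.ae_eq_weakGrad {d : ℕ} {u : Space d → ℂ}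
    {G : Space d → EuclideanSpace ℂ (Fin d)} (hG : IsWeakGradient u G) :
    ∀ᵐ x, weakGrad u x = G x := by
  have h : ∃ G, IsWeakGradient u G := ⟨G, hG⟩
  have hw : weakGrad u = h.choose := dif_pos h
  rw [hw]
  exact h.choose_spec.ae_eq hG

/-- The mass `M(u) = ∫ |u|²`. -/
def mass {d : ℕ} (u : Space d → ℂ) : ℝ := ∫ x, ‖u x‖ ^ 2

/-- `‖∇u‖²_{L²} = ∫ |∇u|²`. -/
def gradNormSq {d : ℕ} (u : Space d → ℂ) : ℝ := ∫ x, ‖weakGrad u x‖ ^ 2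

/-- `∫ |u|^q`, for a real exponent `q`. -/
def powInt {d : ℕ} (q : ℝ) (u : Space d → ℂ) : ℝ := ∫ x, ‖u x‖ ^ q

/-- The energy `E(u)`. -/
def energy {d : ℕ} (p₀ p₁ : ℝ) (u : Space d → ℂ) : ℝ :=
  gradNormSq u - 2 / (p₁ + 2) * powInt (p₁ + 2) u + 2 / (p₀ + 2) * powInt (p₀ + 2) u

/-- The virial functional `Φ(u)`. -/
def virial {d : ℕ} (p₀ p₁ : ℝ) (u : Space d → ℂ) : ℝ :=
  gradNormSq u - d * p₁ / (2 * (p₁ + 2)) * powInt (p₁ + 2) u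
    + d * p₀ / (2 * (p₀ + 2)) * powInt (p₀ + 2) u

/-- The functions `u ∈ H¹(ℝᵈ) ∩ L^{p₀+2}(ℝᵈ)` with `M(u) = m`. -/
def massShell (d : ℕ) (p₀ m : ℝ) : Set (Space d → ℂ) :=
  {u | MemH1 u ∧ MemLp u (ENNReal.ofReal (p₀ + 2)) volume ∧ mass u = m}

/-- `I(m) = inf {E(u) : u ∈ H¹ ∩ L^{p₀+2}, M(u) = m}`. -/
def energyInf (d : ℕ) (p₀ p₁ m : ℝ) : ℝ := sInf (energy p₀ p₁ '' massShell d p₀ m)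

/-- `Ĩ(m) = inf {Φ(u) : u ∈ H¹ ∩ L^{p₀+2}, M(u) = m}`. -/
def virialInf (d : ℕ) (p₀ p₁ m : ℝ) : ℝ := sInf (virial p₀ p₁ '' massShell d p₀ m)

/-- The critical mass for the energy: `I` vanishes on `[0, mc]` and is negative on `(mc, ∞)`.
At most one `mc > 0` has this property. -/
def IsCriticalMass (d : ℕ) (p₀ p₁ mc : ℝ) : Prop :=
  0 < mc ∧ (∀ m ∈ Icc 0 mc, energyInf d p₀ p₁ m = 0) ∧ ∀ m ∈ Ioi mc, energyInf d p₀ p₁ m < 0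

/-- The rescaled critical mass
`m̃_c = (p₀/p₁)^{(p₁d-4)/(2(p₀-p₁))} (4/(dp₁))^{d/2} m_c`. -/
def tildeMass (d : ℕ) (p₀ p₁ mc : ℝ) : ℝ :=
  (p₀ / p₁) ^ ((p₁ * d - 4) / (2 * (p₀ - p₁))) * (4 / (d * p₁)) ^ ((d : ℝ) / 2) * mc

/-- `u` is positive, radial and (strictly) radially decreasing: `u(x) = f(|x|)` with `f` positive
and strictly decreasing on `[0, ∞)`. -/
def IsPositiveRadialDecreasing {d : ℕ} (u : Space d → ℂ) : Prop :=
  ∃ f : ℝ → ℝ, (∀ r ∈ Ici (0 : ℝ), 0 < f r) ∧ StrictAntiOn f (Ici 0) ∧ ∀ x, u x = (f ‖x‖ : ℂ)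

end DoublePowerNLS

end

/-! Both E and Φ have the form ‖∇u‖² − a∫|u|^{q₁} + b∫|u|^{q₀} with a, b > 0 and 2 + 4/d < q₁ < q₀,
so the theory is developed once, for `groundInf` under `Admissible`. A dilation A·u(B·) that
multiplies the three terms by matching factors carries the infimum of one functional to a multiple
of the other (`groundInf_dilate`, `exists_dilation_parameters`). This relates the two critical
masses.

Shape of the infimum. Mollifying, taking the modulus and truncating shows that Lipschitz bumps
compute the infimum (`exists_bump_near`). Cutting a near-optimal bump by a hyperplane and reflecting
each half gives two bumps of prescribed masses whose energies add up to twice the original one, so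
the infimum is midpoint concave (`groundInf_midpoint`), and concave because it is locally bounded
below (`concaveOn_of_midpoint`). Spreading a bump out shows that it is nonpositive. A concave
nonpositive function vanishing at 0 is nonincreasing, and once negative it is strictly decreasing
(`exists_critical`). It vanishes at some positive mass because, after truncation at a level fixed by
the nonlinearity, a mass-critical weak-type Gagliardo–Nirenberg inequality and the layer-cake
formula bound ∫v^{q₁} by a multiple of m^{2/d}‖∇v‖² (`exists_groundInf_eq_zero`). It is negative
somewhere because a widely spread profile of suitable height has negative energy. Dilating a
subcritical function up to the critical mass gives the coercivity in (e) (`subcritical_coercive`).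

Minimisers. A bump is symmetrized by minimising the second moment in a class closed under
polarization (`IsLipBump.exists_symmetrization`). Along bounded radially nonincreasing sequences of
bounded mass all powers above 2 converge, the Dirichlet integral is lower semicontinuous, and mass
can only drop (`exists_radial_limit`). Above the critical mass, strict monotonicity of the infimum
forbids the drop. At the critical mass one uses negative-energy bumps of slightly larger mass: a
superlevel-set estimate rules out vanishing (`functional_nonneg_of_small`), and coercivity rules out
partial loss.

Positivity and strict decrease. Differentiating the dilation inequality at the minimiser gives the
Euler–Lagrange equation, whose radial form is a first-order system. A flat piece of the profile
would, by ODE uniqueness, make it constant, which is incompatible with L² and positive mass. A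
nonnegative strictly decreasing profile is positive. -/

namespace DoublePowerNLS
open Filter Topology
open scoped NNReal ENNReal InnerProductSpace Convolution

variable {d : ℕ}

/-! ### Lipschitz bumps and their gradients -/

/-- Nonnegative, compactly supported Lipschitz functions. -/
structure IsLipBump (f : Space d → ℝ) : Prop where
  lip : ∃ K : ℝ≥0, LipschitzWith K f
  supp : HasCompactSupport f
  nonneg : ∀ x, 0 ≤ f x

/-- The Dirichlet integral of a real function. -/
noncomputable def dirichlet (f : Space d → ℝ) : ℝ := ∫ x, ‖fderiv ℝ f x‖ ^ 2

/-- The pointwise gradient, with complex coordinates. -/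
noncomputable def gradC (f : Space d → ℝ) (x : Space d) : EuclideanSpace ℂ (Fin d) :=
  WithLp.toLp 2 fun i => ((fderiv ℝ f x (EuclideanSpace.single i 1) : ℝ) : ℂ)

theorem norm_sq_clm (L : Space d →L[ℝ] ℝ) :
    ‖L‖ ^ 2 = ∑ i, (L (EuclideanSpace.single i 1)) ^ 2 := by
  obtain ⟨v, rfl⟩ := (InnerProductSpace.toDual ℝ (Space d)).surjective L
  rw [LinearIsometryEquiv.norm_map, EuclideanSpace.norm_sq_eq]
  refine Finset.sum_congr rfl fun i _ => ?_
  simp [InnerProductSpace.toDual_apply_apply, EuclideanSpace.inner_single_right]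

theorem norm_gradC (f : Space d → ℝ) (x : Space d) : ‖gradC f x‖ = ‖fderiv ℝ f x‖ := by
  rw [← sq_eq_sq₀ (norm_nonneg _) (norm_nonneg _), norm_sq_clm, EuclideanSpace.norm_sq_eq]
  simp [gradC]

/-- Difference quotients of `g` along any direction are dominated by those of `f`, and this survives
in the limit. It serves in place of a chain rule for truncations and absolute values. -/
theorem norm_fderiv_le_of_contraction {f g : Space d → ℝ} {x : Space d}
    (h : ∀ y, |g y - g x| ≤ |f y - f x|) (hf : DifferentiableAt ℝ f x)
    (hg : DifferentiableAt ℝ g x) : ‖fderiv ℝ g x‖ ≤ ‖fderiv ℝ f x‖ := by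
  refine ContinuousLinearMap.opNorm_le_bound _ (norm_nonneg _) fun v => ?_
  refine le_trans ?_ ((fderiv ℝ f x).le_opNorm v)
  have key : ∀ {k : Space d → ℝ}, DifferentiableAt ℝ k x →
      Tendsto (fun t : ℝ => ‖t⁻¹ • (k (x + t • v) - k x)‖) (𝓝[>] 0) (𝓝 ‖fderiv ℝ k x v‖) := by
    intro k hk
    exact ((hk.hasFDerivAt.hasLineDerivAt v).tendsto_slope_zero_right).norm
  refine le_of_tendsto_of_tendsto' (key hg) (key hf) fun t => ?_
  rw [norm_smul, norm_smul]
  exact mul_le_mul_of_nonneg_left (h _) (norm_nonneg _)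

theorem ae_norm_fderiv_le_of_contraction {f g : Space d → ℝ} {K K' : ℝ≥0}
    (hf : LipschitzWith K f) (hg : LipschitzWith K' g)
    (h : ∀ x y, |g y - g x| ≤ |f y - f x|) : ∀ᵐ x, ‖fderiv ℝ g x‖ ≤ ‖fderiv ℝ f x‖ := by
  filter_upwards [hf.ae_differentiableAt (μ := volume), hg.ae_differentiableAt (μ := volume)]
    with x h1 h2 using norm_fderiv_le_of_contraction (h x) h1 h2

theorem measurable_gradC (f : Space d → ℝ) : Measurable (gradC f) := by
  unfold gradC
  refine (WithLp.measurable_toLp 2 _).comp (measurable_pi_lambda _ fun i => ?_)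
  exact Complex.measurable_ofReal.comp (measurable_fderiv_apply_const ℝ f _)

theorem norm_fderiv_le_lip {f : Space d → ℝ} {K : ℝ≥0} (hf : LipschitzWith K f) (x : Space d) :
    ‖fderiv ℝ f x‖ ≤ K := norm_fderiv_le_of_lipschitz ℝ hf

/-- Rademacher's theorem identifies line derivatives with `fderiv` almost everywhere, so integration
by parts of a Lipschitz function against a test function becomes the weak gradient identity. -/
theorem isWeakGradient_of_lipschitz {f : Space d → ℝ} {K : ℝ≥0} (hf : LipschitzWith K f) :
    IsWeakGradient (fun x => (f x : ℂ)) (gradC f) := by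
  refine ⟨(Complex.continuous_ofReal.comp hf.continuous).locallyIntegrable, ?_, ?_⟩
  · refine (locallyIntegrable_const (K : ℝ)).mono (measurable_gradC f).aestronglyMeasurable ?_
    refine Eventually.of_forall fun x => ?_
    rw [norm_gradC]
    simpa using norm_fderiv_le_lip hf x
  · intro φ hφ hc i
    obtain ⟨L, hL⟩ := ContDiff.lipschitzWith_of_hasCompactSupport hc hφ (by simp)
    have h := LipschitzWith.integral_lineDeriv_mul_eq (μ := (volume : Measure (Space d))) hf hL hc
      (EuclideanSpace.single i (1 : ℝ))
    have h1 : ∫ x, (fderiv ℝ φ x (EuclideanSpace.single i 1)) • (f x : ℂ)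
        = ((∫ x, (fderiv ℝ φ x (EuclideanSpace.single i 1)) * f x : ℝ) : ℂ) := by
      rw [← integral_complex_ofReal]
      refine integral_congr_ae (Eventually.of_forall fun x => ?_)
      simp
    have h2 : ∫ x, φ x • gradC f x i
        = ((∫ x, lineDeriv ℝ f x (EuclideanSpace.single i 1) * φ x : ℝ) : ℂ) := by
      rw [← integral_complex_ofReal]
      refine integral_congr_ae ?_
      filter_upwards [hf.ae_differentiableAt (μ := volume)] with x hx
      simp [gradC, hx.lineDeriv_eq_fderiv, mul_comm]
    rw [h1, h2, h, ← Complex.ofReal_neg, ← integral_neg]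
    congr 2
    ext x
    -- The integration by parts formula carries its sign in the direction, hence the derivative
    -- along the negative basis vector.
    have := ((hφ.differentiable (by simp)) x).lineDeriv_eq_fderiv (v := -(EuclideanSpace.single i (1 : ℝ)))
    rw [this]
    simp

theorem gradNormSq_eq {u : Space d → ℂ} {G : Space d → EuclideanSpace ℂ (Fin d)}
    (hG : IsWeakGradient u G) : gradNormSq u = ∫ x, ‖G x‖ ^ 2 := by
  refine integral_congr_ae ?_
  filter_upwards [hG.ae_eq_weakGrad] with x hx
  simp [hx]

theorem gradNormSq_nonneg (u : Space d → ℂ) : 0 ≤ gradNormSq u :=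
  integral_nonneg fun _ => by positivity

theorem dirichlet_nonneg (f : Space d → ℝ) : 0 ≤ dirichlet f :=
  integral_nonneg fun _ => by positivity

theorem gradNormSq_ofReal {f : Space d → ℝ} {K : ℝ≥0} (hf : LipschitzWith K f) :
    gradNormSq (fun x => (f x : ℂ)) = dirichlet f := by
  rw [gradNormSq_eq (isWeakGradient_of_lipschitz hf)]
  simp [norm_gradC, dirichlet]

namespace IsLipBump
variable {f g : Space d → ℝ}

theorem continuous (hf : IsLipBump f) : Continuous f := hf.lip.choose_spec.continuous

theorem memLp_ofReal (hf : IsLipBump f) (p : ℝ≥0∞) : MemLp (fun x => (f x : ℂ)) p volume :=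
  (Complex.continuous_ofReal.comp hf.continuous).memLp_of_hasCompactSupport
    (hf.supp.comp_left (g := fun r : ℝ => (r : ℂ)) rfl)

theorem hasCompactSupport_fderiv (hf : IsLipBump f) : HasCompactSupport (fderiv ℝ f) :=
  hf.supp.fderiv ℝ

theorem memLp_gradC (hf : IsLipBump f) (p : ℝ≥0∞) : MemLp (gradC f) p volume := by
  obtain ⟨K, hK⟩ := hf.lip
  refine HasCompactSupport.memLp_of_bound (C := (K : ℝ)) ?_
    (measurable_gradC f).aestronglyMeasurable ?_
  · refine hf.hasCompactSupport_fderiv.mono fun x hx => ?_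
    contrapose! hx
    have : fderiv ℝ f x = 0 := by simpa using hx
    have h2 : ‖gradC f x‖ = 0 := by rw [norm_gradC, this, norm_zero]
    simpa using h2
  · exact Eventually.of_forall fun x => by rw [norm_gradC]; exact norm_fderiv_le_lip hK x

theorem memH1 (hf : IsLipBump f) : MemH1 (fun x => (f x : ℂ)) :=
  ⟨hf.memLp_ofReal 2, gradC f, hf.memLp_gradC 2, isWeakGradient_of_lipschitz hf.lip.choose_spec⟩

theorem integrable_fderiv_sq (hf : IsLipBump f) : Integrable fun x => ‖fderiv ℝ f x‖ ^ 2 := by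
  have := (hf.memLp_gradC 2).integrable_norm_pow (p := 2) (by norm_num)
  simpa [norm_gradC] using this

theorem integrable_rpow (hf : IsLipBump f) {q : ℝ} (hq : 0 < q) :
    Integrable fun x => f x ^ q := by
  refine Continuous.integrable_of_hasCompactSupport ?_ ?_
  · exact hf.continuous.rpow_const fun x => Or.inr hq.le
  · exact hf.supp.comp_left (g := fun r : ℝ => r ^ q) (Real.zero_rpow hq.ne')

theorem integrable_sq (hf : IsLipBump f) : Integrable fun x => f x ^ 2 := by
  refine Continuous.integrable_of_hasCompactSupport (hf.continuous.pow 2) ?_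
  exact hf.supp.comp_left (g := fun r : ℝ => r ^ 2) (by simp)

theorem gradNormSq_eq (hf : IsLipBump f) : gradNormSq (fun x => (f x : ℂ)) = dirichlet f :=
  gradNormSq_ofReal hf.lip.choose_spec

theorem mass_eq (_hf : IsLipBump f) : mass (fun x => (f x : ℂ)) = ∫ x, f x ^ 2 := by
  simp [mass]

theorem powInt_eq (hf : IsLipBump f) (q : ℝ) :
    powInt q (fun x => (f x : ℂ)) = ∫ x, f x ^ q := by
  simp [powInt, abs_of_nonneg (hf.nonneg _)]

theorem mem_massShell (hf : IsLipBump f) (p₀ : ℝ) :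
    (fun x => (f x : ℂ)) ∈ massShell d p₀ (∫ x, f x ^ 2) :=
  ⟨hf.memH1, hf.memLp_ofReal _, hf.mass_eq⟩

theorem dirichlet_mono (hf : IsLipBump f) (hg : IsLipBump g)
    (h : ∀ x y, |g y - g x| ≤ |f y - f x|) : dirichlet g ≤ dirichlet f := by
  refine integral_mono_ae hg.integrable_fderiv_sq hf.integrable_fderiv_sq ?_
  filter_upwards [ae_norm_fderiv_le_of_contraction hf.lip.choose_spec hg.lip.choose_spec h]
    with x hx
  exact pow_le_pow_left₀ (norm_nonneg _) hx 2

end IsLipBump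

/-! ### Weak limits and lower semicontinuity of the Dirichlet integral -/

/-- Bounded sequences in a Hilbert space have weak limits along an ultrafilter. -/
theorem exists_weak_limit {H : Type*} [NormedAddCommGroup H] [InnerProductSpace ℝ H]
    [CompleteSpace H] (𝒰 : Ultrafilter ℕ) (g : ℕ → H) (R : ℕ → ℝ) {R₀ : ℝ}
    (hg : ∀ n, ‖g n‖ ≤ R n) (hR : Tendsto R 𝒰 (𝓝 R₀)) {B : ℝ} (hB : ∀ n, R n ≤ B) :
    ∃ G : H, ‖G‖ ≤ R₀ ∧ ∀ φ : H, Tendsto (fun n => ⟪g n, φ⟫_ℝ) 𝒰 (𝓝 ⟪G, φ⟫_ℝ) := by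
  let T : ℕ → WeakDual ℝ H := fun n => StrongDual.toWeakDual (InnerProductSpace.toDual ℝ H (g n))
  -- Banach–Alaoglu in the fixed ball of radius `B`; the sharper bound `R₀` comes afterwards, by
  -- passing to the limit in |⟪g n, φ⟫| ≤ R n ‖φ‖.
  have hc := WeakDual.isCompact_closedBall (𝕜 := ℝ) (E := H) 0 B
  obtain ⟨S, hS, hlim⟩ := hc.ultrafilter_le_nhds (𝒰.map T) (by
    rw [le_principal_iff]
    refine mem_map.2 (Filter.univ_mem' fun n => ?_)
    simp only [mem_preimage, Metric.mem_closedBall, dist_zero_right, T]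
    refine le_trans ?_ ((hg n).trans (hB n))
    exact (LinearIsometryEquiv.norm_map (InnerProductSpace.toDual ℝ H) (g n)).le)
  have hev : ∀ φ : H, Tendsto (fun n => ⟪g n, φ⟫_ℝ) 𝒰 (𝓝 (S φ)) := by
    intro φ
    have h1 : Tendsto T 𝒰 (𝓝 S) := hlim
    exact ((WeakDual.eval_continuous φ).tendsto S).comp h1
  refine ⟨(InnerProductSpace.toDual ℝ H).symm (WeakDual.toStrongDual S), ?_, ?_⟩
  · rw [LinearIsometryEquiv.norm_map]
    have hR0 : 0 ≤ R₀ := ge_of_tendsto' hR fun n => (norm_nonneg _).trans (hg n)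
    refine ContinuousLinearMap.opNorm_le_bound _ hR0 fun φ => ?_
    refine le_of_tendsto_of_tendsto' (hev φ).norm (hR.mul_const ‖φ‖) fun n => ?_
    exact (norm_inner_le_norm _ _).trans (mul_le_mul_of_nonneg_right (hg n) (norm_nonneg _))
  · intro φ
    have : ⟪(InnerProductSpace.toDual ℝ H).symm (WeakDual.toStrongDual S), φ⟫_ℝ = S φ := by
      rw [InnerProductSpace.toDual_symm_apply]; rfl
    rw [this]; exact hev φ

/-- Real gradient of a real function in Euclidean coordinates. -/
noncomputable def gradR (f : Space d → ℝ) (x : Space d) : Space d :=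
  WithLp.toLp 2 fun i => fderiv ℝ f x (EuclideanSpace.single i 1)

theorem norm_gradR (f : Space d → ℝ) (x : Space d) : ‖gradR f x‖ = ‖fderiv ℝ f x‖ := by
  rw [← sq_eq_sq₀ (norm_nonneg _) (norm_nonneg _), norm_sq_clm, EuclideanSpace.norm_sq_eq]
  simp [gradR]

theorem measurable_gradR (f : Space d → ℝ) : Measurable (gradR f) := by
  unfold gradR
  refine (WithLp.measurable_toLp 2 _).comp (measurable_pi_lambda _ fun i => ?_)
  exact measurable_fderiv_apply_const ℝ f _

theorem IsLipBump.memLp_gradR {f : Space d → ℝ} (hf : IsLipBump f) :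
    MemLp (gradR f) 2 volume := by
  refine (memLp_congr_norm (measurable_gradR f).aestronglyMeasurable
    (measurable_gradC f).aestronglyMeasurable ?_).2 (hf.memLp_gradC 2)
  exact Eventually.of_forall fun x => by rw [norm_gradR, norm_gradC]

theorem norm_toLp_sq {E : Type*} [NormedAddCommGroup E] {G : Space d → E} (hG : MemLp G 2 volume) :
    ‖hG.toLp G‖ ^ 2 = ∫ x, ‖G x‖ ^ 2 := by
  rw [Lp.norm_toLp, hG.eLpNorm_eq_integral_rpow_norm (by norm_num) (by norm_num),
    ENNReal.toReal_ofReal (by positivity)]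
  rw [← Real.rpow_natCast, ← Real.rpow_mul (by positivity)]
  norm_num

/-- A pointwise limit of locally dominated bumps with bounded Dirichlet integral has a weak
gradient, and the Dirichlet integral is lower semicontinuous. -/
theorem exists_weakGradient_of_tendsto {v : ℕ → Space d → ℝ} {u : Space d → ℝ} {C : ℕ → ℝ}
    {C₀ B : ℝ} (hv : ∀ n, IsLipBump (v n)) (hC : ∀ n, dirichlet (v n) ≤ C n)
    (hC0 : Tendsto C atTop (𝓝 C₀)) (hB : ∀ n x, v n x ≤ B)
    (hlim : ∀ᵐ x, Tendsto (fun n => v n x) atTop (𝓝 (u x))) :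
    ∃ G : Space d → EuclideanSpace ℂ (Fin d), MemLp G 2 volume ∧
      IsWeakGradient (fun x => (u x : ℂ)) G ∧ ∫ x, ‖G x‖ ^ 2 ≤ C₀ := by
  have hum : AEStronglyMeasurable u volume :=
    aestronglyMeasurable_of_tendsto_ae atTop
      (fun n => (hv n).continuous.aestronglyMeasurable) hlim
  have hub : ∀ᵐ x, ‖u x‖ ≤ ‖B‖ := by
    filter_upwards [hlim] with x hx
    have h0 : 0 ≤ u x := ge_of_tendsto' hx fun n => (hv n).nonneg x
    have h1 : u x ≤ B := le_of_tendsto' hx fun n => hB n x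
    rw [Real.norm_of_nonneg h0, Real.norm_of_nonneg (h0.trans h1)]
    exact h1
  have huloc : LocallyIntegrable u volume :=
    (locallyIntegrable_const B).mono hum hub
  obtain ⟨C', hC'⟩ := hC0.bddAbove_range
  have hC0' : 0 ≤ C₀ := ge_of_tendsto' hC0 fun n => (dirichlet_nonneg _).trans (hC n)
  let g : ℕ → Lp (Space d) 2 (volume : Measure (Space d)) := fun n =>
    (hv n).memLp_gradR.toLp (gradR (v n))
  have hg : ∀ n, ‖g n‖ ≤ Real.sqrt (C n) := by
    intro n
    refine Real.le_sqrt_of_sq_le ?_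
    rw [norm_toLp_sq]
    simpa [norm_gradR, dirichlet] using hC n
  -- A nonprincipal ultrafilter replaces the extraction of a subsequence: everything else converges
  -- along `atTop`, hence also along it.
  have hle : ((hyperfilter ℕ : Ultrafilter ℕ) : Filter ℕ) ≤ atTop := Nat.hyperfilter_le_atTop
  obtain ⟨G, hGn, hG⟩ := exists_weak_limit (hyperfilter ℕ) g (fun n => Real.sqrt (C n))
    (R₀ := Real.sqrt C₀) hg
    (((Real.continuous_sqrt.tendsto C₀).comp hC0).mono_left hle)
    (B := Real.sqrt C') (fun n => Real.sqrt_le_sqrt (hC' ⟨n, rfl⟩))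
  have hGm := Lp.memLp G
  have hnorm : ∀ x, ‖(WithLp.toLp 2 fun i => ((G x i : ℝ) : ℂ) :
      EuclideanSpace ℂ (Fin d))‖ = ‖G x‖ := by
    intro x
    rw [EuclideanSpace.norm_eq, EuclideanSpace.norm_eq]
    simp
  have hmeas : AEStronglyMeasurable (fun x => (WithLp.toLp 2 fun i => ((G x i : ℝ) : ℂ) :
      EuclideanSpace ℂ (Fin d))) volume := by
    have hc : Continuous fun y : Space d => (WithLp.toLp 2 fun i => ((y i : ℝ) : ℂ) :
      EuclideanSpace ℂ (Fin d)) := by fun_prop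
    exact hc.comp_aestronglyMeasurable hGm.1
  refine ⟨fun x => WithLp.toLp 2 fun i => ((G x i : ℝ) : ℂ), ?_, ?_, ?_⟩
  · exact (memLp_congr_norm hmeas hGm.1 (Eventually.of_forall hnorm)).2 hGm
  · have hGloc : LocallyIntegrable G volume := hGm.locallyIntegrable (by norm_num)
    refine ⟨?_, hGloc.mono hmeas (Eventually.of_forall fun x => (hnorm x).le), ?_⟩
    · refine huloc.mono (Complex.continuous_ofReal.comp_aestronglyMeasurable hum) ?_
      exact Eventually.of_forall fun x => by simp
    intro φ hφ hc i
    have hφL : MemLp (fun x => φ x • (EuclideanSpace.single i (1 : ℝ) : Space d)) 2 volume := by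
      refine Continuous.memLp_of_hasCompactSupport ?_ ?_
      · exact hφ.continuous.smul continuous_const
      · exact hc.smul_right
    have h1 := hG (hφL.toLp _)
    have hin : ∀ F : Lp (Space d) 2 (volume : Measure (Space d)),
        ⟪F, hφL.toLp _⟫_ℝ = ∫ x, φ x * F x i := by
      intro F
      rw [L2.inner_def]
      refine integral_congr_ae ?_
      filter_upwards [hφL.coeFn_toLp] with x hx
      rw [hx, inner_smul_right, EuclideanSpace.inner_single_right]
      simp
    have h2 : ∀ n, ⟪g n, hφL.toLp _⟫_ℝ
        = -∫ x, (fderiv ℝ φ x (EuclideanSpace.single i 1)) * v n x := by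
      intro n
      rw [hin]
      have h3 := (isWeakGradient_of_lipschitz (hv n).lip.choose_spec).2.2 φ hφ hc i
      have h4 : ∫ x, φ x • gradC (v n) x i = ((∫ x, φ x * (g n : Space d → Space d) x i : ℝ) : ℂ) := by
        rw [← integral_complex_ofReal]
        refine integral_congr_ae ?_
        filter_upwards [(hv n).memLp_gradR.coeFn_toLp] with x hx
        simp [gradC, g, hx, gradR]
      have h5 : ∫ x, (fderiv ℝ φ x (EuclideanSpace.single i 1)) • (v n x : ℂ)
          = ((∫ x, (fderiv ℝ φ x (EuclideanSpace.single i 1)) * v n x : ℝ) : ℂ) := by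
        rw [← integral_complex_ofReal]
        refine integral_congr_ae (Eventually.of_forall fun x => ?_)
        simp
      rw [h4, h5] at h3
      have h6 := congrArg Complex.re h3
      simp only [Complex.ofReal_re, Complex.neg_re] at h6
      linarith
    have hψ : Continuous fun x => fderiv ℝ φ x (EuclideanSpace.single i 1) :=
      (hφ.continuous_fderiv (by simp)).clm_apply continuous_const
    have hψc : HasCompactSupport fun x => fderiv ℝ φ x (EuclideanSpace.single i 1) :=
      hc.fderiv_apply ℝ _
    have h7 : Tendsto (fun n => ∫ x, (fderiv ℝ φ x (EuclideanSpace.single i 1)) * v n x) atTop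
        (𝓝 (∫ x, (fderiv ℝ φ x (EuclideanSpace.single i 1)) * u x)) := by
      refine tendsto_integral_of_dominated_convergence
        (fun x => ‖fderiv ℝ φ x (EuclideanSpace.single i 1)‖ * B) ?_ ?_ ?_ ?_
      · exact fun n => (hψ.mul (hv n).continuous).aestronglyMeasurable
      · exact (hψ.integrable_of_hasCompactSupport hψc).norm.mul_const B
      · refine fun n => Eventually.of_forall fun x => ?_
        rw [norm_mul, Real.norm_of_nonneg ((hv n).nonneg x)]
        exact mul_le_mul_of_nonneg_left (hB n x) (norm_nonneg _)
      · filter_upwards [hlim] with x hx using hx.const_mul _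
    -- Uniqueness of limits along the ultrafilter: the left side is the weak limit of gradients, the
    -- right side the dominated limit after integration by parts.
    have h8 : ∫ x, φ x * G x i
        = -∫ x, (fderiv ℝ φ x (EuclideanSpace.single i 1)) * u x := by
      rw [← hin]
      refine tendsto_nhds_unique h1 ?_
      simp_rw [h2]
      exact (h7.neg).mono_left hle
    have h9 : ∫ x, (fderiv ℝ φ x (EuclideanSpace.single i 1)) • (u x : ℂ)
          = ((∫ x, (fderiv ℝ φ x (EuclideanSpace.single i 1)) * u x : ℝ) : ℂ) := by
        rw [← integral_complex_ofReal]
        refine integral_congr_ae (Eventually.of_forall fun x => ?_)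
        simp
    have h10 : ∫ x, φ x • ((G x i : ℝ) : ℂ) = ((∫ x, φ x * G x i : ℝ) : ℂ) := by
        rw [← integral_complex_ofReal]
        refine integral_congr_ae (Eventually.of_forall fun x => ?_)
        simp
    change ∫ x, (fderiv ℝ φ x (EuclideanSpace.single i 1)) • (u x : ℂ)
      = -∫ x, φ x • ((G x i : ℝ) : ℂ)
    rw [h9, h10, h8]
    simp
  · simp_rw [hnorm]
    rw [← norm_toLp_sq hGm, Lp.toLp_coeFn]
    exact (pow_le_pow_left₀ (norm_nonneg _) hGn 2).trans (Real.sq_sqrt hC0').le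

/-! ### The combined-power functional and dilations -/

/-- The combined-power functional `‖∇u‖² - a ∫|u|^{q₁} + b ∫|u|^{q₀}`. -/
noncomputable def functional (a b q₁ q₀ : ℝ) (u : Space d → ℂ) : ℝ :=
  gradNormSq u - a * powInt q₁ u + b * powInt q₀ u

theorem memLp_comp_smul {E : Type*} [NormedAddCommGroup E] {u : Space d → E} {p : ℝ≥0∞}
    (hu : MemLp u p volume) {B : ℝ} (hB : 0 < B) : MemLp (fun x => u (B • x)) p volume := by
  have h1 : MemLp u p (Measure.map (B • ·) (volume : Measure (Space d))) := by
    rw [Measure.map_addHaar_smul _ hB.ne']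
    exact hu.smul_measure ENNReal.ofReal_ne_top
  exact (memLp_map_measure_iff h1.1 (measurable_const_smul B).aemeasurable).1 h1

theorem integral_comp_dilation {F : Type*} [NormedAddCommGroup F] [NormedSpace ℝ F]
    (f : Space d → F) {B : ℝ} (hB : 0 < B) :
    ∫ x, f (B • x) = (B ^ d)⁻¹ • ∫ x, f x := by
  rw [Measure.integral_comp_smul]
  simp [abs_of_pos hB]

/-- Test the original identity against φ(B⁻¹·) and change variables on both sides. -/
theorem IsWeakGradient.dilate {u : Space d → ℂ} {G : Space d → EuclideanSpace ℂ (Fin d)}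
    (hG : IsWeakGradient u G) (hu2 : MemLp u 2 volume) (hG2 : MemLp G 2 volume) (A : ℝ) {B : ℝ}
    (hB : 0 < B) : IsWeakGradient (fun x => A • u (B • x)) (fun x => (A * B) • G (B • x)) := by
  refine ⟨((memLp_comp_smul hu2 hB).const_smul A).locallyIntegrable (by norm_num),
    ((memLp_comp_smul hG2 hB).const_smul (A * B)).locallyIntegrable (by norm_num), ?_⟩
  intro φ hφ hc i
  have hφ' : ContDiff ℝ ∞ fun y : Space d => φ (B⁻¹ • y) := hφ.comp (contDiff_const_smul _)
  have hc' : HasCompactSupport fun y : Space d => φ (B⁻¹ • y) :=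
    hc.comp_smul (inv_ne_zero hB.ne')
  have h := hG.2.2 _ hφ' hc' i
  have hd : ∀ y : Space d, fderiv ℝ (fun y : Space d => φ (B⁻¹ • y)) y (EuclideanSpace.single i 1)
      = B⁻¹ * fderiv ℝ φ (B⁻¹ • y) (EuclideanSpace.single i 1) := by
    intro y
    rw [fderiv_comp_smul]; simp
  simp_rw [hd] at h
  have hx : ∀ x : Space d, B⁻¹ • B • x = x := fun x => inv_smul_smul₀ hB.ne' x
  have e1 := integral_comp_dilation (fun y : Space d =>
    (fderiv ℝ φ (B⁻¹ • y) (EuclideanSpace.single i 1)) • (A • u y)) hB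
  have e2 := integral_comp_dilation (fun y : Space d =>
    φ (B⁻¹ • y) • (((A * B) • G y) i)) hB
  simp only [hx] at e1 e2
  change ∫ x, (fderiv ℝ φ x (EuclideanSpace.single i 1)) • (A • u (B • x))
    = -∫ x, φ x • (((A * B) • G (B • x)) i)
  rw [e1, e2]
  have e3 : ∫ y, (fderiv ℝ φ (B⁻¹ • y) (EuclideanSpace.single i 1)) • (A • u y)
      = (A * B) • ∫ y, (B⁻¹ * fderiv ℝ φ (B⁻¹ • y) (EuclideanSpace.single i 1)) • u y := by
    rw [← integral_smul]
    congr 1; ext y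
    rw [smul_smul, smul_smul]; congr 1; field_simp
  have e4 : ∫ y, φ (B⁻¹ • y) • (((A * B) • G y) i) = (A * B) • ∫ y, φ (B⁻¹ • y) • G y i := by
    rw [← integral_smul]
    congr 1; ext y
    rw [PiLp.smul_apply, smul_comm]
  rw [e3, e4, h]
  simp

theorem mass_dilate (u : Space d → ℂ) (A : ℝ) {B : ℝ} (hB : 0 < B) :
    mass (fun x => A • u (B • x)) = A ^ 2 * (B ^ d)⁻¹ * mass u := by
  unfold mass
  rw [integral_comp_dilation (fun x => ‖A • u x‖ ^ 2) hB]
  simp_rw [norm_smul, mul_pow, Real.norm_eq_abs, sq_abs, integral_const_mul, smul_eq_mul]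
  ring

theorem powInt_dilate (u : Space d → ℂ) {A : ℝ} (hA : 0 ≤ A) {B : ℝ} (hB : 0 < B) (q : ℝ) :
    powInt q (fun x => A • u (B • x)) = A ^ q * (B ^ d)⁻¹ * powInt q u := by
  unfold powInt
  rw [integral_comp_dilation (fun x => ‖A • u x‖ ^ q) hB]
  simp_rw [norm_smul, Real.norm_of_nonneg hA, Real.mul_rpow hA (norm_nonneg _),
    integral_const_mul, smul_eq_mul]
  ring

theorem MemH1.dilate {u : Space d → ℂ} (hu : MemH1 u) (A : ℝ) {B : ℝ} (hB : 0 < B) :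
    MemH1 (fun x => A • u (B • x)) := by
  obtain ⟨hu2, G, hG2, hG⟩ := hu
  exact ⟨(memLp_comp_smul hu2 hB).const_smul A, _, (memLp_comp_smul hG2 hB).const_smul (A * B),
    hG.dilate hu2 hG2 A hB⟩

theorem gradNormSq_dilate {u : Space d → ℂ} (hu : MemH1 u) (A : ℝ) {B : ℝ} (hB : 0 < B) :
    gradNormSq (fun x => A • u (B • x)) = A ^ 2 * B ^ 2 * (B ^ d)⁻¹ * gradNormSq u := by
  obtain ⟨hu2, G, hG2, hG⟩ := hu
  rw [gradNormSq_eq (hG.dilate hu2 hG2 A hB), gradNormSq_eq hG,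
    integral_comp_dilation (fun x => ‖(A * B) • G x‖ ^ 2) hB]
  simp_rw [norm_smul, mul_pow, Real.norm_eq_abs, sq_abs, integral_const_mul, smul_eq_mul]
  ring

theorem mem_massShell_dilate {u : Space d → ℂ} {p₀ m : ℝ} (hu : u ∈ massShell d p₀ m) (A : ℝ)
    {B : ℝ} (hB : 0 < B) :
    (fun x => A • u (B • x)) ∈ massShell d p₀ (A ^ 2 * (B ^ d)⁻¹ * m) := by
  refine ⟨hu.1.dilate A hB, (memLp_comp_smul hu.2.1 hB).const_smul A, ?_⟩
  rw [mass_dilate _ _ hB, hu.2.2]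

theorem IsLipBump.dilate {f : Space d → ℝ} (hf : IsLipBump f) {A B : ℝ} (hA : 0 ≤ A)
    (hB : 0 < B) : IsLipBump fun x => A * f (B • x) := by
  obtain ⟨K, hK⟩ := hf.lip
  refine ⟨⟨‖A‖₊ * (K * ‖B‖₊), ?_⟩, ?_, fun x => mul_nonneg hA (hf.nonneg _)⟩
  · have h1 : LipschitzWith (K * ‖B‖₊) fun x : Space d => f (B • x) :=
      hK.comp (lipschitzWith_smul B)
    exact (lipschitzWith_smul A).comp h1
  · exact (hf.supp.comp_smul hB.ne').mul_left

theorem IsLipBump.dilate_coe (f : Space d → ℝ) (A B : ℝ) :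
    (fun x => ((A * f (B • x) : ℝ) : ℂ)) = fun x => A • ((f (B • x) : ℝ) : ℂ) := by
  ext x; simp

theorem functional_dilate {u : Space d → ℂ} (hu : MemH1 u) {A B : ℝ} (hA : 0 ≤ A) (hB : 0 < B)
    (a b q₁ q₀ : ℝ) : functional a b q₁ q₀ (fun x => A • u (B • x)) =
      (B ^ d)⁻¹ * (A ^ 2 * B ^ 2 * gradNormSq u - a * A ^ q₁ * powInt q₁ u
        + b * A ^ q₀ * powInt q₀ u) := by
  unfold functional
  rw [gradNormSq_dilate hu _ hB, powInt_dilate _ hA hB, powInt_dilate _ hA hB]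
  ring

theorem mass_nonneg (u : Space d → ℂ) : 0 ≤ mass u := integral_nonneg fun _ => by positivity

theorem powInt_nonneg (q : ℝ) (u : Space d → ℂ) : 0 ≤ powInt q u :=
  integral_nonneg fun _ => Real.rpow_nonneg (norm_nonneg _) _

theorem integrable_rpow_of_memLp {u : Space d → ℂ} {q : ℝ} (hq : 0 < q)
    (hu : MemLp u (ENNReal.ofReal q) volume) : Integrable fun x => ‖u x‖ ^ q := by
  have := hu.integrable_norm_rpow (by simpa using hq) ENNReal.ofReal_ne_top
  rwa [ENNReal.toReal_ofReal hq.le] at this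

theorem integrable_sq_of_memLp {u : Space d → ℂ} (hu : MemLp u 2 volume) :
    Integrable fun x => ‖u x‖ ^ 2 := hu.integrable_norm_pow (p := 2) (by norm_num)

/-- The square dominates for s ≤ 1 and the top power for s ≥ 1; this crude interpolation makes every
intermediate power integrable. -/
theorem rpow_le_sq_add_rpow {s q₁ q₀ : ℝ} (hs : 0 ≤ s) (h1 : 2 ≤ q₁) (h0 : q₁ ≤ q₀) :
    s ^ q₁ ≤ s ^ 2 + s ^ q₀ := by
  rcases le_total s 1 with h | h
  · have : s ^ q₁ ≤ s ^ (2 : ℝ) := by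
      rcases hs.eq_or_lt with rfl | hs'
      · rw [Real.zero_rpow (by linarith), Real.zero_rpow (by norm_num)]
      · exact Real.rpow_le_rpow_of_exponent_ge hs' h h1
    rw [Real.rpow_two] at this
    linarith [Real.rpow_nonneg hs q₀]
  · have := Real.rpow_le_rpow_of_exponent_le h h0
    nlinarith [sq_nonneg s]

theorem integrable_rpow_of_massShell {u : Space d → ℂ} {q₁ q₀ : ℝ} (h1 : 2 ≤ q₁) (h0 : q₁ ≤ q₀)
    (hu2 : MemLp u 2 volume) (hu : MemLp u (ENNReal.ofReal q₀) volume) :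
    Integrable fun x => ‖u x‖ ^ q₁ := by
  refine ((integrable_sq_of_memLp hu2).add (integrable_rpow_of_memLp (by linarith) hu)).mono' ?_ ?_
  · exact (hu2.1.norm.aemeasurable.pow_const _).aestronglyMeasurable
  · refine Eventually.of_forall fun x => ?_
    rw [Real.norm_of_nonneg (Real.rpow_nonneg (norm_nonneg _) _)]
    exact rpow_le_sq_add_rpow (norm_nonneg _) h1 h0

/-! ### Admissible coefficients and lower bounds -/

/-- Exponents and coefficients of an admissible combined-power functional. -/
structure Admissible (d : ℕ) (a b q₁ q₀ : ℝ) : Prop where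
  dim : 1 ≤ d
  ha : 0 < a
  hb : 0 < b
  supercritical : 2 + 4 / (d : ℝ) < q₁
  lt : q₁ < q₀

namespace Admissible
variable {a b q₁ q₀ : ℝ}

theorem two_lt (h : Admissible d a b q₁ q₀) : 2 < q₁ := by
  have : 0 < 4 / (d : ℝ) := by
    have : (0 : ℝ) < d := by exact_mod_cast h.dim
    positivity
  linarith [h.supercritical]

theorem two_lt' (h : Admissible d a b q₁ q₀) : 2 < q₀ := h.two_lt.trans h.lt

/-- Above some level the nonlinear density `-a s^{q₁} + b s^{q₀}` is nondecreasing. -/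
theorem exists_cutoff (h : Admissible d a b q₁ q₀) : ∃ K : ℝ, 0 < K ∧ ∀ s, 0 ≤ s →
    -a * (min s K) ^ q₁ + b * (min s K) ^ q₀ ≤ -a * s ^ q₁ + b * s ^ q₀ := by
  have hab : 0 < a / b := div_pos h.ha h.hb
  have hδ : 0 < q₀ - q₁ := sub_pos.2 h.lt
  -- `K` is the positive zero of the density −a s^{q₁} + b s^{q₀}: truncation at `K` replaces
  -- nonnegative values by zero and leaves the rest alone.
  refine ⟨(a / b) ^ (q₀ - q₁)⁻¹, by positivity, fun s hs => ?_⟩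
  set K := (a / b) ^ (q₀ - q₁)⁻¹ with hK
  have hK0 : 0 < K := by positivity
  rcases le_total s K with hsK | hsK
  · rw [min_eq_left hsK]
  rw [min_eq_right hsK]
  have hq1 : 0 < q₁ := by linarith [h.two_lt]
  have e : ∀ t, 0 < t → -a * t ^ q₁ + b * t ^ q₀ = b * t ^ q₁ * (t ^ (q₀ - q₁) - a / b) := by
    intro t ht
    rw [Real.rpow_sub ht]
    have := h.hb
    have : t ^ q₁ ≠ 0 := (Real.rpow_pos_of_pos ht _).ne'
    field_simp
    ring
  have eK : K ^ (q₀ - q₁) = a / b := by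
    rw [hK, ← Real.rpow_mul hab.le, inv_mul_cancel₀ hδ.ne', Real.rpow_one]
  rw [e K hK0, e s (hK0.trans_le hsK), eK, sub_self, mul_zero]
  have : a / b ≤ s ^ (q₀ - q₁) := by
    rw [← eK]; exact Real.rpow_le_rpow hK0.le hsK hδ.le
  have := Real.rpow_nonneg hs q₁
  have := h.hb
  apply mul_nonneg
  · positivity
  · linarith

/-- The functional is bounded below by a multiple of the mass. -/
theorem exists_density_lower_bound (h : Admissible d a b q₁ q₀) : ∃ C : ℝ, 0 ≤ C ∧ ∀ s, 0 ≤ s →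
    -C * s ^ 2 ≤ -a * s ^ q₁ + b * s ^ q₀ := by
  obtain ⟨K, hK, hKs⟩ := h.exists_cutoff
  -- The constant comes from min(s,K)^{q₁} ≤ K^{q₁−2} s², after dropping the positive term.
  refine ⟨a * K ^ (q₁ - 2), by have := h.ha; positivity, fun s hs => le_trans ?_ (hKs s hs)⟩
  have hmin : 0 ≤ min s K := le_min hs hK.le
  have h2 : (min s K) ^ q₁ ≤ K ^ (q₁ - 2) * s ^ 2 := by
    rcases hmin.eq_or_lt with h0 | h0
    · rw [← h0, Real.zero_rpow (by linarith [h.two_lt])]; positivity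
    have : (min s K) ^ q₁ = (min s K) ^ (q₁ - 2) * (min s K) ^ 2 := by
      rw [← Real.rpow_two, ← Real.rpow_add h0]; congr 1; ring
    rw [this]
    have := h.two_lt
    gcongr
    · exact min_le_right _ _
    · exact min_le_left _ _
  have := h.hb
  have := h.ha
  have h3 : 0 ≤ b * (min s K) ^ q₀ := by positivity
  nlinarith

theorem functional_lower_bound (h : Admissible d a b q₁ q₀) : ∃ C : ℝ, 0 ≤ C ∧
    ∀ u : Space d → ℂ, MemLp u 2 volume → MemLp u (ENNReal.ofReal q₀) volume →
      gradNormSq u - C * mass u ≤ functional a b q₁ q₀ u := by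
  obtain ⟨C, hC, hs⟩ := h.exists_density_lower_bound
  refine ⟨C, hC, fun u hu2 hu => ?_⟩
  have i1 := integrable_rpow_of_massShell h.two_lt.le h.lt.le hu2 hu
  have i0 := integrable_rpow_of_memLp (by linarith [h.two_lt']) hu
  have i2 := integrable_sq_of_memLp hu2
  have key : ∫ x, -C * ‖u x‖ ^ 2 ≤ ∫ x, (-a * ‖u x‖ ^ q₁ + b * ‖u x‖ ^ q₀) :=
    integral_mono (i2.const_mul _) ((i1.const_mul _).add (i0.const_mul _))
      fun x => hs _ (norm_nonneg _)
  rw [integral_add (i1.const_mul _) (i0.const_mul _), integral_const_mul, integral_const_mul,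
    integral_const_mul] at key
  unfold functional mass powInt
  linarith

end Admissible

/-! ### Reflections across hyperplanes -/

/-- Reflection across the hyperplane `⟪e, x⟫ = c`, for a unit vector `e`. -/
noncomputable def hrefl (e : Space d) (c : ℝ) (x : Space d) : Space d :=
  x - (2 * (⟪e, x⟫_ℝ - c)) • e

section reflection
variable {e : Space d} (he : ‖e‖ = 1) (c : ℝ)
include he

theorem inner_hrefl (x : Space d) : ⟪e, hrefl e c x⟫_ℝ = 2 * c - ⟪e, x⟫_ℝ := by
  unfold hrefl
  rw [inner_sub_right, inner_smul_right, real_inner_self_eq_norm_sq, he]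
  ring

theorem hrefl_hrefl (x : Space d) : hrefl e c (hrefl e c x) = x := by
  conv_lhs => unfold hrefl
  rw [show x - (2 * (⟪e, x⟫_ℝ - c)) • e = hrefl e c x from rfl, inner_hrefl he]
  unfold hrefl
  module

theorem hrefl_eq (x : Space d) :
    hrefl e c x = ((ℝ ∙ e)ᗮ).reflection x + (2 * c) • e := by
  rw [Submodule.reflection_orthogonal_apply, Submodule.reflection_singleton_apply]
  unfold hrefl
  simp only [he]
  norm_num
  module

theorem measurePreserving_hrefl : MeasurePreserving (hrefl e c) volume volume := by
  have h1 := (((ℝ ∙ e)ᗮ).reflection).measurePreserving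
  have h2 := measurePreserving_add_right (volume : Measure (Space d)) ((2 * c) • e)
  have := h2.comp h1
  rwa [show hrefl e c = _ from funext (hrefl_eq he c)]

theorem norm_hrefl_sub (x y : Space d) : ‖hrefl e c x - hrefl e c y‖ = ‖x - y‖ := by
  rw [hrefl_eq he, hrefl_eq he, add_sub_add_right_eq_sub, ← map_sub, LinearIsometryEquiv.norm_map]

/-- Moving `y` to the side of `x` can only bring it closer. This two-point inequality is what makes
glued functions Lipschitz with the same constant. -/
theorem norm_sub_hrefl_le {x y : Space d} (hx : ⟪e, x⟫_ℝ ≤ c) (hy : c ≤ ⟪e, y⟫_ℝ) :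
    ‖x - hrefl e c y‖ ≤ ‖x - y‖ := by
  rw [← sq_le_sq₀ (norm_nonneg _) (norm_nonneg _)]
  have : x - hrefl e c y = (x - y) + (2 * (⟪e, y⟫_ℝ - c)) • e := by unfold hrefl; abel
  rw [this, norm_add_sq_real, inner_smul_right, norm_smul, he, inner_sub_left,
    real_inner_comm e x, real_inner_comm e y, Real.norm_eq_abs, mul_one, sq_abs]
  nlinarith [mul_nonneg (sub_nonneg.2 hx) (sub_nonneg.2 hy)]

/-- For c > 0 the origin lies on the side ⟪e, x⟫ < c, and the formula shows that reflecting such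
points moves them strictly outward. -/
theorem norm_sq_hrefl (x : Space d) :
    ‖hrefl e c x‖ ^ 2 = ‖x‖ ^ 2 + 4 * c * (c - ⟪e, x⟫_ℝ) := by
  unfold hrefl
  rw [norm_sub_sq_real, inner_smul_right, norm_smul, he, real_inner_comm e x, Real.norm_eq_abs,
    mul_one, sq_abs]
  ring

omit he in
theorem continuous_hrefl : Continuous (hrefl e c) := by
  unfold hrefl; fun_prop

theorem measurableEmbedding_hrefl : MeasurableEmbedding (hrefl e c) := by
  let E : Space d ≃ₜ Space d :=
    ⟨⟨hrefl e c, hrefl e c, hrefl_hrefl he c, hrefl_hrefl he c⟩, continuous_hrefl c,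
      continuous_hrefl c⟩
  exact E.measurableEmbedding

theorem measure_hyperplane : volume {x : Space d | ⟪e, x⟫_ℝ = c} = 0 := by
  have h0 : volume (((ℝ ∙ e)ᗮ : Submodule ℝ (Space d)) : Set (Space d)) = 0 := by
    refine Measure.addHaar_submodule _ _ fun h => ?_
    have : e ∈ (ℝ ∙ e)ᗮ := by rw [h]; trivial
    rw [Submodule.mem_orthogonal_singleton_iff_inner_right, real_inner_self_eq_norm_sq, he] at this
    norm_num at this
  have h1 := measure_preimage_add_right (volume : Measure (Space d)) (-(c • e))
    (((ℝ ∙ e)ᗮ : Submodule ℝ (Space d)) : Set (Space d))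
  rw [h0] at h1
  convert h1 using 2
  ext x
  simp only [mem_ofPred_eq, mem_preimage, SetLike.mem_coe,
    Submodule.mem_orthogonal_singleton_iff_inner_right, inner_add_right, inner_neg_right,
    inner_smul_right,
    real_inner_self_eq_norm_sq, he]
  constructor <;> intro h <;> linarith

/-- Splitting an integral along a hyperplane. -/
theorem integral_eq_halfspace {Q : Space d → ℝ} (hQ : Integrable Q) :
    ∫ x, Q x = ∫ x in {x | ⟪e, x⟫_ℝ < c}, (Q x + Q (hrefl e c x)) := by
  have hm : MeasurableSet {x : Space d | ⟪e, x⟫_ℝ < c} :=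
    (isOpen_lt (by fun_prop) continuous_const).measurableSet
  have hQr : Integrable fun x => Q (hrefl e c x) :=
    (measurePreserving_hrefl he c).integrable_comp_of_integrable hQ
  rw [integral_add hQ.integrableOn hQr.integrableOn, ← integral_add_compl hm hQ]
  congr 1
  have h1 := (measurePreserving_hrefl he c).setIntegral_preimage_emb
    (measurableEmbedding_hrefl he c) Q {x : Space d | c < ⟪e, x⟫_ℝ}
  have h2 : hrefl e c ⁻¹' {x : Space d | c < ⟪e, x⟫_ℝ} = {x | ⟪e, x⟫_ℝ < c} := by
    ext x
    simp only [mem_preimage, mem_ofPred_eq, inner_hrefl he]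
    constructor <;> intro h <;> linarith
  rw [h2] at h1
  rw [h1]
  refine setIntegral_congr_set ?_
  have h3 : ∀ᵐ x : Space d, ⟪e, x⟫_ℝ ≠ c := by
    rw [ae_iff]; simpa using measure_hyperplane he c
  filter_upwards [h3] with x hx
  refine propext ?_
  change ¬ (⟪e, x⟫_ℝ < c) ↔ c < ⟪e, x⟫_ℝ
  exact ⟨fun h => lt_of_le_of_ne (not_lt.1 h) hx.symm, fun h => not_lt.2 h.le⟩

/-- The derivative of the reflection is a linear isometry. No differentiability is needed: since the
reflection is an involution, failure of differentiability is transported too, and then both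
derivatives are zero by convention. -/
theorem norm_fderiv_comp_hrefl (k : Space d → ℝ) (x : Space d) :
    ‖fderiv ℝ (fun y => k (hrefl e c y)) x‖ = ‖fderiv ℝ k (hrefl e c x)‖ := by
  have hr : ∀ y, HasFDerivAt (hrefl e c)
      ((((ℝ ∙ e)ᗮ).reflection : Space d ≃L[ℝ] Space d) : Space d →L[ℝ] Space d) y := by
    intro y
    have : hrefl e c = fun x => ((ℝ ∙ e)ᗮ).reflection x + (2 * c) • e := by
      ext1 x; exact hrefl_eq he c x
    rw [this]
    exact (((((ℝ ∙ e)ᗮ).reflection : Space d ≃L[ℝ] Space d) :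
      Space d →L[ℝ] Space d).hasFDerivAt).add_const _
  have key : ∀ (k : Space d → ℝ) (x : Space d), DifferentiableAt ℝ k (hrefl e c x) →
      DifferentiableAt ℝ (fun y => k (hrefl e c y)) x := fun k x hk =>
    hk.comp x (hr x).differentiableAt
  by_cases hk : DifferentiableAt ℝ k (hrefl e c x)
  · have h1 := (hk.hasFDerivAt.comp x (hr x)).fderiv
    change fderiv ℝ (fun y => k (hrefl e c y)) x = _ at h1
    rw [h1]
    exact ContinuousLinearMap.opNorm_comp_linearIsometryEquiv _ _
  · rw [fderiv_zero_of_not_differentiableAt hk, fderiv_zero_of_not_differentiableAt]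
    intro h
    apply hk
    have := key (fun y => k (hrefl e c y)) (hrefl e c x) (by simpa [hrefl_hrefl he] using h)
    simpa [hrefl_hrefl he] using this

end reflection

/-! ### Gluing: polarization and folding -/

/-- The function equal to `Φ₁ (f, f ∘ σ)` on one side of a hyperplane and to `Φ₂ (f ∘ σ, f)` on the
other, `σ` being the reflection. -/
noncomputable def glue (Φ₁ Φ₂ : ℝ → ℝ → ℝ) (e : Space d) (c : ℝ) (f : Space d → ℝ)
    (x : Space d) : ℝ :=
  open Classical in
  if ⟪e, x⟫_ℝ < c then Φ₁ (f x) (f (hrefl e c x)) else Φ₂ (f (hrefl e c x)) (f x)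

/-- Conditions on `Φ₁, Φ₂` under which `glue` preserves Lipschitz bumps. -/
structure GlueData (Φ₁ Φ₂ : ℝ → ℝ → ℝ) : Prop where
  lip₁ : ∀ {a b a' b' M : ℝ}, |a - a'| ≤ M → |b - b'| ≤ M → |Φ₁ a b - Φ₁ a' b'| ≤ M
  lip₂ : ∀ {a b a' b' M : ℝ}, |a - a'| ≤ M → |b - b'| ≤ M → |Φ₂ a b - Φ₂ a' b'| ≤ M
  cross : ∀ {a b a' b' M : ℝ}, |a - a'| ≤ M → |b - b'| ≤ M → |a - b'| ≤ M → |b - a'| ≤ M →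
    |Φ₁ a b - Φ₂ a' b'| ≤ M
  zero₁ : Φ₁ 0 0 = 0
  zero₂ : Φ₂ 0 0 = 0
  nonneg₁ : ∀ {a b}, 0 ≤ a → 0 ≤ b → 0 ≤ Φ₁ a b
  nonneg₂ : ∀ {a b}, 0 ≤ a → 0 ≤ b → 0 ≤ Φ₂ a b

/-- Polarization: the larger of the values at mirror points goes to the side ⟪e, x⟫ < c. -/
theorem glueData_max_min : GlueData max min where
  lip₁ h1 h2 := (abs_max_sub_max_le_max _ _ _ _).trans (max_le h1 h2)
  lip₂ h1 h2 := (abs_min_sub_min_le_max _ _ _ _).trans (max_le h1 h2)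
  cross h1 h2 h3 h4 := by
    rename_i a b a' b' M
    rcases max_choice a b with h | h <;> rcases min_choice a' b' with h' | h' <;> rw [h, h'] <;>
      assumption
  zero₁ := by simp
  zero₂ := by simp
  nonneg₁ h1 _ := le_max_of_le_left h1
  nonneg₂ h1 h2 := le_min h1 h2

/-- Folding: the part of `f` on the side ⟪e, x⟫ < c is kept and reflected evenly. -/
theorem glueData_fst : GlueData (fun a _ => a) (fun a _ => a) where
  lip₁ h1 _ := h1
  lip₂ h1 _ := h1
  cross h1 _ _ _ := h1
  zero₁ := rfl
  zero₂ := rfl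
  nonneg₁ h1 _ := h1
  nonneg₂ h1 _ := h1

/-- Folding with the roles of the two sides exchanged. -/
theorem glueData_snd : GlueData (fun _ a => a) (fun _ a => a) where
  lip₁ _ h1 := h1
  lip₂ _ h1 := h1
  cross _ h1 _ _ := h1
  zero₁ := rfl
  zero₂ := rfl
  nonneg₁ _ h1 := h1
  nonneg₂ _ h1 := h1

section glue
variable {Φ₁ Φ₂ : ℝ → ℝ → ℝ} (hΦ : GlueData Φ₁ Φ₂) {e : Space d} (he : ‖e‖ = 1) (c : ℝ)
  {f : Space d → ℝ}

theorem glue_of_lt {x : Space d} (hx : ⟪e, x⟫_ℝ < c) :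
    glue Φ₁ Φ₂ e c f x = Φ₁ (f x) (f (hrefl e c x)) := if_pos hx

include he in
theorem glue_hrefl_of_lt {x : Space d} (hx : ⟪e, x⟫_ℝ < c) :
    glue Φ₁ Φ₂ e c f (hrefl e c x) = Φ₂ (f x) (f (hrefl e c x)) := by
  unfold glue
  rw [if_neg, hrefl_hrefl he]
  rw [inner_hrefl he]; linarith

include hΦ he

/-- For points on opposite sides, all four pairings of `x` and its mirror image with `y` and its
mirror image are at distance at most ‖x − y‖, so `cross` applies; on one side only the isometry
property is used. -/
theorem lipschitzWith_glue {K : ℝ≥0} (hf : LipschitzWith K f) :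
    LipschitzWith K (glue Φ₁ Φ₂ e c f) := by
  have hf' : ∀ x y, |f x - f y| ≤ K * ‖x - y‖ := fun x y => by
    simpa [Real.dist_eq, dist_eq_norm] using hf.dist_le_mul x y
  have hcross : ∀ x y : Space d, ⟪e, x⟫_ℝ < c → ¬ ⟪e, y⟫_ℝ < c →
      |Φ₁ (f x) (f (hrefl e c x)) - Φ₂ (f (hrefl e c y)) (f y)| ≤ K * ‖x - y‖ := by
    intro x y hx hy
    have h1 := norm_sub_hrefl_le he c hx.le (not_lt.1 hy)
    have h2 : ‖hrefl e c x - y‖ ≤ ‖x - y‖ := by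
      rw [← norm_hrefl_sub he c, hrefl_hrefl he]; exact h1
    refine hΦ.cross ((hf' _ _).trans ?_) ((hf' _ _).trans ?_) (hf' _ _) ((hf' _ _).trans ?_)
    · gcongr
    · gcongr
    · rw [norm_hrefl_sub he]
  refine LipschitzWith.of_dist_le_mul fun x y => ?_
  rw [Real.dist_eq, dist_eq_norm]
  unfold glue
  split_ifs with hx hy hy
  · exact hΦ.lip₁ (hf' _ _) ((hf' _ _).trans (by rw [norm_hrefl_sub he]))
  · exact hcross x y hx hy
  · rw [abs_sub_comm, norm_sub_rev]; exact hcross y x hy hx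
  · exact hΦ.lip₂ ((hf' _ _).trans (by rw [norm_hrefl_sub he])) (hf' _ _)

theorem IsLipBump.glue (hf : IsLipBump f) : IsLipBump (glue Φ₁ Φ₂ e c f) := by
  obtain ⟨K, hK⟩ := hf.lip
  refine ⟨⟨K, lipschitzWith_glue hΦ he c hK⟩, ?_, fun x => ?_⟩
  · have h2 : IsCompact (hrefl e c ⁻¹' tsupport f) := by
      have : hrefl e c ⁻¹' tsupport f = hrefl e c '' tsupport f :=
       
        (congrFun (image_eq_preimage_of_inverse (hrefl_hrefl he c) (hrefl_hrefl he c)) _).symm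
      rw [this]
      exact hf.supp.isCompact.image (continuous_hrefl c)
    refine HasCompactSupport.intro (hf.supp.isCompact.union h2) fun x hx => ?_
    have h3 : f x = 0 := image_eq_zero_of_notMem_tsupport fun h => hx (Or.inl h)
    have h4 : f (hrefl e c x) = 0 := image_eq_zero_of_notMem_tsupport fun h => hx (Or.inr h)
    unfold DoublePowerNLS.glue
    rw [h3, h4, hΦ.zero₁, hΦ.zero₂, ite_self]
  · unfold DoublePowerNLS.glue
    split_ifs
    · exact hΦ.nonneg₁ (hf.nonneg _) (hf.nonneg _)
    · exact hΦ.nonneg₂ (hf.nonneg _) (hf.nonneg _)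

/-- Derivatives are local and the open half-space determines the function near each of its points;
the other half is pulled back by the reflection, and the hyperplane is null. -/
theorem dirichlet_glue (hf : IsLipBump f) : dirichlet (glue Φ₁ Φ₂ e c f) =
    ∫ x in {x | ⟪e, x⟫_ℝ < c}, (‖fderiv ℝ (fun y => Φ₁ (f y) (f (hrefl e c y))) x‖ ^ 2
      + ‖fderiv ℝ (fun y => Φ₂ (f y) (f (hrefl e c y))) x‖ ^ 2) := by
  have ho : IsOpen {x : Space d | ⟪e, x⟫_ℝ < c} := isOpen_lt (by fun_prop) continuous_const
  unfold dirichlet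
  rw [integral_eq_halfspace he c (hf.glue hΦ he c).integrable_fderiv_sq]
  refine setIntegral_congr_fun ho.measurableSet fun x hx => ?_
  have h1 : DoublePowerNLS.glue Φ₁ Φ₂ e c f =ᶠ[𝓝 x] fun y => Φ₁ (f y) (f (hrefl e c y)) := by
    filter_upwards [ho.mem_nhds hx] with y hy using glue_of_lt c hy
  have h2 : (fun y => DoublePowerNLS.glue Φ₁ Φ₂ e c f (hrefl e c y))
      =ᶠ[𝓝 x] fun y => Φ₂ (f y) (f (hrefl e c y)) := by
    filter_upwards [ho.mem_nhds hx] with y hy using glue_hrefl_of_lt he c hy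
  rw [h1.fderiv_eq, ← norm_fderiv_comp_hrefl he, h2.fderiv_eq]

/-- The integrand may depend on the point, so that the second moment is covered as well as powers.
-/
theorem integral_glue (hf : IsLipBump f) (Q : Space d → ℝ → ℝ)
    (hQ : Continuous (Function.uncurry Q)) (hQ0 : ∀ x, Q x 0 = 0) :
    ∫ x, Q x (glue Φ₁ Φ₂ e c f x) = ∫ x in {x | ⟪e, x⟫_ℝ < c},
      (Q x (Φ₁ (f x) (f (hrefl e c x))) + Q (hrefl e c x) (Φ₂ (f x) (f (hrefl e c x)))) := by
  have ho : IsOpen {x : Space d | ⟪e, x⟫_ℝ < c} := isOpen_lt (by fun_prop) continuous_const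
  have hg := hf.glue hΦ he c
  rw [integral_eq_halfspace he c]
  · refine setIntegral_congr_fun ho.measurableSet fun x hx => ?_
    rw [glue_of_lt c hx, glue_hrefl_of_lt he c hx]
  · refine Continuous.integrable_of_hasCompactSupport (hQ.comp (continuous_id.prodMk hg.continuous)) ?_
    refine hg.supp.mono fun x hx => ?_
    contrapose! hx
    have : DoublePowerNLS.glue Φ₁ Φ₂ e c f x = 0 := by simpa using hx
    simp [this, hQ0]

end glue

section halves
variable {e : Space d} (he : ‖e‖ = 1) (c : ℝ) {f : Space d → ℝ}
include he

theorem dirichlet_eq_halfspace (hf : IsLipBump f) : dirichlet f =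
    ∫ x in {x | ⟪e, x⟫_ℝ < c}, (‖fderiv ℝ f x‖ ^ 2
      + ‖fderiv ℝ (fun y => f (hrefl e c y)) x‖ ^ 2) := by
  unfold dirichlet
  rw [integral_eq_halfspace he c hf.integrable_fderiv_sq]
  simp_rw [norm_fderiv_comp_hrefl he]

/-- Each half of `f` occurs twice in exactly one of the two folded functions. -/
theorem dirichlet_fold_add (hf : IsLipBump f) :
    dirichlet (glue (fun a _ => a) (fun a _ => a) e c f)
      + dirichlet (glue (fun _ a => a) (fun _ a => a) e c f) = 2 * dirichlet f := by
  rw [dirichlet_glue glueData_fst he c hf, dirichlet_glue glueData_snd he c hf,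
    dirichlet_eq_halfspace he c hf]
  have i1 : Integrable fun x => ‖fderiv ℝ f x‖ ^ 2 := hf.integrable_fderiv_sq
  have i2 : Integrable fun x => ‖fderiv ℝ (fun y => f (hrefl e c y)) x‖ ^ 2 := by
    simp_rw [norm_fderiv_comp_hrefl he]
    exact (measurePreserving_hrefl he c).integrable_comp_of_integrable i1
  rw [integral_add i1.integrableOn i2.integrableOn, integral_add i1.integrableOn i1.integrableOn,
    integral_add i2.integrableOn i2.integrableOn]
  ring

end halves

/-- Maximum and minimum are half of (f + g) ± |f − g|. The parallelogram law reduces the claim to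
|∇|f − g|| ≤ |∇(f − g)|, which follows from contraction without computing the derivative of the
absolute value. -/
theorem norm_fderiv_max_min_le {f g : Space d → ℝ} {x : Space d}
    (hf : DifferentiableAt ℝ f x) (hg : DifferentiableAt ℝ g x)
    (hw : DifferentiableAt ℝ (fun y => |f y - g y|) x) :
    ‖fderiv ℝ (fun y => max (f y) (g y)) x‖ ^ 2 + ‖fderiv ℝ (fun y => min (f y) (g y)) x‖ ^ 2
      ≤ ‖fderiv ℝ f x‖ ^ 2 + ‖fderiv ℝ g x‖ ^ 2 := by
  have h1 : (fun y => max (f y) (g y)) = fun y => (2 : ℝ)⁻¹ • ((f y + g y) + |f y - g y|) := by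
    ext y
    rcases le_total (f y) (g y) with h | h
    · rw [max_eq_right h, abs_of_nonpos (sub_nonpos.2 h), smul_eq_mul]; ring
    · rw [max_eq_left h, abs_of_nonneg (sub_nonneg.2 h), smul_eq_mul]; ring
  have h2 : (fun y => min (f y) (g y)) = fun y => (2 : ℝ)⁻¹ • ((f y + g y) - |f y - g y|) := by
    ext y
    rcases le_total (f y) (g y) with h | h
    · rw [min_eq_left h, abs_of_nonpos (sub_nonpos.2 h), smul_eq_mul]; ring
    · rw [min_eq_right h, abs_of_nonneg (sub_nonneg.2 h), smul_eq_mul]; ring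
  have hw' : ‖fderiv ℝ (fun y => |f y - g y|) x‖ ≤ ‖fderiv ℝ (fun y => f y - g y) x‖ :=
    norm_fderiv_le_of_contraction (fun y => abs_abs_sub_abs_le _ _) (hf.sub hg) hw
  rw [fderiv_fun_sub hf hg] at hw'
  have hw2 := pow_le_pow_left₀ (norm_nonneg _) hw' 2
  have hfg : DifferentiableAt ℝ (fun y => f y + g y) x := hf.add hg
  rw [h1, h2, fderiv_fun_const_smul (hfg.fun_add hw), fderiv_fun_const_smul (hfg.fun_sub hw),
    fderiv_fun_add hfg hw, fderiv_fun_sub hfg hw, fderiv_fun_add hf hg]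
  rw [norm_sq_clm, norm_sq_clm] at hw2
  rw [norm_sq_clm, norm_sq_clm, norm_sq_clm, norm_sq_clm, ← Finset.sum_add_distrib,
    ← Finset.sum_add_distrib]
  set W := fderiv ℝ (fun y => |f y - g y|) x
  have : ∀ i, ((2 : ℝ)⁻¹ • ((fderiv ℝ f x + fderiv ℝ g x) + W)) (EuclideanSpace.single i 1) ^ 2
      + ((2 : ℝ)⁻¹ • ((fderiv ℝ f x + fderiv ℝ g x) - W)) (EuclideanSpace.single i 1) ^ 2
      = (fderiv ℝ f x (EuclideanSpace.single i 1) ^ 2 + fderiv ℝ g x (EuclideanSpace.single i 1) ^ 2)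
        + (2 : ℝ)⁻¹ * (W (EuclideanSpace.single i 1) ^ 2
        - (fderiv ℝ f x - fderiv ℝ g x) (EuclideanSpace.single i 1) ^ 2) := by
    intro i
    simp
    ring
  simp_rw [this]
  rw [Finset.sum_add_distrib, ← Finset.mul_sum, Finset.sum_sub_distrib]
  linarith

theorem dirichlet_polarization_le {e : Space d} (he : ‖e‖ = 1) (c : ℝ) {f : Space d → ℝ}
    (hf : IsLipBump f) : dirichlet (glue max min e c f) ≤ dirichlet f := by
  have hp := hf.glue glueData_max_min he c
  obtain ⟨K, hK⟩ := hf.lip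
  have hKr : LipschitzWith K fun y => f (hrefl e c y) := by
    refine LipschitzWith.of_dist_le_mul fun x y => (hK.dist_le_mul _ _).trans ?_
    rw [dist_eq_norm, dist_eq_norm, norm_hrefl_sub he]
  have hKw : LipschitzWith (K + K) fun y => |f y - f (hrefl e c y)| := by
    have := (lipschitzWith_one_norm (E := ℝ)).comp (hK.sub hKr)
    rw [one_mul] at this
    exact this
  rw [dirichlet_glue glueData_max_min he c hf, dirichlet_eq_halfspace he c hf]
  have i1 : Integrable fun x => ‖fderiv ℝ f x‖ ^ 2 := hf.integrable_fderiv_sq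
  have i2 : Integrable fun x => ‖fderiv ℝ (fun y => f (hrefl e c y)) x‖ ^ 2 := by
    simp_rw [norm_fderiv_comp_hrefl he]
    exact (measurePreserving_hrefl he c).integrable_comp_of_integrable i1
  refine integral_mono_of_nonneg (Eventually.of_forall fun x => by positivity)
    (i1.integrableOn.add i2.integrableOn) (ae_restrict_of_ae ?_)
  filter_upwards [hK.ae_differentiableAt (μ := volume), hKr.ae_differentiableAt (μ := volume),
    hKw.ae_differentiableAt (μ := volume)] with x h1 h2 h3
  exact norm_fderiv_max_min_le h1 h2 h3

/-! ### Folding at a prescribed mass -/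

theorem exists_unit_vector (hd : 1 ≤ d) : ∃ e : Space d, ‖e‖ = 1 :=
  ⟨EuclideanSpace.single ⟨0, hd⟩ 1, by simp⟩

/-- Off the null hyperplane at height `c` the indicators are locally constant in the height, so
dominated convergence applies. -/
theorem continuous_setIntegral_halfspace {e : Space d} (he : ‖e‖ = 1) {Q : Space d → ℝ}
    (hQ : Integrable Q) : Continuous fun c : ℝ => ∫ x in {x | ⟪e, x⟫_ℝ < c}, Q x := by
  have hm : ∀ c, MeasurableSet {x : Space d | ⟪e, x⟫_ℝ < c} := fun c =>
    (isOpen_lt (by fun_prop) continuous_const).measurableSet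
  simp_rw [← integral_indicator (hm _)]
  rw [continuous_iff_continuousAt]
  intro c
  refine tendsto_integral_filter_of_dominated_convergence (fun x => ‖Q x‖) ?_ ?_ hQ.norm ?_
  · exact Eventually.of_forall fun c' => (hQ.indicator (hm c')).aestronglyMeasurable
  · exact Eventually.of_forall fun c' => Eventually.of_forall fun x => norm_indicator_le_norm_self _ _
  · have h3 : ∀ᵐ x : Space d, ⟪e, x⟫_ℝ ≠ c := by
      rw [ae_iff]; simpa using measure_hyperplane he c
    filter_upwards [h3] with x hx
    refine tendsto_const_nhds.congr' ?_
    rcases lt_or_gt_of_ne hx with h | h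
    · filter_upwards [lt_mem_nhds h] with c' hc'
      rw [indicator_of_mem (by exact h), indicator_of_mem (by exact hc')]
    · filter_upwards [gt_mem_nhds h] with c' hc'
      rw [indicator_of_notMem, indicator_of_notMem]
      · exact not_lt.2 (le_of_lt hc')
      · exact not_lt.2 (le_of_lt h)

/-- Intermediate value theorem as the hyperplane sweeps across the support, from no mass to full
mass. -/
theorem exists_halfspace_mass {e : Space d} (he : ‖e‖ = 1) {f : Space d → ℝ} (hf : IsLipBump f)
    {α : ℝ} (h0 : 0 ≤ α) (h1 : α ≤ ∫ x, f x ^ 2) :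
    ∃ c, ∫ x in {x | ⟪e, x⟫_ℝ < c}, f x ^ 2 = α := by
  obtain ⟨R, hR⟩ := hf.supp.isCompact.isBounded.subset_closedBall 0
  have hfR : ∀ x, f x ≠ 0 → |⟪e, x⟫_ℝ| ≤ R := by
    intro x hx
    have h2 := hR (subset_tsupport f hx)
    rw [mem_closedBall_zero_iff] at h2
    refine (abs_real_inner_le_norm e x).trans ?_
    rwa [he, one_mul]
  have hle : ∫ x in {x | ⟪e, x⟫_ℝ < -R}, f x ^ 2 = 0 := by
    refine setIntegral_eq_zero_of_forall_eq_zero fun x hx => ?_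
    by_contra hne
    have h2 := hfR x (by intro h; simp [h] at hne)
    have := (abs_le.1 h2).1
    have hx' : ⟪e, x⟫_ℝ < -R := hx
    linarith
  have hge : ∫ x in {x | ⟪e, x⟫_ℝ < R + 1}, f x ^ 2 = ∫ x, f x ^ 2 := by
    refine setIntegral_eq_integral_of_forall_compl_eq_zero fun x hx => ?_
    by_contra hne
    have h2 := hfR x (by intro h; simp [h] at hne)
    have := (abs_le.1 h2).2
    exact hx (show ⟪e, x⟫_ℝ < R + 1 by linarith)
  -- The bounding radius is not known to be nonnegative; if the sweep interval is reversed then `R`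
  -- is negative and `f` vanishes.
  by_cases hRR : -R ≤ R + 1
  · have := intermediate_value_Icc hRR
      (continuous_setIntegral_halfspace he hf.integrable_sq).continuousOn
    rw [hle, hge] at this
    obtain ⟨c, -, hc⟩ := this ⟨h0, h1⟩
    exact ⟨c, hc⟩
  · have hz : ∀ x, f x = 0 := fun x => by
      by_contra hne
      have := (abs_nonneg _).trans (hfR x hne)
      apply hRR; linarith
    refine ⟨0, ?_⟩
    simp only [hz] at h1 ⊢
    simp at h1 ⊢
    linarith

theorem integral_fold {e : Space d} (he : ‖e‖ = 1) (c : ℝ) {f : Space d → ℝ} (hf : IsLipBump f)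
    {Q : ℝ → ℝ} (hQ : Continuous Q) (hQ0 : Q 0 = 0) :
    ∫ x, Q (glue (fun a _ => a) (fun a _ => a) e c f x) = 2 * ∫ x in {x | ⟪e, x⟫_ℝ < c}, Q (f x) ∧
    (∫ x, Q (glue (fun a _ => a) (fun a _ => a) e c f x))
      + ∫ x, Q (glue (fun _ a => a) (fun _ a => a) e c f x) = 2 * ∫ x, Q (f x) := by
  have hi : Integrable fun x => Q (f x) :=
    (hQ.comp hf.continuous).integrable_of_hasCompactSupport (hf.supp.comp_left hQ0)
  have hir : Integrable fun x => Q (f (hrefl e c x)) :=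
    (measurePreserving_hrefl he c).integrable_comp_of_integrable hi
  rw [integral_glue glueData_fst he c hf (fun _ => Q) (by fun_prop) (fun _ => hQ0),
    integral_glue glueData_snd he c hf (fun _ => Q) (by fun_prop) (fun _ => hQ0),
    integral_eq_halfspace he c hi, integral_add hi.integrableOn hi.integrableOn,
    integral_add hir.integrableOn hir.integrableOn, integral_add hi.integrableOn hir.integrableOn]
  constructor <;> ring

/-- Folding a bump along a hyperplane produces two bumps whose masses are prescribed and whose
energies add up to twice the original energy. -/
theorem IsLipBump.exists_fold {f : Space d → ℝ} (hf : IsLipBump f) (hd : 1 ≤ d) {α : ℝ}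
    (h0 : 0 ≤ α) (h1 : α ≤ ∫ x, f x ^ 2) (a b : ℝ) {q₁ q₀ : ℝ} (hq₁ : 0 < q₁) (hq₀ : 0 < q₀) :
    ∃ g₁ g₂ : Space d → ℝ, IsLipBump g₁ ∧ IsLipBump g₂ ∧ ∫ x, g₁ x ^ 2 = 2 * α ∧
      ∫ x, g₂ x ^ 2 = 2 * (∫ x, f x ^ 2) - 2 * α ∧
      functional a b q₁ q₀ (fun x => (g₁ x : ℂ)) + functional a b q₁ q₀ (fun x => (g₂ x : ℂ))
        = 2 * functional a b q₁ q₀ (fun x => (f x : ℂ)) := by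
  obtain ⟨e, he⟩ := exists_unit_vector hd
  obtain ⟨c, hc⟩ := exists_halfspace_mass he hf h0 h1
  have b1 := hf.glue glueData_fst he c
  have b2 := hf.glue glueData_snd he c
  have k2 := integral_fold he c hf (Q := fun s => s ^ 2) (by fun_prop) (by simp)
  have kq := fun q (hq : 0 < q) => integral_fold he c hf (Q := fun s => s ^ q)
    (Real.continuous_rpow_const hq.le) (Real.zero_rpow hq.ne')
  refine ⟨_, _, b1, b2, ?_, ?_, ?_⟩
  · rw [k2.1, hc]
  · linarith [k2.1, k2.2, hc]
  · unfold functional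
    rw [b1.gradNormSq_eq, b2.gradNormSq_eq, hf.gradNormSq_eq, b1.powInt_eq, b1.powInt_eq,
      b2.powInt_eq, b2.powInt_eq, hf.powInt_eq, hf.powInt_eq]
    linear_combination dirichlet_fold_add he c hf - a * (kq q₁ hq₁).2 + b * (kq q₀ hq₀).2

/-! ### Mollification and approximation by bumps -/

/-- Smooth, compactly supported, nonnegative weights of total mass one. -/
structure IsMollifier (η : Space d → ℝ) : Prop where
  smooth : ContDiff ℝ ∞ η
  supp : HasCompactSupport η
  nonneg : ∀ x, 0 ≤ η x
  integral_eq_one : ∫ x, η x = 1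

/-- Convolution with a weight. -/
noncomputable def mollify {F : Type*} [NormedAddCommGroup F] [NormedSpace ℝ F] (η : Space d → ℝ)
    (w : Space d → F) (x : Space d) : F := ∫ t, η (x - t) • w t

section
variable {F : Type*} [NormedAddCommGroup F] [NormedSpace ℝ F] {η : Space d → ℝ} {w : Space d → F}

theorem mollify_eq_convolution (η : Space d → ℝ) (w : Space d → F) :
    mollify η w = η ⋆[ContinuousLinearMap.lsmul ℝ ℝ, volume] w := by
  ext1 x
  rw [convolution_eq_swap]
  rfl

namespace IsMollifier

theorem integrable_smul (hη : IsMollifier η) (hw : LocallyIntegrable w volume) (x : Space d) :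
    Integrable fun t => η (x - t) • w t := by
  have := hη.supp.convolutionExists_left (ContinuousLinearMap.lsmul ℝ ℝ) (F := F)
    hη.smooth.continuous hw x
  exact this.integrable_swap

theorem integral_shift (hη : IsMollifier η) (x : Space d) : ∫ t, η (x - t) = 1 := by
  rw [integral_sub_left_eq_self]; exact hη.integral_eq_one

theorem integrable_shift (hη : IsMollifier η) (x : Space d) : Integrable fun t => η (x - t) :=
  (hη.smooth.continuous.integrable_of_hasCompactSupport hη.supp).comp_sub_left x

/-- Jensen's inequality for mollification. -/
theorem norm_mollify_rpow_le (hη : IsMollifier η) (hw : LocallyIntegrable w volume) {q : ℝ}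
    (hq : 1 ≤ q) (hwq : Integrable fun x => ‖w x‖ ^ q) (x : Space d) :
    ‖mollify η w x‖ ^ q ≤ mollify η (fun t => ‖w t‖ ^ q) x := by
  have i1 : Integrable fun t => η (x - t) • w t := hη.integrable_smul hw x
  have i2 : Integrable fun t => η (x - t) * ‖w t‖ :=
    i1.norm.congr (Eventually.of_forall fun t => by
      simp [norm_smul, abs_of_nonneg (hη.nonneg _)])
  have i3 : Integrable fun t => η (x - t) * ‖w t‖ ^ q :=
    hη.integrable_smul hwq.locallyIntegrable x
  set c := ∫ t, η (x - t) * ‖w t‖ with hc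
  have hle : ‖mollify η w x‖ ≤ c := by
    refine (norm_integral_le_integral_norm _).trans_eq ?_
    refine integral_congr_ae (Eventually.of_forall fun t => ?_)
    simp [norm_smul, abs_of_nonneg (hη.nonneg _)]
  have hc0 : 0 ≤ c := (norm_nonneg _).trans hle
  refine (Real.rpow_le_rpow (norm_nonneg _) hle (by linarith)).trans ?_
  change c ^ q ≤ ∫ t, η (x - t) * ‖w t‖ ^ q
  rcases hc0.eq_or_lt with h0 | h0
  · rw [← h0, Real.zero_rpow (by linarith)]
    exact integral_nonneg fun t => mul_nonneg (hη.nonneg _) (Real.rpow_nonneg (norm_nonneg _) _)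
  -- Tangent line of s^q at the mean `c`, from Bernoulli's inequality; integrating it against the
  -- probability density η(x − ·) kills the linear term.
  have htan : ∀ s, 0 ≤ s → c ^ q + q * c ^ (q - 1) * (s - c) ≤ s ^ q := by
    intro s hs
    have h1 := one_add_mul_self_le_rpow_one_add (s := s / c - 1) (by
      have := div_nonneg hs h0.le; linarith) hq
    rw [show 1 + (s / c - 1) = s / c by ring, Real.div_rpow hs h0.le,
      le_div_iff₀ (Real.rpow_pos_of_pos h0 q)] at h1
    refine le_trans (le_of_eq ?_) h1
    rw [Real.rpow_sub h0, Real.rpow_one]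
    field_simp
  have key : ∫ t, (η (x - t) * (c ^ q - q * c ^ (q - 1) * c)
      + q * c ^ (q - 1) * (η (x - t) * ‖w t‖)) ≤ ∫ t, η (x - t) * ‖w t‖ ^ q := by
    refine integral_mono (((hη.integrable_shift x).mul_const _).add (i2.const_mul _)) i3 fun t => ?_
    have := mul_le_mul_of_nonneg_left (htan _ (norm_nonneg (w t))) (hη.nonneg (x - t))
    simp only
    linarith
  rw [integral_add ((hη.integrable_shift x).mul_const _) (i2.const_mul _), integral_mul_const,
    integral_const_mul, hη.integral_shift, ← hc] at key
  linarith

theorem integrable_mollify (hη : IsMollifier η) (hw : Integrable w) :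
    Integrable (mollify η w) := by
  rw [mollify_eq_convolution]
  exact (hη.smooth.continuous.integrable_of_hasCompactSupport hη.supp).integrable_convolution _ hw

theorem integral_mollify [CompleteSpace F] (hη : IsMollifier η) (hw : Integrable w) :
    ∫ x, mollify η w x = ∫ x, w x := by
  rw [mollify_eq_convolution, integral_convolution _
    (hη.smooth.continuous.integrable_of_hasCompactSupport hη.supp) hw, hη.integral_eq_one]
  simp

theorem exists_bound (hη : IsMollifier η) : ∃ C, 0 < C ∧ ∀ x, η x ≤ C := by
  obtain ⟨C, hC⟩ := hη.supp.exists_bound_of_continuous hη.smooth.continuous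
  exact ⟨max C 1, by positivity, fun x => (le_abs_self _).trans ((hC x).trans (le_max_left _ _))⟩

/-- The mollification of an integrable nonnegative function vanishes at infinity. -/
theorem mollify_small (hη : IsMollifier η) {g : Space d → ℝ} (hg : Integrable g) {ε : ℝ}
    (hε : 0 < ε) : ∃ R : ℝ, ∀ x, R < ‖x‖ → mollify η g x ≤ ε := by
  obtain ⟨C, hC0, hC⟩ := hη.exists_bound
  obtain ⟨k, hkc, hk, -, hki⟩ := hg.exists_hasCompactSupport_integral_sub_le (ε := ε / C)
    (by positivity)
  obtain ⟨R₁, hR₁⟩ := hkc.isCompact.isBounded.subset_closedBall 0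
  obtain ⟨R₂, hR₂⟩ := hη.supp.isCompact.isBounded.subset_closedBall 0
  refine ⟨R₁ + R₂, fun x hx => ?_⟩
  -- So far out the supports of η(x − ·) and of the compactly supported approximation `k` are
  -- disjoint, so `k` may be subtracted for free.
  have hz : ∀ t, η (x - t) * g t = η (x - t) * (g t - k t) := by
    intro t
    by_cases hk0 : k t = 0
    · rw [hk0, sub_zero]
    have h1 := hR₁ (subset_tsupport k hk0)
    have h2 : η (x - t) = 0 := by
      by_contra hne
      have h3 := hR₂ (subset_tsupport η hne)
      rw [mem_closedBall_zero_iff] at h1 h3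
      have := norm_add_le (x - t) t
      rw [sub_add_cancel] at this
      linarith
    rw [h2]; simp
  have i1 := hη.integrable_smul (hg.sub hki).locallyIntegrable x
  calc mollify η g x = ∫ t, η (x - t) * (g t - k t) := by
        unfold mollify
        exact integral_congr_ae (Eventually.of_forall fun t => hz t)
    _ ≤ ∫ t, C * ‖g t - k t‖ := by
        refine integral_mono i1 ((hg.sub hki).norm.const_mul C) fun t => ?_
        refine (mul_le_mul_of_nonneg_left (le_abs_self (g t - k t)) (hη.nonneg _)).trans ?_
        exact mul_le_mul_of_nonneg_right (hC _) (abs_nonneg _)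
    _ = C * ∫ t, ‖g t - k t‖ := integral_const_mul _ _
    _ ≤ C * (ε / C) := mul_le_mul_of_nonneg_left hk hC0.le
    _ = ε := by field_simp

theorem mollify_le (hη : IsMollifier η) {C : ℝ} (hC : ∀ x, η x ≤ C) {g : Space d → ℝ}
    (hg : Integrable g) (hg0 : ∀ x, 0 ≤ g x) (x : Space d) : mollify η g x ≤ C * ∫ x, g x := by
  rw [← integral_const_mul]
  refine integral_mono (hη.integrable_smul hg.locallyIntegrable x) (hg.const_mul C) fun t => ?_
  exact mul_le_mul_of_nonneg_right (hC _) (hg0 t)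

variable {u : Space d → ℂ} {G : Space d → EuclideanSpace ℂ (Fin d)}

/-- Mollification turns weak gradients into classical ones. -/
theorem hasFDerivAt_mollify (hη : IsMollifier η) (hG : IsWeakGradient u G) (x : Space d) :
    ∃ L : Space d →L[ℝ] ℂ, HasFDerivAt (mollify η u) L x ∧
      ∀ i, L (EuclideanSpace.single i 1) = mollify η G x i := by
  have h1 := hη.supp.hasFDerivAt_convolution_left (ContinuousLinearMap.lsmul ℝ ℝ)
    (hη.smooth.of_le (by simp)) hG.1 x
  rw [← mollify_eq_convolution] at h1
  refine ⟨_, h1, fun i => ?_⟩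
  have hex := (hη.supp.fderiv ℝ).convolutionExists_left
    ((ContinuousLinearMap.lsmul ℝ ℝ).precompL (Space d)) (F := Space d →L[ℝ] ℂ)
    (hη.smooth.continuous_fderiv (by simp)) hG.1 x
  rw [convolution_eq_swap, ContinuousLinearMap.integral_apply hex.integrable_swap]
  simp only [ContinuousLinearMap.precompL_apply, ContinuousLinearMap.lsmul_apply]
  -- The kernel t ↦ η(x − t) is itself the test function; its derivative in t is minus that in x,
  -- cancelling the sign in the weak identity.
  have hφ : ContDiff ℝ ∞ fun t => η (x - t) := hη.smooth.comp (contDiff_const.sub contDiff_id)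
  have hφc : HasCompactSupport fun t => η (x - t) :=
    hη.supp.comp_homeomorph (Homeomorph.subLeft x)
  have h2 := hG.2.2 _ hφ hφc i
  have h3 : ∀ t, fderiv ℝ (fun t => η (x - t)) t (EuclideanSpace.single i 1)
      = -(fderiv ℝ η (x - t) (EuclideanSpace.single i 1)) := by
    intro t
    have h4 := ((hη.smooth.differentiable (by simp)) (x - t)).hasFDerivAt.comp t
      ((hasFDerivAt_id t).const_sub x)
    change fderiv ℝ (η ∘ fun t => x - t) t _ = _
    rw [h4.fderiv]; simp
  simp_rw [h3, neg_smul, integral_neg, neg_inj] at h2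
  rw [h2]
  unfold mollify
  have := (EuclideanSpace.proj (𝕜 := ℂ) i : EuclideanSpace ℂ (Fin d) →L[ℂ] ℂ).integral_comp_comm
    (hη.integrable_smul hG.2.1 x)
  simp only [EuclideanSpace.coe_proj] at this
  rw [← this]
  rfl

end IsMollifier
end

/-- The truncated modulus of a mollification. -/
noncomputable def mollTrunc (η : Space d → ℝ) (ε : ℝ) (u : Space d → ℂ) (x : Space d) : ℝ :=
  max (‖mollify η u x‖ - ε) 0

namespace IsMollifier
variable {η : Space d → ℝ} {u : Space d → ℂ} {G : Space d → EuclideanSpace ℂ (Fin d)}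

theorem norm_mollify_sq_le (hη : IsMollifier η) {F : Type*} [NormedAddCommGroup F]
    [NormedSpace ℝ F] {w : Space d → F} (hw : MemLp w 2 volume) (x : Space d) :
    ‖mollify η w x‖ ^ 2 ≤ mollify η (fun t => ‖w t‖ ^ 2) x := by
  have hi : Integrable fun x => ‖w x‖ ^ (2 : ℝ) := by
    simpa using hw.integrable_norm_pow (p := 2) (by norm_num)
  have := hη.norm_mollify_rpow_le (hw.locallyIntegrable (by norm_num)) (q := 2) (by norm_num) hi x
  simpa using this

/-- The partial derivatives are coordinates of the mollified `G`, bounded through Jensen by sup η ·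
‖G‖²; summing over coordinates costs a factor d. -/
theorem exists_lipschitzWith_mollify (hη : IsMollifier η) (hG : IsWeakGradient u G)
    (hG2 : MemLp G 2 volume) : ∃ K : ℝ≥0, LipschitzWith K (mollify η u) := by
  obtain ⟨C, hC0, hC⟩ := hη.exists_bound
  have hi := hG2.integrable_norm_pow (p := 2) (by norm_num)
  set A := Real.sqrt (C * ∫ x, ‖G x‖ ^ 2)
  have hA : ∀ x, ‖mollify η G x‖ ≤ A := fun x => Real.le_sqrt_of_sq_le
    ((hη.norm_mollify_sq_le hG2 x).trans (hη.mollify_le hC hi (fun x => by positivity) x))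
  refine ⟨⟨d * A, by positivity⟩, lipschitzWith_of_nnnorm_fderiv_le (𝕜 := ℝ) (fun x => ?_)
    fun x => ?_⟩
  · obtain ⟨L, hL, -⟩ := hη.hasFDerivAt_mollify hG x
    exact hL.differentiableAt
  · obtain ⟨L, hL, hLi⟩ := hη.hasFDerivAt_mollify hG x
    rw [hL.fderiv]
    change ‖L‖ ≤ d * A
    refine L.opNorm_le_bound (by positivity) fun v => ?_
    have hv : v = ∑ i, v i • EuclideanSpace.single i (1 : ℝ) := by
      ext j; simp [Finset.sum_apply, Pi.single_apply]
    conv_lhs => rw [hv]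
    rw [map_sum]
    refine (norm_sum_le _ _).trans ?_
    have : ∀ i ∈ (Finset.univ : Finset (Fin d)),
        ‖L (v i • EuclideanSpace.single i (1 : ℝ))‖ ≤ A * ‖v‖ := by
      intro i _
      rw [map_smul, norm_smul, hLi, mul_comm]
      exact mul_le_mul ((PiLp.norm_apply_le _ _).trans (hA x)) (PiLp.norm_apply_le _ _)
        (norm_nonneg _) (by positivity)
    refine (Finset.sum_le_sum this).trans_eq ?_
    simp [mul_assoc]

theorem mollTrunc_contraction (η : Space d → ℝ) (ε : ℝ) (u : Space d → ℂ) (x y : Space d) :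
    |mollTrunc η ε u y - mollTrunc η ε u x| ≤ ‖mollify η u y - mollify η u x‖ := by
  unfold mollTrunc
  refine (abs_max_sub_max_le_abs _ _ _).trans ?_
  rw [sub_sub_sub_cancel_right]
  exact abs_norm_sub_norm_le _ _

/-- A mollified L² function tends to zero at infinity, so subtracting ε from its modulus and taking
the positive part produces compact support. -/
theorem isLipBump_mollTrunc (hη : IsMollifier η) (hu : MemLp u 2 volume)
    (hG : IsWeakGradient u G) (hG2 : MemLp G 2 volume) {ε : ℝ} (hε : 0 < ε) :
    IsLipBump (mollTrunc η ε u) := by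
  obtain ⟨K, hK⟩ := hη.exists_lipschitzWith_mollify hG hG2
  refine ⟨⟨K, ?_⟩, ?_, fun x => le_max_right _ _⟩
  · refine LipschitzWith.of_dist_le_mul fun x y => ?_
    rw [Real.dist_eq]
    refine (mollTrunc_contraction η ε u y x).trans ?_
    rw [← dist_eq_norm]
    exact hK.dist_le_mul x y
  · obtain ⟨R, hR⟩ := hη.mollify_small (hu.integrable_norm_pow (p := 2) (by norm_num))
      (ε := ε ^ 2) (by positivity)
    refine HasCompactSupport.intro (isCompact_closedBall (0 : Space d) R) fun x hx => ?_
    have hx' : R < ‖x‖ := by simpa using hx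
    have h1 := (hη.norm_mollify_sq_le hu x).trans (hR x hx')
    have h2 := (sq_le_sq₀ (norm_nonneg _) hε.le).1 h1
    exact max_eq_right (by linarith)

/-- Each partial derivative of the truncated modulus is at most the modulus of the complex partial
derivative, again by comparing difference quotients; Jensen then removes the mollifier. The
inequality |∇|u|| ≤ |∇u| is contained here. -/
theorem dirichlet_mollTrunc_le (hη : IsMollifier η) (hu : MemLp u 2 volume)
    (hG : IsWeakGradient u G) (hG2 : MemLp G 2 volume) {ε : ℝ} (hε : 0 < ε) :
    dirichlet (mollTrunc η ε u) ≤ gradNormSq u := by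
  have hb := hη.isLipBump_mollTrunc hu hG hG2 hε
  have hi := hG2.integrable_norm_pow (p := 2) (by norm_num)
  rw [gradNormSq_eq hG, ← hη.integral_mollify hi]
  refine integral_mono_ae hb.integrable_fderiv_sq (hη.integrable_mollify hi) ?_
  obtain ⟨K, hK⟩ := hb.lip
  filter_upwards [hK.ae_differentiableAt (μ := volume)] with x hx
  refine le_trans ?_ (hη.norm_mollify_sq_le hG2 x)
  obtain ⟨L, hL, hLi⟩ := hη.hasFDerivAt_mollify hG x
  rw [norm_sq_clm, EuclideanSpace.norm_sq_eq]
  refine Finset.sum_le_sum fun i _ => ?_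
  rw [← sq_abs]
  refine pow_le_pow_left₀ (abs_nonneg _) ?_ 2
  rw [← hLi]
  refine le_of_tendsto_of_tendsto'
    ((hx.hasFDerivAt.hasLineDerivAt (EuclideanSpace.single i 1)).tendsto_slope_zero_right).norm
    ((hL.hasLineDerivAt (EuclideanSpace.single i 1)).tendsto_slope_zero_right).norm fun t => ?_
  rw [norm_smul, norm_smul]
  exact mul_le_mul_of_nonneg_left (mollTrunc_contraction η ε u _ _) (norm_nonneg _)

theorem integral_mollTrunc_rpow_le (hη : IsMollifier η) (hu : MemLp u 2 volume)
    (hG : IsWeakGradient u G) (hG2 : MemLp G 2 volume) {ε : ℝ} (hε : 0 < ε) {q : ℝ} (hq : 1 ≤ q)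
    (huq : Integrable fun x => ‖u x‖ ^ q) :
    ∫ x, mollTrunc η ε u x ^ q ≤ ∫ x, ‖u x‖ ^ q := by
  have hb := hη.isLipBump_mollTrunc hu hG hG2 hε
  rw [← hη.integral_mollify huq]
  refine integral_mono (hb.integrable_rpow (by linarith)) (hη.integrable_mollify huq) fun x => ?_
  refine le_trans ?_ (hη.norm_mollify_rpow_le hG.1 hq huq x)
  refine Real.rpow_le_rpow (hb.nonneg x) ?_ (by linarith)
  exact max_le (by linarith) (norm_nonneg _)

end IsMollifier

/-- Approximation of the modulus of an `H¹` function by Lipschitz bumps, without increasing the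
Dirichlet integral or the `L^q` norms. -/
theorem exists_bump_seq {u : Space d → ℂ} (hu : MemH1 u) :
    ∃ w : ℕ → Space d → ℝ, (∀ k, IsLipBump (w k)) ∧
      (∀ᵐ x, Tendsto (fun k => w k x) atTop (𝓝 ‖u x‖)) ∧
      (∀ k, dirichlet (w k) ≤ gradNormSq u) ∧
      ∀ q : ℝ, 1 ≤ q → (Integrable fun x => ‖u x‖ ^ q) → ∀ k, ∫ x, w k x ^ q ≤ ∫ x, ‖u x‖ ^ q := by
  obtain ⟨hu2, G, hG2, hG⟩ := hu
  -- The outer radius is twice the inner one for every `k`: a bounded ratio is what almost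
  -- everywhere convergence of the mollifications requires.
  let φ : ℕ → ContDiffBump (0 : Space d) := fun k =>
    ⟨1 / (k + 1), 2 / (k + 1), by positivity, by gcongr; norm_num⟩
  let η : ℕ → Space d → ℝ := fun k => (φ k).normed volume
  have hη : ∀ k, IsMollifier (η k) := fun k =>
    ⟨(φ k).contDiff_normed (n := ⊤), (φ k).hasCompactSupport_normed, (φ k).nonneg_normed,
      (φ k).integral_normed⟩
  have hε : ∀ k : ℕ, 0 < 1 / ((k : ℝ) + 1) := fun k => by positivity
  refine ⟨fun k => mollTrunc (η k) (1 / ((k : ℝ) + 1)) u, fun k => ?_, ?_, fun k => ?_,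
    fun q hq hi k => ?_⟩
  · exact (hη k).isLipBump_mollTrunc hu2 hG hG2 (hε k)
  · have h1 := ContDiffBump.ae_convolution_tendsto_right_of_locallyIntegrable
      (μ := (volume : Measure (Space d))) (φ := φ) (l := atTop) (K := 2) ?_ ?_ hG.1
    · filter_upwards [h1] with x hx
      have h2 : Tendsto (fun k : ℕ => max (‖mollify (η k) u x‖ - 1 / ((k : ℝ) + 1)) 0) atTop
          (𝓝 (max (‖u x‖ - 0) 0)) := by
        refine Tendsto.max (Tendsto.sub ?_ tendsto_one_div_add_atTop_nhds_zero_nat)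
          tendsto_const_nhds
        simp_rw [mollify_eq_convolution]
        exact hx.norm
      rw [sub_zero, max_eq_left (norm_nonneg _)] at h2
      exact h2
    · have := (tendsto_one_div_add_atTop_nhds_zero_nat (𝕜 := ℝ)).const_mul 2
      rw [mul_zero] at this
      refine this.congr fun k => ?_
      change 2 * (1 / ((k : ℝ) + 1)) = 2 / (k + 1)
      ring
    · refine Eventually.of_forall fun k => ?_
      change 2 / ((k : ℝ) + 1) ≤ 2 * (1 / (k + 1))
      rw [mul_one_div]
  · exact (hη k).dirichlet_mollTrunc_le hu2 hG hG2 (hε k)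
  · exact (hη k).integral_mollTrunc_rpow_le hu2 hG hG2 (hε k) hq hi

/-- Almost everywhere convergence without increase of the integral of a power implies convergence
of that integral. -/
theorem tendsto_integral_rpow_of_le {w : ℕ → Space d → ℝ} {f : Space d → ℝ} {q : ℝ} (hq : 0 < q)
    (hw : ∀ k, IsLipBump (w k)) (hlim : ∀ᵐ x, Tendsto (fun k => w k x) atTop (𝓝 (f x)))
    (hf : Integrable fun x => f x ^ q) (hle : ∀ k, ∫ x, w k x ^ q ≤ ∫ x, f x ^ q) :
    Tendsto (fun k => ∫ x, w k x ^ q) atTop (𝓝 (∫ x, f x ^ q)) := by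
  have hf0 : ∀ᵐ x, 0 ≤ f x := by
    filter_upwards [hlim] with x hx using ge_of_tendsto' hx fun k => (hw k).nonneg x
  have hlimq : ∀ᵐ x, Tendsto (fun k => w k x ^ q) atTop (𝓝 (f x ^ q)) := by
    filter_upwards [hlim] with x hx using hx.rpow_const (Or.inr hq.le)
  -- The minimum is dominated by the limit itself, and its integral squeezes that of w_k^q from
  -- below; the hypothesis supplies the bound from above.
  have hmin : Tendsto (fun k => ∫ x, min (w k x ^ q) (f x ^ q)) atTop (𝓝 (∫ x, f x ^ q)) := by
    refine tendsto_integral_of_dominated_convergence (fun x => f x ^ q) (fun k => ?_) hf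
      (fun k => ?_) ?_
    · exact (((hw k).integrable_rpow hq).inf hf).aestronglyMeasurable
    · filter_upwards [hf0] with x hx
      have h1 := Real.rpow_nonneg ((hw k).nonneg x) q
      have h2 := Real.rpow_nonneg hx q
      rw [Real.norm_of_nonneg (le_min h1 h2)]
      exact min_le_right _ _
    · filter_upwards [hlimq] with x hx
      simpa using hx.min (tendsto_const_nhds (x := f x ^ q))
  refine tendsto_of_tendsto_of_tendsto_of_le_of_le hmin tendsto_const_nhds (fun k => ?_) hle
  exact integral_mono (((hw k).integrable_rpow hq).inf hf) ((hw k).integrable_rpow hq)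
    fun x => min_le_left _ _

/-! ### Concave functions of the mass -/

/-- Let μ be the infimum over a segment of `f` minus its chord, finite by the local lower bound.
That difference vanishes at both ends, so every point is the midpoint of an end and another point,
and midpoint concavity gives values at least μ/2. Hence μ/2 ≤ μ, that is, μ ≥ 0. -/
theorem concaveOn_of_midpoint {f : ℝ → ℝ}
    (hmid : ∀ x y, 0 ≤ x → 0 ≤ y → f x + f y ≤ 2 * f ((x + y) / 2))
    (hbdd : ∀ R, ∃ c, ∀ x, 0 ≤ x → x ≤ R → c ≤ f x) : ConcaveOn ℝ (Ici 0) f := by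
  refine LinearOrder.concaveOn_of_lt (convex_Ici 0) fun x hx y hy hxy s t hs ht hst => ?_
  obtain ⟨c, hc⟩ := hbdd y
  set g : ℝ → ℝ := fun t => f (x + t * (y - x)) - ((1 - t) * f x + t * f y) with hg
  have hx' : 0 ≤ x := hx
  have hpos : ∀ t, 0 ≤ t → 0 ≤ x + t * (y - x) := fun t ht =>
    add_nonneg hx' (mul_nonneg ht (sub_nonneg.2 hxy.le))
  have hgm : ∀ s t, 0 ≤ s → 0 ≤ t → g s + g t ≤ 2 * g ((s + t) / 2) := by
    intro s t hs ht
    have := hmid _ _ (hpos s hs) (hpos t ht)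
    rw [show (x + s * (y - x) + (x + t * (y - x))) / 2 = x + (s + t) / 2 * (y - x) by ring] at this
    simp only [hg]
    linarith
  have hg0 : g 0 = 0 := by simp [hg]
  have hg1 : g 1 = 0 := by simp [hg]
  have hbd : BddBelow (g '' Icc 0 1) := by
    refine ⟨c - (|f x| + |f y|), ?_⟩
    rintro _ ⟨t, ⟨h0, h1⟩, rfl⟩
    have h2 := hc _ (hpos t h0) (by nlinarith)
    have h3 : (1 - t) * f x ≤ |f x| := by nlinarith [le_abs_self (f x), abs_nonneg (f x)]
    have h4 : t * f y ≤ |f y| := by nlinarith [le_abs_self (f y), abs_nonneg (f y)]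
    simp only [hg]
    linarith
  set μ := sInf (g '' Icc 0 1) with hμ
  have hμle : ∀ t, 0 ≤ t → t ≤ 1 → μ ≤ g t := fun t h0 h1 => csInf_le hbd ⟨t, ⟨h0, h1⟩, rfl⟩
  have hhalf : μ / 2 ≤ μ := by
    refine le_csInf ⟨_, 0, ⟨le_rfl, zero_le_one⟩, rfl⟩ ?_
    rintro _ ⟨t, ⟨h0, h1⟩, rfl⟩
    rcases le_total t (1 / 2) with h | h
    · have h2 := hgm 0 (2 * t) le_rfl (by linarith)
      rw [hg0, show (0 + 2 * t) / 2 = t by ring] at h2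
      linarith [hμle (2 * t) (by linarith) (by linarith)]
    · have h2 := hgm 1 (2 * t - 1) zero_le_one (by linarith)
      rw [hg1, show (1 + (2 * t - 1)) / 2 = t by ring] at h2
      linarith [hμle (2 * t - 1) (by linarith) (by linarith)]
  have h5 := hμle t ht.le (by linarith)
  have h6 : s • x + t • y = x + t * (y - x) := by
    simp only [smul_eq_mul]
    rw [show s = 1 - t by linarith]; ring
  rw [h6]
  simp only [hg] at h5
  simp only [smul_eq_mul]
  rw [show s = 1 - t by linarith]
  linarith

section critical
variable {f : ℝ → ℝ} (hf : ConcaveOn ℝ (Ici 0) f) (hle : ∀ m, 0 ≤ m → f m ≤ 0) (h0 : f 0 = 0)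
include hf hle h0

/-- For x ≤ y, concavity between 0 and y gives f x ≥ (x/y) f y ≥ f y, as f y ≤ 0. -/
theorem antitoneOn_of_concave : AntitoneOn f (Ici 0) := by
  intro x hx y hy hxy
  have hx' : 0 ≤ x := hx
  rcases hxy.eq_or_lt with rfl | hlt
  · rfl
  have hy0 : 0 < y := hx'.trans_lt hlt
  have hxy1 : x / y ≤ 1 := (div_le_one hy0).2 hxy
  have h := hf.2 (show (0 : ℝ) ∈ Ici 0 from self_mem_Ici) hy
    (show 0 ≤ 1 - x / y by linarith) (show 0 ≤ x / y by positivity) (by ring)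
  simp only [smul_eq_mul, mul_zero, zero_add, h0] at h
  rw [div_mul_cancel₀ x hy0.ne'] at h
  nlinarith [hle y hy]

/-- The critical point is the supremum of the zero set. For mc < x < y, writing x as a convex
combination of mc and y bounds f x below by a fraction less than 1 of the negative number f y,
whence strictness. -/
theorem exists_critical {m₁ m₂ : ℝ} (hm₁ : 0 < m₁) (h1 : f m₁ = 0) (hm₂ : 0 ≤ m₂) (h2 : f m₂ < 0) :
    ∃ mc, 0 < mc ∧ (∀ m ∈ Icc 0 mc, f m = 0) ∧ (∀ m ∈ Ioi mc, f m < 0) ∧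
      StrictAntiOn f (Ioi mc) := by
  have hanti := antitoneOn_of_concave hf hle h0
  set S := {m | 0 ≤ m ∧ f m = 0} with hS
  have hbd : ∀ m ∈ S, m ≤ m₂ := by
    intro m hm
    by_contra hlt
    have := hanti hm₂ hm.1 (not_le.1 hlt).le
    rw [hm.2] at this
    linarith
  have hbdd : BddAbove S := ⟨m₂, hbd⟩
  have hne : S.Nonempty := ⟨m₁, hm₁.le, h1⟩
  set mc := sSup S with hmc
  have hmc0 : 0 < mc := hm₁.trans_le (le_csSup hbdd ⟨hm₁.le, h1⟩)
  have hlow : ∀ m, 0 ≤ m → m < mc → f m = 0 := by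
    intro m hm hlt
    obtain ⟨m', hm', hlt'⟩ := exists_lt_of_lt_csSup hne hlt
    have := hanti hm hm'.1 hlt'.le
    rw [hm'.2] at this
    exact le_antisymm (hle m hm) this
  have hneg : ∀ m, mc < m → f m < 0 := by
    intro m hlt
    refine lt_of_le_of_ne (hle m (hmc0.trans hlt).le) fun h => ?_
    exact absurd (le_csSup hbdd ⟨(hmc0.trans hlt).le, h⟩) (not_le.2 hlt)
  have hcrit : f mc = 0 := by
    refine le_antisymm (hle mc hmc0.le) ?_
    -- For t ≤ 1/2, mc is the combination of a zero to its left, with weight 1 − t, and of 2mc, with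
    -- weight t. Only t → 0 matters; larger t are compared with the midpoint of 0 and 2mc.
    have key : ∀ t ∈ Ioo (0 : ℝ) 1, t * f (2 * mc) ≤ f mc := by
      intro t ht
      have hx : 0 ≤ (1 - 2 * t) / (1 - t) * mc ∨ 1 / 2 < t := by
        rcases le_or_gt t (1 / 2) with h | h
        · left
          have : 0 < 1 - t := by linarith [ht.2]
          have : 0 ≤ 1 - 2 * t := by linarith
          positivity
        · exact Or.inr h
      have ht1 : 0 < 1 - t := by linarith [ht.2]
      rcases hx with hx | hx
      · have hxlt : (1 - 2 * t) / (1 - t) * mc < mc := by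
          have : (1 - 2 * t) / (1 - t) < 1 := by rw [div_lt_one ht1]; linarith [ht.1]
          nlinarith
        have h := hf.2 (show (1 - 2 * t) / (1 - t) * mc ∈ Ici 0 from hx)
          (show 2 * mc ∈ Ici 0 from by change 0 ≤ 2 * mc; linarith) ht1.le ht.1.le (by ring)
        simp only [smul_eq_mul, hlow _ hx hxlt, mul_zero, zero_add] at h
        rwa [show (1 - t) * ((1 - 2 * t) / (1 - t) * mc) + t * (2 * mc) = mc by
          field_simp; ring] at h
      · have h3 := hf.2 (show (0 : ℝ) ∈ Ici 0 from self_mem_Ici)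
          (show 2 * mc ∈ Ici 0 from by change 0 ≤ 2 * mc; linarith)
          (show (0 : ℝ) ≤ 1 / 2 by norm_num) (show (0 : ℝ) ≤ 1 / 2 by norm_num) (by norm_num)
        simp only [smul_eq_mul, h0, mul_zero, zero_add] at h3
        rw [show 1 / 2 * (2 * mc) = mc by ring] at h3
        nlinarith [hle (2 * mc) (by linarith)]
    have hlim : Tendsto (fun t : ℝ => t * f (2 * mc)) (𝓝[>] 0) (𝓝 (0 * f (2 * mc))) :=
      (tendsto_id.mul_const _).mono_left nhdsWithin_le_nhds
    rw [zero_mul] at hlim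
    refine le_of_tendsto hlim ?_
    filter_upwards [Ioo_mem_nhdsGT (zero_lt_one' ℝ)] with t ht using key t ht
  refine ⟨mc, hmc0, fun m hm => ?_, fun m hm => hneg m hm, ?_⟩
  · rcases hm.2.eq_or_lt with rfl | h
    · exact hcrit
    · exact hlow m hm.1 h
  · intro x hx y hy hxy
    have hx' : mc < x := hx
    have hy' : mc < y := hy
    have hd : 0 < y - mc := by linarith
    have h := hf.2 (show mc ∈ Ici 0 from hmc0.le) (show y ∈ Ici 0 from (hmc0.trans hy').le)
      (show 0 ≤ (y - x) / (y - mc) from div_nonneg (by linarith) hd.le)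
      (show 0 ≤ (x - mc) / (y - mc) from div_nonneg (by linarith) hd.le) (by field_simp; ring)
    simp only [smul_eq_mul, hcrit, mul_zero, zero_add] at h
    rw [show (y - x) / (y - mc) * mc + (x - mc) / (y - mc) * y = x by field_simp; ring] at h
    have h4 : (x - mc) / (y - mc) < 1 := by rw [div_lt_one hd]; linarith
    nlinarith [hneg y hy']

end critical

/-! ### The infimum as a function of the mass -/

/-- The infimum of the combined-power functional at fixed mass. -/
noncomputable def groundInf (d : ℕ) (a b p₁ p₀ m : ℝ) : ℝ :=
  sInf (functional a b (p₁ + 2) (p₀ + 2) '' massShell d p₀ m)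

/-- A standard bump. -/
theorem exists_bump (d : ℕ) : ∃ f : Space d → ℝ, IsLipBump f ∧ 0 < ∫ x, f x ^ 2 := by
  have hb : IsLipBump fun x : Space d => max (1 - ‖x‖) 0 := by
    refine ⟨⟨1, ?_⟩, ?_, fun x => le_max_right _ _⟩
    · refine LipschitzWith.of_dist_le_mul fun x y => ?_
      rw [Real.dist_eq, NNReal.coe_one, one_mul]
      refine (abs_max_sub_max_le_abs _ _ _).trans ?_
      rw [sub_sub_sub_cancel_left, dist_comm, dist_eq_norm]
      exact abs_norm_sub_norm_le _ _
    · refine HasCompactSupport.intro (isCompact_closedBall (0 : Space d) 1) fun x hx => ?_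
      have : 1 < ‖x‖ := by simpa using hx
      exact max_eq_right (by linarith)
  refine ⟨_, hb, ?_⟩
  refine (hb.continuous.pow 2).integral_pos_of_hasCompactSupport_nonneg_nonzero
    (hb.supp.comp_left (g := fun r : ℝ => r ^ 2) (by simp)) (fun x => by positivity) (x := 0) ?_
  simp

theorem exists_bump_of_mass (d : ℕ) {m : ℝ} (hm : 0 ≤ m) :
    ∃ f : Space d → ℝ, IsLipBump f ∧ ∫ x, f x ^ 2 = m := by
  obtain ⟨f, hf, hpos⟩ := exists_bump d
  refine ⟨fun x => Real.sqrt (m / ∫ x, f x ^ 2) * f ((1 : ℝ) • x),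
    hf.dilate (Real.sqrt_nonneg _) one_pos, ?_⟩
  simp_rw [mul_pow, integral_const_mul, one_smul]
  rw [Real.sq_sqrt (by positivity)]
  field_simp

namespace Admissible
variable {a b p₁ p₀ : ℝ} (h : Admissible d a b (p₁ + 2) (p₀ + 2))
include h

theorem bddBelow : ∃ C : ℝ, 0 ≤ C ∧ ∀ m, ∀ u ∈ massShell d p₀ m,
    gradNormSq u - C * m ≤ functional a b (p₁ + 2) (p₀ + 2) u := by
  obtain ⟨C, hC, hu⟩ := h.functional_lower_bound
  refine ⟨C, hC, fun m u hum => ?_⟩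
  have := hu u hum.1.1 hum.2.1
  rwa [hum.2.2] at this

theorem isGLB {m : ℝ} (hm : 0 ≤ m) :
    IsGLB (functional a b (p₁ + 2) (p₀ + 2) '' massShell d p₀ m) (groundInf d a b p₁ p₀ m) := by
  obtain ⟨C, hC, hu⟩ := h.bddBelow
  obtain ⟨f, hf, hfm⟩ := exists_bump_of_mass d hm
  refine isGLB_csInf ⟨_, _, hfm ▸ hf.mem_massShell p₀, rfl⟩ ⟨-C * m, ?_⟩
  rintro _ ⟨u, hum, rfl⟩
  linarith [hu m u hum, gradNormSq_nonneg u]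

theorem groundInf_le {m : ℝ} {u : Space d → ℂ} (hu : u ∈ massShell d p₀ m) :
    groundInf d a b p₁ p₀ m ≤ functional a b (p₁ + 2) (p₀ + 2) u := by
  have hm : 0 ≤ m := hu.2.2 ▸ mass_nonneg u
  exact (h.isGLB hm).1 ⟨u, hu, rfl⟩

theorem groundInf_lower : ∃ C : ℝ, 0 ≤ C ∧ ∀ m, 0 ≤ m → -C * m ≤ groundInf d a b p₁ p₀ m := by
  obtain ⟨C, hC, hu⟩ := h.bddBelow
  refine ⟨C, hC, fun m hm => (h.isGLB hm).2 ?_⟩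
  rintro _ ⟨u, hum, rfl⟩
  linarith [hu m u hum, gradNormSq_nonneg u]

omit h in
theorem dim_pos (h : 1 ≤ d) : (0 : ℝ) < d := by exact_mod_cast h

/-- The dilation turning mass `M` into mass `m`. -/
theorem functional_dilation_eq {M m : ℝ} (hM : 0 < M) (hm : 0 < m) {u : Space d → ℂ}
    (hu : MemH1 u) : functional a b (p₁ + 2) (p₀ + 2)
      (fun x => (1 : ℝ) • u (((M / m) ^ (1 / (d : ℝ))) • x)) =
      (m / M) * ((M / m) ^ (2 / (d : ℝ)) * gradNormSq u - a * powInt (p₁ + 2) u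
        + b * powInt (p₀ + 2) u) := by
  have hd := dim_pos h.dim
  have hMm : 0 < M / m := by positivity
  rw [functional_dilate hu zero_le_one (by positivity)]
  have e1 : ((M / m) ^ (1 / (d : ℝ))) ^ d = M / m := by
    rw [← Real.rpow_natCast, ← Real.rpow_mul hMm.le, one_div_mul_cancel hd.ne', Real.rpow_one]
  have e2 : ((M / m) ^ (1 / (d : ℝ))) ^ 2 = (M / m) ^ (2 / (d : ℝ)) := by
    rw [← Real.rpow_natCast, ← Real.rpow_mul hMm.le]
    congr 1
    push_cast
    ring
  rw [e1, e2, inv_div]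
  simp

theorem mem_massShell_dilation {M m : ℝ} (hM : 0 < M) (hm : 0 < m) {u : Space d → ℂ}
    (hu : u ∈ massShell d p₀ M) :
    (fun x => (1 : ℝ) • u (((M / m) ^ (1 / (d : ℝ))) • x)) ∈ massShell d p₀ m := by
  have hd := dim_pos h.dim
  have hMm : 0 < M / m := by positivity
  have := mem_massShell_dilate hu 1 (B := (M / m) ^ (1 / (d : ℝ))) (by positivity)
  have e1 : ((M / m) ^ (1 / (d : ℝ))) ^ d = M / m := by
    rw [← Real.rpow_natCast, ← Real.rpow_mul hMm.le, one_div_mul_cancel hd.ne', Real.rpow_one]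
  rw [e1] at this
  convert this using 1
  field_simp

/-- Stretching space alone rescales both potential terms like the mass and changes only the weight
of the gradient. The result constrains functions of any mass `M` by the infimum at one mass `m`; it
yields both the subcritical coercivity and an Euler–Lagrange equation without a mass constraint. -/
theorem dilation_inequality {M m : ℝ} (hM : 0 < M) (hm : 0 < m) {u : Space d → ℂ}
    (hu : u ∈ massShell d p₀ M) : groundInf d a b p₁ p₀ m * (M / m) ≤
      (M / m) ^ (2 / (d : ℝ)) * gradNormSq u - a * powInt (p₁ + 2) u + b * powInt (p₀ + 2) u := by
  have h1 := h.groundInf_le (h.mem_massShell_dilation hM hm hu)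
  rw [h.functional_dilation_eq hM hm hu.1] at h1
  have h2 := mul_le_mul_of_nonneg_right h1 (show 0 ≤ M / m by positivity)
  refine h2.trans_eq ?_
  field_simp

/-- Lipschitz bumps suffice to compute the infimum. -/
theorem exists_bump_near {m : ℝ} (hm : 0 < m) {u : Space d → ℂ} (hu : u ∈ massShell d p₀ m)
    {ε : ℝ} (hε : 0 < ε) : ∃ f : Space d → ℝ, IsLipBump f ∧ ∫ x, f x ^ 2 = m ∧
      functional a b (p₁ + 2) (p₀ + 2) (fun x => (f x : ℂ))
        ≤ functional a b (p₁ + 2) (p₀ + 2) u + ε := by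
  have hd := dim_pos h.dim
  obtain ⟨w, hw, hlim, hdir, hpow⟩ := exists_bump_seq hu.1
  have i1 := integrable_rpow_of_massShell h.two_lt.le h.lt.le hu.1.1 hu.2.1
  have i0 := integrable_rpow_of_memLp (by linarith [h.two_lt']) hu.2.1
  have i2 : Integrable fun x => ‖u x‖ ^ (2 : ℝ) := by simpa using integrable_sq_of_memLp hu.1.1
  have t1 := tendsto_integral_rpow_of_le (by linarith [h.two_lt]) hw hlim i1
    (hpow _ (by linarith [h.two_lt]) i1)
  have t0 := tendsto_integral_rpow_of_le (by linarith [h.two_lt']) hw hlim i0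
    (hpow _ (by linarith [h.two_lt']) i0)
  have t2 := tendsto_integral_rpow_of_le (by norm_num) hw hlim i2 (hpow _ (by norm_num) i2)
  have hmass : ∫ x, ‖u x‖ ^ (2 : ℝ) = m := by simpa [mass] using hu.2.2
  simp_rw [hmass, Real.rpow_two] at t2
  have hratio : Tendsto (fun k => (∫ x, w k x ^ 2) / m) atTop (𝓝 1) := by
    simpa [hm.ne'] using t2.div_const m
  have hratio' : Tendsto (fun k => m / ∫ x, w k x ^ 2) atTop (𝓝 1) := by
    have := (tendsto_const_nhds (x := m)).div t2 hm.ne'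
    rwa [div_self hm.ne'] at this
  -- The approximating bumps have mass only close to `m` and are dilated to mass exactly `m`. This
  -- is the resulting value, with their Dirichlet integral replaced by its upper bound `gradNormSq
  -- u`.
  have hB : Tendsto (fun k => (m / ∫ x, w k x ^ 2) * (((∫ x, w k x ^ 2) / m) ^ (2 / (d : ℝ)) *
      gradNormSq u - a * (∫ x, w k x ^ (p₁ + 2)) + b * ∫ x, w k x ^ (p₀ + 2))) atTop
      (𝓝 (functional a b (p₁ + 2) (p₀ + 2) u)) := by
    have h3 := hratio'.mul ((((hratio.rpow_const (p := 2 / (d : ℝ)) (Or.inl one_ne_zero)).mul_const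
      (gradNormSq u)).sub (t1.const_mul a)).add (t0.const_mul b))
    simpa [functional, powInt] using h3
  obtain ⟨k, hk1, hk2⟩ := ((hB.eventually (gt_mem_nhds (show _ < functional a b (p₁ + 2) (p₀ + 2) u
    + ε by linarith))).and (t2.eventually (lt_mem_nhds hm))).exists
  set M := ∫ x, w k x ^ 2 with hM
  have hMm : 0 < M / m := by positivity
  have hmem := h.mem_massShell_dilation hk2 hm ((hw k).mem_massShell p₀)
  have hbump := (hw k).dilate zero_le_one (B := (M / m) ^ (1 / (d : ℝ))) (by positivity)
  have hcoe := IsLipBump.dilate_coe (w k) 1 ((M / m) ^ (1 / (d : ℝ)))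
  refine ⟨_, hbump, ?_, ?_⟩
  · rw [← hbump.mass_eq, hcoe]; exact hmem.2.2
  · rw [hcoe, h.functional_dilation_eq hk2 hm (hw k).memH1, (hw k).gradNormSq_eq, (hw k).powInt_eq,
      (hw k).powInt_eq]
    refine le_trans ?_ hk1.le
    have : 0 ≤ m / M := by positivity
    have h5 := hdir k
    gcongr

theorem exists_bump_lt {m : ℝ} (hm : 0 < m) {E : ℝ} (hE : groundInf d a b p₁ p₀ m < E) :
    ∃ f : Space d → ℝ, IsLipBump f ∧ ∫ x, f x ^ 2 = m ∧
      functional a b (p₁ + 2) (p₀ + 2) (fun x => (f x : ℂ)) < E := by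
  obtain ⟨_, ⟨u, hu, rfl⟩, -, hlt⟩ := (h.isGLB hm.le).exists_between hE
  obtain ⟨f, hf, hfm, hfE⟩ := h.exists_bump_near hm hu
    (ε := (E - functional a b (p₁ + 2) (p₀ + 2) u) / 2) (by linarith)
  exact ⟨f, hf, hfm, by linarith⟩

/-- Under the mass-preserving scaling B^{d/2} u(B·) every term carries a positive power of B, so
letting B → 0 sends the functional to 0. -/
theorem groundInf_nonpos {m : ℝ} (hm : 0 ≤ m) : groundInf d a b p₁ p₀ m ≤ 0 := by
  have hd := dim_pos h.dim
  obtain ⟨f, hf, hfm⟩ := exists_bump_of_mass d hm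
  set u : Space d → ℂ := fun x => (f x : ℂ)
  have key : ∀ B : ℝ, 0 < B → groundInf d a b p₁ p₀ m ≤ B ^ 2 * gradNormSq u
      - a * B ^ (d * p₁ / 2) * powInt (p₁ + 2) u + b * B ^ (d * p₀ / 2) * powInt (p₀ + 2) u := by
    intro B hB
    have hA2 : (B ^ ((d : ℝ) / 2)) ^ 2 = B ^ d := by
      rw [← Real.rpow_natCast, ← Real.rpow_mul hB.le, ← Real.rpow_natCast B d]
      congr 1; push_cast; ring
    have hAq : ∀ p : ℝ, (B ^ ((d : ℝ) / 2)) ^ (p + 2) = B ^ d * B ^ (d * p / 2) := by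
      intro p
      rw [← Real.rpow_mul hB.le, ← Real.rpow_natCast B d, ← Real.rpow_add hB]
      congr 1; ring
    have hBd : B ^ d ≠ 0 := by positivity
    have hmem := mem_massShell_dilate (hfm ▸ hf.mem_massShell p₀) (B ^ ((d : ℝ) / 2)) hB
    rw [hA2, mul_inv_cancel₀ hBd, one_mul] at hmem
    have h1 := h.groundInf_le hmem
    rw [functional_dilate hf.memH1 (by positivity) hB, hA2, hAq, hAq] at h1
    refine h1.trans_eq ?_
    field_simp
    rfl
  have hp1 : 0 < p₁ := by linarith [h.two_lt]
  have hp0 : 0 < p₀ := by linarith [h.two_lt']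
  have hlim : Tendsto (fun B : ℝ => B ^ 2 * gradNormSq u
      - a * B ^ (d * p₁ / 2) * powInt (p₁ + 2) u + b * B ^ (d * p₀ / 2) * powInt (p₀ + 2) u)
      (𝓝[>] 0) (𝓝 0) := by
    have hc : Continuous fun B : ℝ => B ^ 2 * gradNormSq u
      - a * B ^ (d * p₁ / 2) * powInt (p₁ + 2) u + b * B ^ (d * p₀ / 2) * powInt (p₀ + 2) u := by
      have c1 : Continuous fun B : ℝ => B ^ (d * p₁ / 2) :=
        Real.continuous_rpow_const (by positivity)
      have c0 : Continuous fun B : ℝ => B ^ (d * p₀ / 2) :=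
        Real.continuous_rpow_const (by positivity)
      fun_prop
    have h2 := (hc.tendsto 0).mono_left (nhdsWithin_le_nhds (s := Ioi 0))
    rw [Real.zero_rpow (by positivity), Real.zero_rpow (by positivity)] at h2
    simpa using h2
  refine ge_of_tendsto hlim ?_
  filter_upwards [self_mem_nhdsWithin] with B hB using key B hB

theorem groundInf_zero : groundInf d a b p₁ p₀ 0 = 0 := by
  refine le_antisymm (h.groundInf_nonpos le_rfl) ?_
  obtain ⟨C, -, hC⟩ := h.groundInf_lower
  simpa using hC 0 le_rfl

/-- Take a near-optimal bump of mass (x + y)/2 and a hyperplane with mass x/2 on one side. The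
folded halves have masses x and y, and together twice the energy. -/
theorem groundInf_midpoint {x y : ℝ} (hx : 0 ≤ x) (hy : 0 ≤ y) :
    groundInf d a b p₁ p₀ x + groundInf d a b p₁ p₀ y ≤ 2 * groundInf d a b p₁ p₀ ((x + y) / 2) := by
  rcases (add_nonneg hx hy).eq_or_lt with h0 | hpos
  · have hx0 : x = 0 := by linarith
    have hy0 : y = 0 := by linarith
    simp [hx0, hy0, h.groundInf_zero]
  refine le_of_forall_pos_lt_add fun ε hε => ?_
  obtain ⟨f, hf, hfm, hfE⟩ := h.exists_bump_lt (m := (x + y) / 2) (by positivity)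
    (E := groundInf d a b p₁ p₀ ((x + y) / 2) + ε / 2) (by linarith)
  obtain ⟨g₁, g₂, hg₁, hg₂, hm₁, hm₂, hsum⟩ := hf.exists_fold h.dim (α := x / 2) (by positivity)
    (by rw [hfm]; linarith) a b (q₁ := p₁ + 2) (q₀ := p₀ + 2) (by linarith [h.two_lt])
    (by linarith [h.two_lt'])
  have e1 : ∫ x, g₁ x ^ 2 = x := by rw [hm₁]; ring
  have e2 : ∫ x, g₂ x ^ 2 = y := by rw [hm₂, hfm]; ring
  have l1 := h.groundInf_le (e1 ▸ hg₁.mem_massShell p₀)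
  have l2 := h.groundInf_le (e2 ▸ hg₂.mem_massShell p₀)
  linarith

theorem concaveOn_groundInf : ConcaveOn ℝ (Ici 0) (groundInf d a b p₁ p₀) := by
  refine concaveOn_of_midpoint (fun x y hx hy => h.groundInf_midpoint hx hy) fun R => ?_
  obtain ⟨C, hC0, hC⟩ := h.groundInf_lower
  refine ⟨-C * R, fun x hx hxR => le_trans ?_ (hC x hx)⟩
  nlinarith

theorem antitoneOn_groundInf : AntitoneOn (groundInf d a b p₁ p₀) (Ici 0) :=
  antitoneOn_of_concave h.concaveOn_groundInf (fun _ hm => h.groundInf_nonpos hm) h.groundInf_zero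

/-- Fix an amplitude at which the potential part is negative, then spread the profile out: relative
to the potential, the gradient term gains a factor B² and disappears. -/
theorem exists_groundInf_neg : ∃ m, 0 ≤ m ∧ groundInf d a b p₁ p₀ m < 0 := by
  have hd := dim_pos h.dim
  obtain ⟨f, hf, hpos⟩ := exists_bump d
  set u : Space d → ℂ := fun x => (f x : ℂ)
  have hne : ∃ x, f x ≠ 0 := by
    by_contra hcon
    push Not at hcon
    simp [hcon] at hpos
  obtain ⟨x₀, hx₀⟩ := hne
  have hPpos : ∀ q : ℝ, 0 < q → 0 < powInt q u := by
    intro q hq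
    rw [hf.powInt_eq]
    refine (hf.continuous.rpow_const fun x => Or.inr
      hq.le).integral_pos_of_hasCompactSupport_nonneg_nonzero
      (hf.supp.comp_left (g := fun r : ℝ => r ^ q) (Real.zero_rpow hq.ne'))
      (fun x => Real.rpow_nonneg (hf.nonneg x) q) (x := x₀) ?_
    exact (Real.rpow_pos_of_pos (lt_of_le_of_ne (hf.nonneg _) hx₀.symm) q).ne'
  have hp1 : 0 < p₁ + 2 := by linarith [h.two_lt]
  have hp0 : 0 < p₀ + 2 := by linarith [h.two_lt']
  have ha := h.ha
  have hb := h.hb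
  have hP1 := hPpos _ hp1
  have hP0 := hPpos _ hp0
  have hlt := h.lt
  obtain ⟨A, hA, hN⟩ : ∃ A : ℝ, 0 < A ∧
      -a * A ^ (p₁ + 2) * powInt (p₁ + 2) u + b * A ^ (p₀ + 2) * powInt (p₀ + 2) u < 0 := by
    -- Half the value of A^{p₀−p₁} at which the two potential terms balance.
    set r := a * powInt (p₁ + 2) u / (2 * b * powInt (p₀ + 2) u) with hr
    have hr0 : 0 < r := by positivity
    refine ⟨r ^ (p₀ - p₁)⁻¹, by positivity, ?_⟩
    set A := r ^ (p₀ - p₁)⁻¹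
    have hA0 : 0 < A := by positivity
    have e1 : A ^ (p₀ + 2) = A ^ (p₁ + 2) * r := by
      have : A ^ (p₀ - p₁) = r := by
        rw [← Real.rpow_mul hr0.le, inv_mul_cancel₀ (by linarith), Real.rpow_one]
      rw [← this, ← Real.rpow_add hA0]; congr 1; ring
    rw [e1]
    have e2 : b * (A ^ (p₁ + 2) * r) * powInt (p₀ + 2) u
        = A ^ (p₁ + 2) * (a * powInt (p₁ + 2) u) / 2 := by
      rw [hr]; field_simp
    rw [e2]
    have : 0 < A ^ (p₁ + 2) * (a * powInt (p₁ + 2) u) := by positivity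
    linarith
  set N := -a * A ^ (p₁ + 2) * powInt (p₁ + 2) u + b * A ^ (p₀ + 2) * powInt (p₀ + 2) u with hNdef
  have hlim : Tendsto (fun B : ℝ => A ^ 2 * B ^ 2 * gradNormSq u + N) (𝓝[>] 0) (𝓝 N) := by
    have hc : Continuous fun B : ℝ => A ^ 2 * B ^ 2 * gradNormSq u + N := by fun_prop
    have h2 := (hc.tendsto 0).mono_left (nhdsWithin_le_nhds (s := Ioi 0))
    simpa using h2
  obtain ⟨B, hB1, hB⟩ := ((hlim.eventually (gt_mem_nhds hN)).and self_mem_nhdsWithin).exists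
  have hB0 : 0 < B := hB
  have hmem := mem_massShell_dilate (hf.mem_massShell p₀) A hB0
  refine ⟨_, hmem.2.2 ▸ mass_nonneg _, (h.groundInf_le hmem).trans_lt ?_⟩
  rw [functional_dilate hf.memH1 hA.le hB0]
  refine mul_neg_of_pos_of_neg (by positivity) ?_
  linarith

end Admissible

/-! ### A weak-type mass-critical Gagliardo–Nirenberg inequality -/

theorem IsLipBump.integrable_translate_sub_sq {v : Space d → ℝ} (hv : IsLipBump v) (k k' : Space d) :
    Integrable fun x => (v (x + k) - v (x + k')) ^ 2 := by
  have h1 : HasCompactSupport fun x => v (x + k) := hv.supp.comp_homeomorph (Homeomorph.addRight k)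
  have h2 : HasCompactSupport fun x => v (x + k') :=
    hv.supp.comp_homeomorph (Homeomorph.addRight k')
  have hc := hv.continuous
  refine Continuous.integrable_of_hasCompactSupport (by fun_prop) ?_
  exact (h1.sub h2).comp_left (g := fun r : ℝ => r ^ 2) (by simp)

/-- The `L²` modulus of continuity is controlled by the Dirichlet integral. -/
theorem IsLipBump.integral_translate_sub_sq_le {v : Space d → ℝ} (hv : IsLipBump v) (k : Space d) :
    ∫ x, (v (x + k) - v x) ^ 2 ≤ ‖k‖ ^ 2 * dirichlet v := by
  obtain ⟨K, hK⟩ := hv.lip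
  -- Cut the translation into n + 1 equal ones and use Cauchy–Schwarz and translation invariance. As
  -- n → ∞ the right side becomes the integral of the squared line derivative, which exists almost
  -- everywhere by Rademacher.
  have hstep : ∀ n : ℕ, ∫ x, (v (x + k) - v x) ^ 2 ≤
      ∫ x, (((n : ℝ) + 1) * (v (x + ((n : ℝ) + 1)⁻¹ • k) - v x)) ^ 2 := by
    intro n
    set t : ℝ := ((n : ℝ) + 1)⁻¹ with ht
    have ht1 : ((n : ℝ) + 1) * t = 1 := by rw [ht]; field_simp
    have hpt : ∀ x, (v (x + k) - v x) ^ 2 ≤ ((n : ℝ) + 1) * ∑ j ∈ Finset.range (n + 1),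
        (v (x + ((j + 1 : ℕ) * t : ℝ) • k) - v (x + ((j : ℕ) * t : ℝ) • k)) ^ 2 := by
      intro x
      have h1 : v (x + k) - v x = ∑ j ∈ Finset.range (n + 1),
          (v (x + ((j + 1 : ℕ) * t : ℝ) • k) - v (x + ((j : ℕ) * t : ℝ) • k)) := by
        rw [Finset.sum_range_sub (fun j : ℕ => v (x + ((j : ℕ) * t : ℝ) • k))]
        push_cast
        rw [ht1]; simp
      rw [h1]
      refine sq_sum_le_card_mul_sum_sq.trans_eq ?_
      simp
    have hone : ∀ j : ℕ, ∫ x, (v (x + ((j + 1 : ℕ) * t : ℝ) • k) - v (x + ((j : ℕ) * t : ℝ) • k)) ^ 2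
        = ∫ x, (v (x + t • k) - v x) ^ 2 := by
      intro j
      rw [← integral_add_right_eq_self (fun x => (v (x + t • k) - v x) ^ 2) (((j : ℕ) * t : ℝ) • k)]
      congr 1; ext x
      congr 3
      push_cast
      module
    calc ∫ x, (v (x + k) - v x) ^ 2 ≤ ∫ x, ((n : ℝ) + 1) * ∑ j ∈ Finset.range (n + 1),
        (v (x + ((j + 1 : ℕ) * t : ℝ) • k) - v (x + ((j : ℕ) * t : ℝ) • k)) ^ 2 := by
          refine integral_mono (by simpa using hv.integrable_translate_sub_sq k 0) ?_ hpt
          exact (integrable_finsetSum _ fun j _ => hv.integrable_translate_sub_sq _ _).const_mul _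
      _ = ((n : ℝ) + 1) * (((n : ℝ) + 1) * ∫ x, (v (x + t • k) - v x) ^ 2) := by
          rw [integral_const_mul, integral_finsetSum _ fun j _ => hv.integrable_translate_sub_sq _ _]
          simp_rw [hone]
          simp
      _ = _ := by
          simp_rw [mul_pow, integral_const_mul]
          ring
  obtain ⟨R, hR⟩ := hv.supp.isCompact.isBounded.subset_closedBall 0
  have hlim : Tendsto (fun n : ℕ => ∫ x, (((n : ℝ) + 1) * (v (x + ((n : ℝ) + 1)⁻¹ • k) - v x)) ^ 2)
      atTop (𝓝 (∫ x, (lineDeriv ℝ v x k) ^ 2)) := by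
    refine tendsto_integral_of_dominated_convergence
      ((Metric.closedBall (0 : Space d) (R + ‖k‖)).indicator fun _ => (K * ‖k‖) ^ 2) (fun n => ?_) ?_
      (fun n => ?_) ?_
    · have hc := hv.continuous
      exact Continuous.aestronglyMeasurable (by fun_prop)
    · rw [integrable_indicator_iff measurableSet_closedBall]
      exact integrableOn_const (by exact measure_closedBall_lt_top.ne)
    · refine Eventually.of_forall fun x => ?_
      have ht : 0 < ((n : ℝ) + 1)⁻¹ := by positivity
      have ht1 : ((n : ℝ) + 1)⁻¹ ≤ 1 := inv_le_one_of_one_le₀ (by simp)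
      by_cases hx : x ∈ Metric.closedBall (0 : Space d) (R + ‖k‖)
      · rw [indicator_of_mem hx, Real.norm_of_nonneg (by positivity)]
        refine sq_le_sq' ?_ ?_ <;> [apply neg_le_of_abs_le; apply le_of_abs_le]
        all_goals
          rw [abs_mul, abs_of_pos (by positivity)]
          have h1 := hK.dist_le_mul (x + ((n : ℝ) + 1)⁻¹ • k) x
          rw [Real.dist_eq, dist_eq_norm, add_sub_cancel_left, norm_smul,
            Real.norm_of_nonneg ht.le] at h1
          refine (mul_le_mul_of_nonneg_left h1 (by positivity)).trans_eq ?_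
          field_simp
      · rw [indicator_of_notMem hx]
        have hx' : R + ‖k‖ < ‖x‖ := by simpa using hx
        have h1 : v x = 0 := by
          by_contra hne
          have := mem_closedBall_zero_iff.1 (hR (subset_tsupport v hne))
          linarith [norm_nonneg k]
        have h2 : v (x + ((n : ℝ) + 1)⁻¹ • k) = 0 := by
          by_contra hne
          have h3 := mem_closedBall_zero_iff.1 (hR (subset_tsupport v hne))
          have h4 := norm_sub_norm_le x (-(((n : ℝ) + 1)⁻¹ • k))
          rw [sub_neg_eq_add, norm_neg, norm_smul, Real.norm_of_nonneg ht.le] at h4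
          nlinarith [norm_nonneg k]
        simp [h1, h2]
    · filter_upwards [hK.ae_lineDifferentiableAt (μ := volume) k] with x hx
      have h1 := hx.hasLineDerivAt.tendsto_slope_zero_right
      have h2 : Tendsto (fun n : ℕ => ((n : ℝ) + 1)⁻¹) atTop (𝓝[>] 0) := by
        refine tendsto_nhdsWithin_iff.2 ⟨?_, Eventually.of_forall fun n => ?_⟩
        · simpa using tendsto_one_div_add_atTop_nhds_zero_nat (𝕜 := ℝ)
        · change 0 < ((n : ℝ) + 1)⁻¹; positivity
      have h3 := (h1.comp h2).pow 2
      refine h3.congr fun n => ?_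
      simp
  refine (ge_of_tendsto' hlim hstep).trans ?_
  unfold dirichlet
  rw [← integral_const_mul]
  refine integral_mono_of_nonneg (Eventually.of_forall fun x => by positivity)
    (hv.integrable_fderiv_sq.const_mul _) ?_
  filter_upwards [hK.ae_differentiableAt (μ := volume)] with x hx
  rw [hx.lineDeriv_eq_fderiv, ← mul_pow, ← sq_abs]
  refine pow_le_pow_left₀ (abs_nonneg _) ?_ 2
  rw [mul_comm]
  exact (fderiv ℝ v x).le_opNorm k

/-- A superlevel set estimate: if `{v > t/2}` fills at most half of a ball of radius `r`, then
`{v > t}` is controlled by the Dirichlet integral. -/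
theorem IsLipBump.measure_superlevel_le {v : Space d → ℝ} (hv : IsLipBump v) {t r : ℝ} (ht : 0 < t)
    (hr : 0 < r)
    (hvol : volume {x | t / 2 < v x} ≤ volume (Metric.ball (0 : Space d) r) / 2) :
    volume {x | t < v x} ≤ ENNReal.ofReal (8 * r ^ 2 / t ^ 2 * dirichlet v) := by
  set Bl := Metric.ball (0 : Space d) r with hBl
  have hc := hv.continuous
  have hBpos : volume Bl ≠ 0 := (Metric.measure_ball_pos volume _ hr).ne'
  have hBtop : volume Bl ≠ ⊤ := measure_ball_lt_top.ne
  have hmeas : Measurable (Function.uncurry fun (x k : Space d) =>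
      ENNReal.ofReal ((v (x + k) - v x) ^ 2)) := by
    refine ENNReal.measurable_ofReal.comp (Continuous.measurable ?_)
    fun_prop
  -- The same double integral is estimated in two ways: above by the translation bound for each k,
  -- below by restricting to points with v x > t.
  have hup : ∫⁻ x, ∫⁻ k in Bl, ENNReal.ofReal ((v (x + k) - v x) ^ 2)
      ≤ ENNReal.ofReal (r ^ 2 * dirichlet v) * volume Bl := by
    rw [lintegral_lintegral_swap hmeas.aemeasurable, ← setLIntegral_const]
    refine setLIntegral_mono measurable_const fun k hk => ?_
    rw [← ofReal_integral_eq_lintegral_ofReal (by simpa using hv.integrable_translate_sub_sq k 0)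
      (Eventually.of_forall fun x => by positivity)]
    refine ENNReal.ofReal_le_ofReal ((hv.integral_translate_sub_sq_le k).trans ?_)
    have : ‖k‖ ≤ r := (mem_ball_zero_iff.1 hk).le
    have := dirichlet_nonneg v
    gcongr
  -- At least half of the ball consists of shifts k with v(x + k) ≤ t/2, and for each of them the
  -- increment exceeds t/2.
  have hlow : ∀ x ∈ {x | t < v x}, ENNReal.ofReal (t ^ 2 / 4) * (volume Bl / 2)
      ≤ ∫⁻ k in Bl, ENNReal.ofReal ((v (x + k) - v x) ^ 2) := by
    intro x hx
    have hx' : t < v x := hx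
    have hSm : MeasurableSet {k | v (x + k) ≤ t / 2} :=
      (isClosed_le (by fun_prop) continuous_const).measurableSet
    have h1 : volume {k | t / 2 < v (x + k)} = volume {x | t / 2 < v x} :=
      measure_preimage_add volume x {x | t / 2 < v x}
    have h2 : volume Bl / 2 ≤ volume (Bl ∩ {k | v (x + k) ≤ t / 2}) := by
      have h3 : volume Bl ≤ volume (Bl ∩ {k | v (x + k) ≤ t / 2}) + volume Bl / 2 := by
        rw [← measure_inter_add_sdiff Bl hSm]
        gcongr
        rw [measure_inter_add_sdiff Bl hSm]
        refine le_trans (measure_mono fun k hk => ?_) (h1.trans_le hvol)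
        exact not_le.1 fun hle : v (x + k) ≤ t / 2 => hk.2 hle
      have h4 : volume Bl / 2 ≠ ⊤ := ENNReal.div_ne_top hBtop (by norm_num)
      refine (ENNReal.add_le_add_iff_right h4).1 ?_
      rwa [ENNReal.add_halves]
    calc ENNReal.ofReal (t ^ 2 / 4) * (volume Bl / 2)
        ≤ ENNReal.ofReal (t ^ 2 / 4) * volume (Bl ∩ {k | v (x + k) ≤ t / 2}) := by gcongr
      _ = ∫⁻ k in Bl ∩ {k | v (x + k) ≤ t / 2}, ENNReal.ofReal (t ^ 2 / 4) :=
          (setLIntegral_const _ _).symm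
      _ ≤ ∫⁻ k in Bl ∩ {k | v (x + k) ≤ t / 2}, ENNReal.ofReal ((v (x + k) - v x) ^ 2) := by
          refine setLIntegral_mono (by fun_prop) fun k hk => ENNReal.ofReal_le_ofReal ?_
          have : v (x + k) ≤ t / 2 := hk.2
          nlinarith
      _ ≤ _ := lintegral_mono_set inter_subset_left
  have hmS : MeasurableSet {x | t < v x} := (isOpen_lt continuous_const hc).measurableSet
  have hmain : ENNReal.ofReal (t ^ 2 / 4) * (volume Bl / 2) * volume {x | t < v x}
      ≤ ENNReal.ofReal (r ^ 2 * dirichlet v) * volume Bl := by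
    refine le_trans ?_ hup
    rw [← setLIntegral_const]
    refine (setLIntegral_mono' hmS hlow).trans ?_
    exact setLIntegral_le_lintegral _ _
  have hmain2 : ENNReal.ofReal (t ^ 2 / 8) * volume {x | t < v x}
      ≤ ENNReal.ofReal (r ^ 2 * dirichlet v) := by
    have e : ENNReal.ofReal (t ^ 2 / 4) * (volume Bl / 2) * volume {x | t < v x}
        = ENNReal.ofReal (t ^ 2 / 8) * volume {x | t < v x} * volume Bl := by
      have : ENNReal.ofReal (t ^ 2 / 8) = ENNReal.ofReal (t ^ 2 / 4) * 2⁻¹ := by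
        rw [show (2 : ℝ≥0∞)⁻¹ = ENNReal.ofReal (1 / 2) by
          rw [one_div, ENNReal.ofReal_inv_of_pos (by norm_num)]; simp,
          ← ENNReal.ofReal_mul (by positivity)]
        congr 1; ring
      rw [this, div_eq_mul_inv (volume Bl)]
      ring
    rw [e] at hmain
    exact (ENNReal.mul_le_mul_iff_left hBpos hBtop).1 hmain
  have h8 : 0 < t ^ 2 / 8 := by positivity
  have h9 : volume {x | t < v x} ≤ ENNReal.ofReal (r ^ 2 * dirichlet v) / ENNReal.ofReal (t ^ 2 / 8) := by
    rw [ENNReal.le_div_iff_mul_le (Or.inl (by simpa using h8)) (Or.inl ENNReal.ofReal_ne_top),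
      mul_comm]
    exact hmain2
  rw [← ENNReal.ofReal_div_of_pos h8] at h9
  refine h9.trans_eq ?_
  congr 1
  field_simp

theorem volume_ball_eq (d : ℕ) {r : ℝ} (hr : 0 < r) : volume (Metric.ball (0 : Space d) r)
    = ENNReal.ofReal (r ^ d * (volume (Metric.ball (0 : Space d) 1)).toReal) := by
  rw [Measure.addHaar_ball_of_pos _ _ hr, ENNReal.ofReal_mul (by positivity),
    ENNReal.ofReal_toReal measure_ball_lt_top.ne]
  simp

/-- Volume of the unit ball. -/
noncomputable def ballVol (d : ℕ) : ℝ := (volume (Metric.ball (0 : Space d) 1)).toReal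

theorem ballVol_pos (d : ℕ) : 0 < ballVol d :=
  ENNReal.toReal_pos (Metric.measure_ball_pos volume _ one_pos).ne' measure_ball_lt_top.ne

theorem IsLipBump.chebyshev {v : Space d → ℝ} (hv : IsLipBump v) {A t : ℝ} (ht : 0 < t)
    (hA : ∫ x, v x ^ 2 ≤ A) : volume {x | t < v x} ≤ ENNReal.ofReal (A / t ^ 2) := by
  have h1 := mul_meas_ge_le_integral_of_nonneg (Eventually.of_forall fun x => sq_nonneg (v x))
    hv.integrable_sq (t ^ 2)
  have hfin : volume {x | t ^ 2 ≤ v x ^ 2} ≠ ⊤ := by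
    refine ne_of_lt (lt_of_le_of_lt (measure_mono fun x hx => ?_)
      (hv.supp.isCompact.measure_lt_top (μ := volume)))
    refine subset_tsupport v fun h0 => ?_
    have hx' : t ^ 2 ≤ v x ^ 2 := hx
    rw [h0] at hx'
    nlinarith
  have hsub : volume {x | t < v x} ≤ volume {x | t ^ 2 ≤ v x ^ 2} :=
    measure_mono fun x hx => pow_le_pow_left₀ ht.le (le_of_lt hx) 2
  refine hsub.trans ?_
  rw [← ENNReal.ofReal_toReal hfin]
  refine ENNReal.ofReal_le_ofReal ?_
  rw [le_div_iff₀ (by positivity)]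
  rw [measureReal_def] at h1
  linarith

/-- The constant in the weak-type Gagliardo–Nirenberg inequality. -/
noncomputable def weakConst (d : ℕ) : ℝ := 8 * (8 / ballVol d) ^ (2 / (d : ℝ))

theorem weakConst_pos (d : ℕ) : 0 < weakConst d := by
  have := ballVol_pos d
  unfold weakConst
  positivity

/-- Weak-type mass-critical Gagliardo–Nirenberg inequality. -/
theorem IsLipBump.weak_gagliardo_nirenberg {v : Space d → ℝ} (hv : IsLipBump v) (hd : 1 ≤ d)
    {A t : ℝ} (hA0 : 0 < A) (ht : 0 < t) (hA : ∫ x, v x ^ 2 ≤ A) : volume {x | t < v x} ≤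
      ENNReal.ofReal (weakConst d * A ^ (2 / (d : ℝ)) * t ^ (-2 - 4 / (d : ℝ)) * dirichlet v) := by
  have hω := ballVol_pos d
  have hd0 : (0 : ℝ) < d := by exact_mod_cast hd
  -- With this radius, half the volume of the ball is 4A/t², the Chebyshev bound for the level t/2.
  set r : ℝ := (8 * A / (ballVol d * t ^ 2)) ^ (1 / (d : ℝ)) with hr
  have hb : 0 < 8 * A / (ballVol d * t ^ 2) := by positivity
  have hr0 : 0 < r := by positivity
  have hrd : r ^ d = 8 * A / (ballVol d * t ^ 2) := by
    rw [hr, ← Real.rpow_natCast, ← Real.rpow_mul hb.le, one_div_mul_cancel hd0.ne', Real.rpow_one]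
  have h1 := hv.measure_superlevel_le ht hr0 (by
    refine (hv.chebyshev (half_pos ht) hA).trans ?_
    rw [volume_ball_eq d hr0, show (volume (Metric.ball (0 : Space d) 1)).toReal = ballVol d from rfl,
      hrd, ENNReal.le_div_iff_mul_le (by simp) (by simp),
      show (2 : ℝ≥0∞) = ENNReal.ofReal 2 by simp, ← ENNReal.ofReal_mul (by positivity)]
    refine ENNReal.ofReal_le_ofReal (le_of_eq ?_)
    field_simp
    norm_num)
  refine h1.trans_eq ?_
  congr 1
  have hr2 : r ^ 2 = (8 / ballVol d) ^ (2 / (d : ℝ)) * A ^ (2 / (d : ℝ)) * t ^ (-(4 / (d : ℝ))) := by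
    rw [hr, ← Real.rpow_natCast, ← Real.rpow_mul hb.le,
      show 8 * A / (ballVol d * t ^ 2) = (8 / ballVol d) * A * t ^ (-2 : ℝ) by
        rw [Real.rpow_neg ht.le, Real.rpow_two]; field_simp,
      Real.mul_rpow (by positivity) (by positivity), Real.mul_rpow (by positivity) hA0.le,
      ← Real.rpow_mul ht.le]
    push_cast
    congr 2
    · ring_nf
    · ring_nf
    · ring_nf
  rw [hr2, show (-2 - 4 / (d : ℝ)) = -(4 / (d : ℝ)) + -2 by ring, Real.rpow_add ht,
    Real.rpow_neg ht.le 2, Real.rpow_two]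
  unfold weakConst
  field_simp

theorem lintegral_rpow_Ioc {θ t₀ : ℝ} (hθ : 0 < θ) (ht₀ : 0 ≤ t₀) :
    ∫⁻ t in Ioc 0 t₀, ENNReal.ofReal (t ^ (θ - 1)) = ENNReal.ofReal (t₀ ^ θ / θ) := by
  have hi : IntervalIntegrable (fun t : ℝ => t ^ (θ - 1)) volume 0 t₀ :=
    intervalIntegral.intervalIntegrable_rpow' (by linarith)
  rw [← ofReal_integral_eq_lintegral_ofReal ((intervalIntegrable_iff_integrableOn_Ioc_of_le ht₀).1 hi)
    ((ae_restrict_iff' measurableSet_Ioc).2 (Eventually.of_forall fun t ht =>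
      Real.rpow_nonneg ht.1.le _)), ← intervalIntegral.integral_of_le ht₀,
    integral_rpow (Or.inl (by linarith))]
  simp [Real.zero_rpow hθ.ne']

/-- A strong-type inequality obtained from the weak-type one below level `t₀` and from a given
bound of the superlevel sets above. -/
theorem IsLipBump.integral_rpow_le {v : Space d → ℝ} (hv : IsLipBump v) (hd : 1 ≤ d)
    {A K t₀ q B : ℝ} (hA0 : 0 < A) (hA : ∫ x, v x ^ 2 ≤ A) (hK : ∀ x, v x ≤ K) (ht₀ : 0 < t₀)
    (ht₀K : t₀ ≤ K) (hq : 2 + 4 / (d : ℝ) < q) (hB0 : 0 ≤ B)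
    (hB : ∀ t, t₀ < t → t < K → volume {x | t < v x} ≤ ENNReal.ofReal (B * dirichlet v)) :
    ∫ x, v x ^ q ≤ (q * weakConst d * A ^ (2 / (d : ℝ)) * t₀ ^ (q - 2 - 4 / (d : ℝ))
      / (q - 2 - 4 / (d : ℝ)) + B * K ^ q) * dirichlet v := by
  have hd0 : (0 : ℝ) < d := by exact_mod_cast hd
  have hq0 : 0 < q := by have : 0 < 4 / (d : ℝ) := by positivity
                         linarith
  have hθ : 0 < q - 2 - 4 / (d : ℝ) := by linarith
  set θ := q - 2 - 4 / (d : ℝ) with hθdef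
  have hD := dirichlet_nonneg v
  have hW := weakConst_pos d
  have hK0 : 0 < K := ht₀.trans_le ht₀K
  have hlayer := lintegral_rpow_eq_lintegral_meas_lt_mul (volume : Measure (Space d))
    (f := v) (Eventually.of_forall hv.nonneg) hv.continuous.measurable.aemeasurable hq0
  set C₁ := weakConst d * A ^ (2 / (d : ℝ)) * dirichlet v with hC₁
  have hC₁0 : 0 ≤ C₁ := by positivity
  -- The weak-type bound leaves t^{θ−1} with θ = q − 2 − 4/d, integrable at zero exactly because `q`
  -- is mass-supercritical.
  have hlow : ∫⁻ t in Ioc 0 t₀, volume {x | t < v x} * ENNReal.ofReal (t ^ (q - 1))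
      ≤ ENNReal.ofReal (C₁ * (t₀ ^ θ / θ)) := by
    rw [ENNReal.ofReal_mul hC₁0, ← lintegral_rpow_Ioc hθ ht₀.le,
      ← lintegral_const_mul' _ _ ENNReal.ofReal_ne_top]
    refine setLIntegral_mono' measurableSet_Ioc fun t ht => ?_
    have ht0 : 0 < t := ht.1
    refine (mul_le_mul_left (hv.weak_gagliardo_nirenberg hd hA0 ht0 hA) _).trans_eq ?_
    rw [← ENNReal.ofReal_mul (by positivity), ← ENNReal.ofReal_mul hC₁0]
    congr 1
    rw [show θ - 1 = (-2 - 4 / (d : ℝ)) + (q - 1) by rw [hθdef]; ring, Real.rpow_add ht0, hC₁]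
    ring
  -- The superlevel sets are empty from level `K` on, so the assumed bound is only integrated over a
  -- bounded range.
  have hhigh : ∫⁻ t in Ioi t₀, volume {x | t < v x} * ENNReal.ofReal (t ^ (q - 1))
      ≤ ENNReal.ofReal (B * dirichlet v * (K ^ q / q)) := by
    have h1 : ∫⁻ t in Ioi t₀, volume {x | t < v x} * ENNReal.ofReal (t ^ (q - 1))
        ≤ ∫⁻ t in Ioi t₀, (Ioc 0 K).indicator
          (fun t => ENNReal.ofReal (B * dirichlet v) * ENNReal.ofReal (t ^ (q - 1))) t := by
      refine setLIntegral_mono' measurableSet_Ioi fun t ht => ?_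
      have ht' : t₀ < t := ht
      rcases lt_or_ge t K with htK | htK
      · rw [indicator_of_mem (show t ∈ Ioc 0 K from ⟨ht₀.trans ht', htK.le⟩)]
        exact mul_le_mul_left (hB t ht' htK) _
      · have : {x | t < v x} = ∅ := by
          ext x
          simp only [mem_ofPred_eq, mem_empty_iff_false, iff_false, not_lt]
          exact (hK x).trans htK
        rw [this]; simp
    refine h1.trans ?_
    refine (setLIntegral_le_lintegral _ _).trans ?_
    rw [lintegral_indicator measurableSet_Ioc, lintegral_const_mul' _ _ ENNReal.ofReal_ne_top,
      lintegral_rpow_Ioc hq0 hK0.le, ← ENNReal.ofReal_mul (by positivity)]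
  have hsplit : ∫⁻ t in Ioi (0 : ℝ), volume {x | t < v x} * ENNReal.ofReal (t ^ (q - 1))
      ≤ ENNReal.ofReal (C₁ * (t₀ ^ θ / θ) + B * dirichlet v * (K ^ q / q)) := by
    rw [← Ioc_union_Ioi_eq_Ioi ht₀.le, ENNReal.ofReal_add (by positivity) (by positivity)]
    exact (lintegral_union_le _ _ _).trans (add_le_add hlow hhigh)
  have hfinal : ENNReal.ofReal (∫ x, v x ^ q)
      ≤ ENNReal.ofReal (q * (C₁ * (t₀ ^ θ / θ) + B * dirichlet v * (K ^ q / q))) := by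
    rw [ofReal_integral_eq_lintegral_ofReal (hv.integrable_rpow hq0)
      (Eventually.of_forall fun x => Real.rpow_nonneg (hv.nonneg x) q), hlayer,
      ENNReal.ofReal_mul hq0.le]
    gcongr
  rw [ENNReal.ofReal_le_ofReal_iff (by positivity)] at hfinal
  refine hfinal.trans_eq ?_
  rw [hC₁]
  field_simp

/-! ### Truncation, the critical mass, and coercivity below it -/

theorem IsLipBump.truncate {v : Space d → ℝ} (hv : IsLipBump v) {K : ℝ} (hK : 0 ≤ K) :
    IsLipBump (fun x => min (v x) K) ∧ dirichlet (fun x => min (v x) K) ≤ dirichlet v := by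
  have hcon : ∀ x y, |min (v y) K - min (v x) K| ≤ |v y - v x| := fun x y => by
    refine (abs_min_sub_min_le_max _ _ _ _).trans ?_
    simp
  have hb : IsLipBump fun x => min (v x) K := by
    obtain ⟨L, hL⟩ := hv.lip
    refine ⟨⟨L, LipschitzWith.of_dist_le_mul fun x y => ?_⟩, ?_, fun x => le_min (hv.nonneg x) hK⟩
    · rw [Real.dist_eq]
      exact (hcon y x).trans (by rw [← Real.dist_eq]; exact hL.dist_le_mul x y)
    · exact hv.supp.comp_left (g := fun r => min r K) (min_eq_left hK)
  exact ⟨hb, hv.dirichlet_mono hb hcon⟩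

namespace Admissible
variable {a b q₁ q₀ : ℝ}

theorem functional_bump {v : Space d → ℝ} (h : Admissible d a b q₁ q₀) (hv : IsLipBump v) :
    functional a b q₁ q₀ (fun x => (v x : ℂ))
      = dirichlet v + ∫ x, (-a * v x ^ q₁ + b * v x ^ q₀) := by
  have i1 := hv.integrable_rpow (q := q₁) (by linarith [h.two_lt])
  have i0 := hv.integrable_rpow (q := q₀) (by linarith [h.two_lt'])
  rw [integral_add (i1.const_mul _) (i0.const_mul _), integral_const_mul, integral_const_mul]
  unfold functional
  rw [hv.gradNormSq_eq, hv.powInt_eq, hv.powInt_eq]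
  ring

theorem functional_truncate_le (h : Admissible d a b q₁ q₀) {K : ℝ} (hK : 0 < K)
    (hcut : ∀ s, 0 ≤ s → -a * (min s K) ^ q₁ + b * (min s K) ^ q₀ ≤ -a * s ^ q₁ + b * s ^ q₀)
    {v : Space d → ℝ} (hv : IsLipBump v) :
    functional a b q₁ q₀ (fun x => ((min (v x) K : ℝ) : ℂ))
      ≤ functional a b q₁ q₀ (fun x => (v x : ℂ)) := by
  obtain ⟨hw, hdir⟩ := hv.truncate hK.le
  rw [h.functional_bump hv, h.functional_bump hw]
  refine add_le_add hdir (integral_mono ?_ ?_ fun x => hcut _ (hv.nonneg x))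
  · exact ((hw.integrable_rpow (by linarith [h.two_lt])).const_mul _).add
      ((hw.integrable_rpow (by linarith [h.two_lt'])).const_mul _)
  · exact ((hv.integrable_rpow (by linarith [h.two_lt])).const_mul _).add
      ((hv.integrable_rpow (by linarith [h.two_lt'])).const_mul _)

/-- The positive top power is simply discarded. -/
theorem functional_bump_lower (h : Admissible d a b q₁ q₀) {v : Space d → ℝ} (hv : IsLipBump v)
    {c : ℝ} (hc : ∫ x, v x ^ q₁ ≤ c * dirichlet v) :
    (1 - a * c) * dirichlet v ≤ functional a b q₁ q₀ (fun x => (v x : ℂ)) := by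
  unfold functional
  rw [hv.gradNormSq_eq, hv.powInt_eq]
  have h1 := mul_le_mul_of_nonneg_left hc h.ha.le
  have h0 := mul_nonneg h.hb.le (powInt_nonneg q₀ fun x => (v x : ℂ))
  linarith

end Admissible

theorem integral_min_sq_le {v : Space d → ℝ} (hv : IsLipBump v) {K : ℝ} (hK : 0 ≤ K) :
    ∫ x, (min (v x) K) ^ 2 ≤ ∫ x, v x ^ 2 :=
  integral_mono (hv.truncate hK).1.integrable_sq hv.integrable_sq fun x =>
    pow_le_pow_left₀ (le_min (hv.nonneg x) hK) (min_le_left _ _) 2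

namespace Admissible
variable {a b p₁ p₀ : ℝ} (h : Admissible d a b (p₁ + 2) (p₀ + 2))
include h

/-- Truncation at the cutoff level does not raise the functional, and for bumps bounded by that
level the focusing term is at most a·c·m^{2/d} times the Dirichlet integral. For small mass it is
absorbed. -/
theorem exists_groundInf_eq_zero : ∃ m, 0 < m ∧ groundInf d a b p₁ p₀ m = 0 := by
  have hd0 := dim_pos h.dim
  obtain ⟨K, hK, hcut⟩ := h.exists_cutoff
  set c := (p₁ + 2) * weakConst d * K ^ (p₁ + 2 - 2 - 4 / (d : ℝ)) / (p₁ + 2 - 2 - 4 / (d : ℝ))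
    with hc
  have hθ : 0 < p₁ + 2 - 2 - 4 / (d : ℝ) := by linarith [h.supercritical]
  have hq : 0 < p₁ + 2 := by linarith [h.two_lt]
  have hW := weakConst_pos d
  have hc0 : 0 < c := by positivity
  have ha := h.ha
  -- The solution of a·c·m^{2/d} = 1, where the absorption is exact.
  set m := (1 / (a * c)) ^ ((d : ℝ) / 2) with hm
  have hm0 : 0 < m := by positivity
  have hmd : m ^ (2 / (d : ℝ)) = 1 / (a * c) := by
    rw [hm, ← Real.rpow_mul (by positivity), show (d : ℝ) / 2 * (2 / d) = 1 by field_simp,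
      Real.rpow_one]
  refine ⟨m, hm0, le_antisymm (h.groundInf_nonpos hm0.le) ?_⟩
  by_contra hneg
  obtain ⟨f, hf, hfm, hfE⟩ := h.exists_bump_lt hm0 (not_le.1 hneg)
  have h1 := h.functional_truncate_le hK hcut hf
  obtain ⟨hw, -⟩ := hf.truncate hK.le
  -- The threshold t₀ is `K` itself, so no level lies strictly between them and the bound there may
  -- be taken with constant 0.
  have h2 := hw.integral_rpow_le h.dim hm0 ((integral_min_sq_le hf hK.le).trans hfm.le)
    (fun x => min_le_right _ _) hK le_rfl h.supercritical le_rfl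
    (fun t h1 h2 => absurd h2 (not_lt.2 h1.le))
  have h3 := h.functional_bump_lower hw h2
  rw [hmd] at h3
  have h4 : 1 - a * ((p₁ + 2) * weakConst d * (1 / (a * c)) * K ^ (p₁ + 2 - 2 - 4 / (d : ℝ))
      / (p₁ + 2 - 2 - 4 / (d : ℝ)) + 0 * K ^ (p₁ + 2)) = 0 := by
    have : (p₁ + 2) * weakConst d * (1 / (a * c)) * K ^ (p₁ + 2 - 2 - 4 / (d : ℝ))
      / (p₁ + 2 - 2 - 4 / (d : ℝ)) = c * (1 / (a * c)) := by rw [hc]; ring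
    rw [this]
    field_simp
    ring
  rw [h4, zero_mul] at h3
  linarith

theorem exists_criticalMass : ∃ mc, 0 < mc ∧ (∀ m ∈ Icc 0 mc, groundInf d a b p₁ p₀ m = 0) ∧
    (∀ m ∈ Ioi mc, groundInf d a b p₁ p₀ m < 0) ∧ StrictAntiOn (groundInf d a b p₁ p₀) (Ioi mc) := by
  obtain ⟨m₁, hm₁, h1⟩ := h.exists_groundInf_eq_zero
  obtain ⟨m₂, hm₂, h2⟩ := h.exists_groundInf_neg
  exact exists_critical h.concaveOn_groundInf (fun _ hm => h.groundInf_nonpos hm) h.groundInf_zero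
    hm₁ h1 hm₂ h2

/-- Dilating to mass mc, where the infimum is 0, shows that the functional stays nonnegative with
only the fraction (m/mc)^{2/d} of the gradient term; the remaining fraction is the gain δ. -/
theorem subcritical_coercive {mc : ℝ} (hmc : groundInf d a b p₁ p₀ mc = 0) {m : ℝ} (hm : 0 < m)
    (hlt : m < mc) : ∃ δ : ℝ, 0 < δ ∧ ∀ u ∈ massShell d p₀ m,
      δ * gradNormSq u ≤ functional a b (p₁ + 2) (p₀ + 2) u := by
  have hd0 := dim_pos h.dim
  have hmc0 : 0 < mc := hm.trans hlt
  refine ⟨1 - (m / mc) ^ (2 / (d : ℝ)), ?_, fun u hu => ?_⟩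
  · have := Real.rpow_lt_one (show 0 ≤ m / mc by positivity) ((div_lt_one hmc0).2 hlt)
      (show 0 < 2 / (d : ℝ) by positivity)
    linarith
  · have := h.dilation_inequality hm hmc0 hu
    rw [hmc, zero_mul] at this
    unfold functional
    linarith

end Admissible

/-! ### Symmetrization by polarization -/

theorem exists_subseq_pointwise {ι : Type*} [Countable ι] (v : ℕ → ι → ℝ) {B : ℝ}
    (hv : ∀ n i, v n i ∈ Icc 0 B) :
    ∃ φ : ℕ → ℕ, StrictMono φ ∧ ∃ l : ι → ℝ, ∀ i, Tendsto (fun n => v (φ n) i) atTop (𝓝 (l i)) := by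
  have hc : IsCompact (Set.pi univ fun _ : ι => Icc (0 : ℝ) B) :=
    isCompact_univ_pi fun _ => isCompact_Icc
  obtain ⟨l, -, φ, hφ, hl⟩ := hc.tendsto_subseq (x := v) fun n => fun i _ => hv n i
  exact ⟨φ, hφ, l, fun i => (tendsto_pi_nhds.1 hl) i⟩

/-- A pointwise form of the Arzelà–Ascoli theorem. -/
theorem exists_subseq_lipschitz {v : ℕ → Space d → ℝ} {K : ℝ≥0} {B : ℝ}
    (hK : ∀ n, LipschitzWith K (v n)) (hv : ∀ n x, v n x ∈ Icc 0 B) :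
    ∃ φ : ℕ → ℕ, StrictMono φ ∧ ∃ u : Space d → ℝ, LipschitzWith K u ∧
      ∀ x, Tendsto (fun n => v (φ n) x) atTop (𝓝 (u x)) := by
  obtain ⟨φ, hφ, l, hl⟩ := exists_subseq_pointwise (fun n (i : ℕ) =>
    v n (TopologicalSpace.denseSeq (Space d) i)) (fun n i => hv n _)
  have hcau : ∀ x, ∃ y, Tendsto (fun n => v (φ n) x) atTop (𝓝 y) := by
    intro x
    refine cauchySeq_tendsto_of_complete (Metric.cauchySeq_iff'.2 fun ε hε => ?_)
    have hδ : 0 < ε / (4 * (K + 1)) := by positivity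
    obtain ⟨i, hi⟩ := (TopologicalSpace.denseRange_denseSeq (Space d)).exists_dist_lt x hδ
    obtain ⟨N, hN⟩ := Metric.cauchySeq_iff'.1 (hl i).cauchySeq (ε / 2) (by positivity)
    refine ⟨N, fun n hn => ?_⟩
    have hKd : ∀ n, dist (v (φ n) x) (v (φ n) (TopologicalSpace.denseSeq (Space d) i)) ≤ ε / 4 := by
      intro n
      refine ((hK _).dist_le_mul _ _).trans ?_
      have : (K : ℝ) * dist x (TopologicalSpace.denseSeq (Space d) i)
          ≤ (K + 1) * (ε / (4 * (K + 1))) := by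
        gcongr
        · linarith
      refine this.trans_eq ?_
      field_simp
    have h1 := hKd n
    have h2 := hKd N
    have h3 := hN n hn
    have h4 := dist_triangle4 (v (φ n) x) (v (φ n) (TopologicalSpace.denseSeq (Space d) i))
      (v (φ N) (TopologicalSpace.denseSeq (Space d) i)) (v (φ N) x)
    rw [dist_comm (v (φ N) (TopologicalSpace.denseSeq (Space d) i)) (v (φ N) x)] at h4
    linarith
  choose u hu using hcau
  refine ⟨φ, hφ, u, LipschitzWith.of_dist_le_mul fun x y => ?_, hu⟩
  exact le_of_tendsto' ((hu x).dist (hu y)) fun n => (hK _).dist_le_mul x y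

/-- The competitors in the symmetrization of a bump. -/
structure IsRearrangement (f : Space d → ℝ) (K : ℝ≥0) (R B : ℝ) (v : Space d → ℝ) : Prop where
  lip : LipschitzWith K v
  supp : ∀ x, R < ‖x‖ → v x = 0
  mem : ∀ x, v x ∈ Icc 0 B
  powers : ∀ q : ℝ, 0 < q → ∫ x, v x ^ q = ∫ x, f x ^ q
  dirichlet_le : dirichlet v ≤ dirichlet f

namespace IsRearrangement
variable {f v : Space d → ℝ} {K : ℝ≥0} {R B : ℝ}

theorem isLipBump (hv : IsRearrangement f K R B v) : IsLipBump v :=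
  ⟨⟨K, hv.lip⟩, HasCompactSupport.intro (isCompact_closedBall (0 : Space d) R)
    (fun x hx => hv.supp x (by simpa using hx)), fun x => (hv.mem x).1⟩

theorem integrable_moment (hv : IsRearrangement f K R B v) :
    Integrable fun x => v x * ‖x‖ ^ 2 := by
  have hc := hv.lip.continuous
  exact Continuous.integrable_of_hasCompactSupport (by fun_prop) hv.isLipBump.supp.mul_right

/-- The condition 0 ≤ c moves large values towards the origin: outside the ball of radius `R`, a
point on the near side reflects further out, so the support stays in the ball. -/
theorem polarize (hv : IsRearrangement f K R B v) {e : Space d} (he : ‖e‖ = 1) {c : ℝ}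
    (hc : 0 ≤ c) : IsRearrangement f K R B (glue max min e c v) := by
  have hb := hv.isLipBump
  refine ⟨lipschitzWith_glue glueData_max_min he c hv.lip, fun x hx => ?_, fun x => ?_,
    fun q hq => ?_, (dirichlet_polarization_le he c hb).trans hv.dirichlet_le⟩
  · unfold glue
    split_ifs with hlt
    · have h1 : R < ‖hrefl e c x‖ := by
        refine hx.trans_le ?_
        rw [← sq_le_sq₀ (norm_nonneg _) (norm_nonneg _), norm_sq_hrefl he]
        nlinarith
      rw [hv.supp x hx, hv.supp _ h1, max_self]
    · rw [hv.supp x hx]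
      exact min_eq_right (hv.mem _).1
  · unfold glue
    split_ifs
    · exact ⟨le_max_of_le_left (hv.mem _).1, max_le (hv.mem _).2 (hv.mem _).2⟩
    · exact ⟨le_min (hv.mem _).1 (hv.mem _).1, min_le_of_left_le (hv.mem _).2⟩
  · rw [← hv.powers q hq, integral_glue glueData_max_min he c hb (fun _ s => s ^ q)
      ((Real.continuous_rpow_const hq.le).comp continuous_snd) (fun _ => Real.zero_rpow hq.ne'),
      integral_eq_halfspace he c (hb.integrable_rpow hq)]
    congr 1; ext x
    rcases le_total (v x) (v (hrefl e c x)) with hle | hle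
    · rw [max_eq_right hle, min_eq_left hle, add_comm]
    · rw [max_eq_left hle, min_eq_right hle]

/-- Polarizing lowers the second moment by the integral of (max − v)·(‖σx‖² − ‖x‖²) over the near
side, whose second factor is positive. Minimality makes the integrand vanish almost everywhere, and
continuity makes it vanish everywhere there. -/
theorem le_of_minimal (hv : IsRearrangement f K R B v)
    (hmin : ∀ w, IsRearrangement f K R B w → ∫ x, v x * ‖x‖ ^ 2 ≤ ∫ x, w x * ‖x‖ ^ 2)
    {e : Space d} (he : ‖e‖ = 1) {c : ℝ} (hc : 0 < c) {x : Space d} (hx : ⟪e, x⟫_ℝ < c) :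
    v (hrefl e c x) ≤ v x := by
  have hb := hv.isLipBump
  have hvc := hv.lip.continuous
  have hrc := continuous_hrefl (e := e) c
  have ho : IsOpen {x : Space d | ⟪e, x⟫_ℝ < c} := isOpen_lt (by fun_prop) continuous_const
  have h1 := hmin _ (hv.polarize he hc.le)
  rw [integral_glue glueData_max_min he c hb (fun x s => s * ‖x‖ ^ 2) (by fun_prop)
    (fun x => by simp), integral_eq_halfspace he c hv.integrable_moment] at h1
  set P : Space d → ℝ := fun x => max (v x) (v (hrefl e c x)) * ‖x‖ ^ 2
    + min (v x) (v (hrefl e c x)) * ‖hrefl e c x‖ ^ 2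
  set Q : Space d → ℝ := fun x => v x * ‖x‖ ^ 2 + v (hrefl e c x) * ‖hrefl e c x‖ ^ 2
  have hcs : HasCompactSupport fun x => v (hrefl e c x) := by
    let E : Space d ≃ₜ Space d :=
      ⟨⟨hrefl e c, hrefl e c, hrefl_hrefl he c, hrefl_hrefl he c⟩, hrc, hrc⟩
    exact hb.supp.comp_homeomorph E
  have hiQ : Integrable Q :=
    Continuous.integrable_of_hasCompactSupport (by fun_prop) (hb.supp.mul_right.add hcs.mul_right)
  have hPQ : ∀ x, Q x - P x = (max (v x) (v (hrefl e c x)) - v x)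
      * (‖hrefl e c x‖ ^ 2 - ‖x‖ ^ 2) := by
    intro x
    simp only [P, Q]
    rcases le_total (v x) (v (hrefl e c x)) with hle | hle
    · rw [max_eq_right hle, min_eq_left hle]; ring
    · rw [max_eq_left hle, min_eq_right hle]; ring
  have hiP : Integrable P := by
    have hsum : ∀ x, v x = 0 → v (hrefl e c x) = 0 → P x = 0 := fun x h1 h2 => by
      simp [P, h1, h2]
    refine Continuous.integrable_of_hasCompactSupport (by fun_prop)
      ((hb.supp.add (hcs)).mono fun x hx => ?_)
    contrapose! hx
    have h0 : v x + v (hrefl e c x) = 0 := by simpa using hx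
    have := hb.nonneg x
    have := hb.nonneg (hrefl e c x)
    simp [hsum x (by linarith) (by linarith)]
  have hnn : ∀ x ∈ {x : Space d | ⟪e, x⟫_ℝ < c}, 0 ≤ Q x - P x := by
    intro x hx
    have hx' : ⟪e, x⟫_ℝ < c := hx
    rw [hPQ, norm_sq_hrefl he]
    refine mul_nonneg (sub_nonneg.2 (le_max_left _ _)) ?_
    have : 0 ≤ 4 * c * (c - ⟪e, x⟫_ℝ) := mul_nonneg (by linarith) (by linarith)
    linarith
  have hint : ∫ x in {x : Space d | ⟪e, x⟫_ℝ < c}, (Q x - P x) = 0 := by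
    refine le_antisymm ?_ (setIntegral_nonneg ho.measurableSet hnn)
    rw [integral_sub hiQ.integrableOn hiP.integrableOn]
    linarith
  have hae := (setIntegral_eq_zero_iff_of_nonneg_ae
    ((ae_restrict_iff' ho.measurableSet).2 (Eventually.of_forall hnn))
    (hiQ.sub hiP).integrableOn).1 hint
  have heq := Measure.eqOn_open_of_ae_eq hae ho (by fun_prop) (by fun_prop) hx
  have heq' : Q x - P x = 0 := heq
  rw [hPQ, norm_sq_hrefl he] at heq'
  have hpos : 0 < 4 * c * (c - ⟪e, x⟫_ℝ) := mul_pos (by linarith) (by linarith)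
  rcases mul_eq_zero.1 heq' with h3 | h3
  · exact max_eq_left_iff.1 (sub_eq_zero.1 h3)
  · linarith

/-- If ‖x‖ < ‖y‖, the perpendicular bisector of x and y has the origin strictly on the side of x and
exchanges the two points. Equal norms follow by continuity, shrinking x slightly. -/
theorem antitone_norm_of_minimal (hv : IsRearrangement f K R B v)
    (hmin : ∀ w, IsRearrangement f K R B w → ∫ x, v x * ‖x‖ ^ 2 ≤ ∫ x, w x * ‖x‖ ^ 2)
    (x y : Space d) (hxy : ‖x‖ ≤ ‖y‖) : v y ≤ v x := by
  have hlt : ∀ x y : Space d, ‖x‖ < ‖y‖ → v y ≤ v x := by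
    intro x y hxy
    have hne : 0 < ‖y - x‖ := norm_pos_iff.2 (sub_ne_zero.2 fun h => by simp [h] at hxy)
    set e : Space d := ‖y - x‖⁻¹ • (y - x) with he_def
    have he : ‖e‖ = 1 := by
      rw [he_def, norm_smul, norm_inv, norm_norm, inv_mul_cancel₀ hne.ne']
    set c : ℝ := (‖y‖ ^ 2 - ‖x‖ ^ 2) / (2 * ‖y - x‖) with hc_def
    have hsq : ‖x‖ ^ 2 < ‖y‖ ^ 2 := pow_lt_pow_left₀ hxy (norm_nonneg _) (by norm_num)
    have hc : 0 < c := div_pos (by linarith) (by linarith)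
    have hn : ‖y - x‖ ^ 2 = ‖y‖ ^ 2 - 2 * ⟪y, x⟫_ℝ + ‖x‖ ^ 2 := norm_sub_sq_real y x
    have hex : ⟪e, x⟫_ℝ = ‖y - x‖⁻¹ * (⟪y, x⟫_ℝ - ‖x‖ ^ 2) := by
      rw [he_def, real_inner_smul_left, inner_sub_left, real_inner_self_eq_norm_sq]
    have hcx : c - ⟪e, x⟫_ℝ = ‖y - x‖ / 2 := by
      rw [hex, hc_def]
      field_simp
      linarith
    have hlt' : ⟪e, x⟫_ℝ < c := by linarith
    have hr : hrefl e c x = y := by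
      unfold hrefl
      rw [show 2 * (⟪e, x⟫_ℝ - c) = -‖y - x‖ by linarith, he_def, smul_smul, neg_mul,
        mul_inv_cancel₀ hne.ne']
      simp
    have := hv.le_of_minimal hmin he hc hlt'
    rwa [hr] at this
  rcases hxy.lt_or_eq with h | h
  · exact hlt x y h
  · by_cases hx : x = 0
    · have hy : y = 0 := by rw [hx, norm_zero] at h; exact norm_eq_zero.1 h.symm
      rw [hx, hy]
    · have hlim : Tendsto (fun t : ℝ => v (t • x)) (𝓝[<] 1) (𝓝 (v ((1 : ℝ) • x))) := by
        have hc : Continuous fun t : ℝ => v (t • x) := by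
          have := hv.lip.continuous
          fun_prop
        exact (hc.tendsto 1).mono_left nhdsWithin_le_nhds
      rw [one_smul] at hlim
      refine ge_of_tendsto hlim ?_
      filter_upwards [Ioo_mem_nhdsLT (zero_lt_one' ℝ)] with t ht
      refine hlt _ _ ?_
      rw [norm_smul, Real.norm_of_nonneg ht.1.le, ← h]
      exact mul_lt_of_lt_one_left (norm_pos_iff.2 hx) ht.2

end IsRearrangement

/-- Symmetrization: every bump can be replaced by a radially nonincreasing one with the same
integrals of powers and no larger Dirichlet integral. -/
theorem IsLipBump.exists_symmetrization {f : Space d → ℝ} (hf : IsLipBump f) {B : ℝ}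
    (hB : ∀ x, f x ≤ B) : ∃ v : Space d → ℝ, IsLipBump v ∧ (∀ x, v x ≤ B) ∧
      (∀ q : ℝ, 0 < q → ∫ x, v x ^ q = ∫ x, f x ^ q) ∧ dirichlet v ≤ dirichlet f ∧
      ∀ x y, ‖x‖ ≤ ‖y‖ → v y ≤ v x := by
  obtain ⟨K, hK⟩ := hf.lip
  obtain ⟨R, hR⟩ := hf.supp.isCompact.isBounded.subset_closedBall 0
  have hB0 : 0 ≤ B := (hf.nonneg 0).trans (hB 0)
  have hself : IsRearrangement f K R B f := by
    refine ⟨hK, fun x hx => ?_, fun x => ⟨hf.nonneg x, hB x⟩, fun _ _ => rfl, le_rfl⟩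
    by_contra hne
    have := mem_closedBall_zero_iff.1 (hR (subset_tsupport f hne))
    linarith
  -- The symmetrization is a minimiser of the second moment. One exists because competitors share a
  -- Lipschitz constant, a bound and a support ball, and the class is closed under pointwise limits.
  set S : Set ℝ := {r | ∃ w, IsRearrangement f K R B w ∧ ∫ x, w x * ‖x‖ ^ 2 = r} with hS
  have hSne : S.Nonempty := ⟨_, f, hself, rfl⟩
  have hSbd : BddBelow S := by
    refine ⟨0, ?_⟩
    rintro _ ⟨w, hw, rfl⟩
    exact integral_nonneg fun x => mul_nonneg (hw.mem x).1 (by positivity)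
  obtain ⟨r, -, hr, hrS⟩ := exists_seq_tendsto_sInf hSne hSbd
  choose w hw hwr using hrS
  obtain ⟨φ, hφ, v, hvK, hv⟩ := exists_subseq_lipschitz (fun n => (hw n).lip) (fun n => (hw n).mem)
  have hvsupp : ∀ x, R < ‖x‖ → v x = 0 := fun x hx =>
    tendsto_nhds_unique (hv x) (by simp_rw [(hw _).supp x hx]; exact tendsto_const_nhds)
  have hvmem : ∀ x, v x ∈ Icc 0 B := fun x =>
    isClosed_Icc.mem_of_tendsto (hv x) (Eventually.of_forall fun n => (hw _).mem x)
  have hvb : IsLipBump v := ⟨⟨K, hvK⟩, HasCompactSupport.intro (isCompact_closedBall (0 : Space d) R)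
    (fun x hx => hvsupp x (by simpa using hx)), fun x => (hvmem x).1⟩
  have hdom : ∀ c : ℝ, Integrable ((Metric.closedBall (0 : Space d) R).indicator fun _ => c) := by
    intro c
    rw [integrable_indicator_iff measurableSet_closedBall]
    exact integrableOn_const (by exact measure_closedBall_lt_top.ne)
  have hpow : ∀ q : ℝ, 0 < q → ∫ x, v x ^ q = ∫ x, f x ^ q := by
    intro q hq
    have hlim : Tendsto (fun n => ∫ x, w (φ n) x ^ q) atTop (𝓝 (∫ x, v x ^ q)) := by
      refine tendsto_integral_of_dominated_convergence _ (fun n => ?_) (hdom (B ^ q)) (fun n => ?_) ?_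
      · exact ((hw _).isLipBump.integrable_rpow hq).aestronglyMeasurable
      · refine Eventually.of_forall fun x => ?_
        rw [Real.norm_of_nonneg (Real.rpow_nonneg ((hw _).mem x).1 q)]
        by_cases hx : x ∈ Metric.closedBall (0 : Space d) R
        · rw [indicator_of_mem hx]
          exact Real.rpow_le_rpow ((hw _).mem x).1 ((hw _).mem x).2 hq.le
        · rw [indicator_of_notMem hx, (hw _).supp x (by simpa using hx), Real.zero_rpow hq.ne']
      · exact Eventually.of_forall fun x => (hv x).rpow_const (Or.inr hq.le)
    simp_rw [(hw _).powers q hq] at hlim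
    exact tendsto_nhds_unique hlim tendsto_const_nhds
  have hdir : dirichlet v ≤ dirichlet f := by
    obtain ⟨G, -, hG, hle⟩ := exists_weakGradient_of_tendsto (C := fun _ => dirichlet f)
      (fun n => (hw (φ n)).isLipBump) (fun n => (hw (φ n)).dirichlet_le) tendsto_const_nhds
      (fun n x => ((hw (φ n)).mem x).2) (Eventually.of_forall hv)
    rw [← hvb.gradNormSq_eq, DoublePowerNLS.gradNormSq_eq hG]
    exact hle
  have hvr : IsRearrangement f K R B v := ⟨hvK, hvsupp, hvmem, hpow, hdir⟩
  have hmom : ∫ x, v x * ‖x‖ ^ 2 = sInf S := by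
    have hlim : Tendsto (fun n => ∫ x, w (φ n) x * ‖x‖ ^ 2) atTop (𝓝 (∫ x, v x * ‖x‖ ^ 2)) := by
      refine tendsto_integral_of_dominated_convergence _ (fun n => ?_) (hdom (B * R ^ 2))
        (fun n => ?_) ?_
      · exact (hw _).integrable_moment.aestronglyMeasurable
      · refine Eventually.of_forall fun x => ?_
        rw [Real.norm_of_nonneg (mul_nonneg ((hw _).mem x).1 (by positivity))]
        by_cases hx : x ∈ Metric.closedBall (0 : Space d) R
        · rw [indicator_of_mem hx]
          have := mem_closedBall_zero_iff.1 hx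
          exact mul_le_mul ((hw _).mem x).2 (pow_le_pow_left₀ (norm_nonneg _) this 2)
            (by positivity) hB0
        · rw [indicator_of_notMem hx, (hw _).supp x (by simpa using hx), zero_mul]
      · exact Eventually.of_forall fun x => (hv x).mul_const _
    simp_rw [hwr] at hlim
    exact tendsto_nhds_unique hlim (hr.comp hφ.tendsto_atTop)
  refine ⟨v, hvb, fun x => (hvmem x).2, hpow, hdir, hvr.antitone_norm_of_minimal fun w' hw' => ?_⟩
  rw [hmom]
  exact csInf_le hSbd ⟨w', hw', rfl⟩

/-! ### Compactness of radially nonincreasing bumps -/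

/-- Helly's selection theorem for uniformly bounded nonincreasing functions. -/
theorem exists_subseq_antitone {f : ℕ → ℝ → ℝ} {B : ℝ} (hf : ∀ n, Antitone (f n))
    (hB : ∀ n r, f n r ∈ Icc 0 B) :
    ∃ φ : ℕ → ℕ, StrictMono φ ∧ ∃ g : ℝ → ℝ, Antitone g ∧ (∀ r, g r ∈ Icc 0 B) ∧
      ∃ S : Set ℝ, S.Countable ∧ ∀ r, r ∉ S → Tendsto (fun n => f (φ n) r) atTop (𝓝 (g r)) := by
  obtain ⟨φ, hφ, l, hl⟩ := exists_subseq_pointwise (fun n (q : ℚ) => f n q) (fun n q => hB n q)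
  have hlB : ∀ q, l q ∈ Icc 0 B := fun q =>
    isClosed_Icc.mem_of_tendsto (hl q) (Eventually.of_forall fun n => hB _ _)
  have hlanti : Antitone l := fun p q hpq =>
    le_of_tendsto_of_tendsto' (hl q) (hl p) fun n => hf _ (by exact_mod_cast hpq)
  -- The limit at r is the supremum of the rational limits strictly to the right of r; convergence
  -- holds wherever this monotone function is continuous.
  set T : ℝ → Set ℝ := fun r => {y | ∃ q : ℚ, r < (q : ℝ) ∧ l q = y} with hT
  have hTne : ∀ r, (T r).Nonempty := fun r => by
    obtain ⟨q, hq⟩ := exists_rat_gt r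
    exact ⟨_, q, hq, rfl⟩
  have hTbd : ∀ r, BddAbove (T r) := fun r => ⟨B, by rintro _ ⟨q, -, rfl⟩; exact (hlB q).2⟩
  set g : ℝ → ℝ := fun r => sSup (T r) with hg
  have hganti : Antitone g := fun r s hrs =>
    csSup_le_csSup (hTbd r) (hTne s) (by rintro _ ⟨q, hq, rfl⟩; exact ⟨q, hrs.trans_lt hq, rfl⟩)
  have hgle : ∀ (r : ℝ) (q : ℚ), r < (q : ℝ) → l q ≤ g r := fun r q hq => le_csSup (hTbd r) ⟨q, hq, rfl⟩
  refine ⟨φ, hφ, g, hganti, fun r => ?_, {r | ¬ ContinuousAt g r},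
    hganti.countable_not_continuousAt, fun r hr => ?_⟩
  · obtain ⟨q, hq⟩ := exists_rat_gt r
    refine ⟨(hlB q).1.trans (hgle r q hq), csSup_le (hTne r) ?_⟩
    rintro _ ⟨q, -, rfl⟩
    exact (hlB q).2
  · have hcont : ContinuousAt g r := not_not.1 hr
    refine tendsto_order.2 ⟨fun a ha => ?_, fun a ha => ?_⟩
    · obtain ⟨_, ⟨q, hq, rfl⟩, hlt⟩ := exists_lt_of_lt_csSup (hTne r) ha
      filter_upwards [(hl q).eventually (lt_mem_nhds hlt)] with n hn
      exact hn.trans_le (hf _ hq.le)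
    · have h1 : ∀ᶠ s in 𝓝[<] r, g s < a :=
        (hcont.tendsto.mono_left nhdsWithin_le_nhds).eventually (gt_mem_nhds ha)
      obtain ⟨s, hs, hsr⟩ := (h1.and self_mem_nhdsWithin).exists
      obtain ⟨p, hsp, hpr⟩ := exists_rat_btwn (show s < r from hsr)
      have h2 : l p < a := (hgle s p hsp).trans_lt hs
      filter_upwards [(hl p).eventually (gt_mem_nhds h2)] with n hn
      exact (hf _ hpr.le).trans_lt hn

theorem ae_norm_notMem_countable (hd : 1 ≤ d) {S : Set ℝ} (hS : S.Countable) :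
    ∀ᵐ x : Space d, ‖x‖ ∉ S := by
  have : Nontrivial (Space d) := by
    obtain ⟨e, he⟩ := exists_unit_vector hd
    exact ⟨e, 0, fun h => by simp [h] at he⟩
  rw [ae_iff]
  have : {x : Space d | ¬ ‖x‖ ∉ S} = ⋃ r ∈ S, Metric.sphere 0 r := by
    ext x; simp
  rw [this, measure_biUnion_null_iff hS]
  exact fun r _ => Measure.addHaar_sphere _ _ _

/-- Radially nonincreasing functions. -/
def RadiallyAntitone (v : Space d → ℝ) : Prop := ∀ x y, ‖x‖ ≤ ‖y‖ → v y ≤ v x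

theorem exists_subseq_radial (hd : 1 ≤ d) {v : ℕ → Space d → ℝ} {B : ℝ}
    (hv : ∀ n, RadiallyAntitone (v n)) (hB : ∀ n x, v n x ∈ Icc 0 B) :
    ∃ φ : ℕ → ℕ, StrictMono φ ∧ ∃ g : ℝ → ℝ, Antitone g ∧ (∀ r, g r ∈ Icc 0 B) ∧
      ∀ᵐ x, Tendsto (fun n => v (φ n) x) atTop (𝓝 (g ‖x‖)) := by
  obtain ⟨e, he⟩ := exists_unit_vector hd
  have hn : ∀ r : ℝ, ‖max r 0 • e‖ = max r 0 := fun r => by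
    rw [norm_smul, he, mul_one, Real.norm_of_nonneg (le_max_right _ _)]
  obtain ⟨φ, hφ, g, hg, hgB, S, hS, hlim⟩ := exists_subseq_antitone
    (f := fun n r => v n (max r 0 • e)) (B := B)
    (fun n r s hrs => hv n _ _ (by rw [hn, hn]; exact max_le_max_right 0 hrs)) (fun n r => hB n _)
  refine ⟨φ, hφ, g, hg, hgB, ?_⟩
  filter_upwards [ae_norm_notMem_countable hd hS] with x hx
  refine (hlim _ hx).congr fun n => ?_
  have : ‖max ‖x‖ 0 • e‖ = ‖x‖ := by rw [hn, max_eq_left (norm_nonneg _)]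
  exact le_antisymm (hv _ _ _ this.ge) (hv _ _ _ this.le)

/-- Decay of radially nonincreasing functions of bounded mass. -/
theorem RadiallyAntitone.rpow_le {v : Space d → ℝ} (hr : RadiallyAntitone v) (hv : IsLipBump v)
    {A B q : ℝ} (hq : 0 ≤ q) (hB : ∀ x, v x ≤ B) (hA : ∫ x, v x ^ 2 ≤ A) (x : Space d) :
    v x ^ q ≤ (2 ^ d * max (B ^ 2) (A / ballVol d)) ^ (q / 2) * (1 + ‖x‖) ^ (-((d : ℝ) * q / 2)) := by
  have hω := ballVol_pos d
  set C := 2 ^ d * max (B ^ 2) (A / ballVol d) with hC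
  have hC0 : 0 ≤ C := by positivity
  have hx1 : 0 < 1 + ‖x‖ := by positivity
  have key : v x ^ 2 * (1 + ‖x‖) ^ d ≤ C := by
    rcases le_total ‖x‖ 1 with h | h
    · have h1 : v x ^ 2 ≤ B ^ 2 := pow_le_pow_left₀ (hv.nonneg x) (hB x) 2
      have h2 : (1 + ‖x‖) ^ d ≤ 2 ^ d := pow_le_pow_left₀ hx1.le (by linarith) d
      calc v x ^ 2 * (1 + ‖x‖) ^ d ≤ B ^ 2 * 2 ^ d := by gcongr
        _ ≤ C := by rw [hC, mul_comm]; gcongr; exact le_max_left _ _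
    · have hx0 : 0 < ‖x‖ := by linarith
      -- On the ball of radius ‖x‖ the function is at least v x, so that ball alone carries mass at
      -- least v x² times its volume.
      have h1 : v x ^ 2 * (‖x‖ ^ d * ballVol d) ≤ A := by
        refine le_trans ?_ hA
        have h3 : ∫ y in Metric.ball (0 : Space d) ‖x‖, v x ^ 2 ≤ ∫ y, v y ^ 2 := by
          refine (setIntegral_mono_on (integrableOn_const (by exact measure_ball_lt_top.ne))
            hv.integrable_sq.integrableOn measurableSet_ball fun y hy => ?_).trans
            (setIntegral_le_integral hv.integrable_sq (Eventually.of_forall fun y => sq_nonneg _))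
          exact pow_le_pow_left₀ (hv.nonneg x) (hr y x (mem_ball_zero_iff.1 hy).le) 2
        rw [setIntegral_const, measureReal_def, volume_ball_eq d hx0,
          ENNReal.toReal_ofReal (by positivity), smul_eq_mul, mul_comm] at h3
        exact h3
      have h2 : (1 + ‖x‖) ^ d ≤ 2 ^ d * ‖x‖ ^ d := by
        rw [← mul_pow]; exact pow_le_pow_left₀ hx1.le (by linarith) d
      calc v x ^ 2 * (1 + ‖x‖) ^ d ≤ v x ^ 2 * (2 ^ d * ‖x‖ ^ d) := by gcongr
        _ = 2 ^ d * (v x ^ 2 * (‖x‖ ^ d * ballVol d) / ballVol d) := by field_simp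
        _ ≤ 2 ^ d * (A / ballVol d) := by gcongr
        _ ≤ C := by rw [hC]; gcongr; exact le_max_right _ _
  have h3 : v x ^ q = (v x ^ 2) ^ (q / 2) := by
    rw [← Real.rpow_natCast, ← Real.rpow_mul (hv.nonneg x)]; congr 1; push_cast; ring
  have h4 : (1 + ‖x‖) ^ (-((d : ℝ) * q / 2)) = (((1 + ‖x‖) ^ d)⁻¹) ^ (q / 2) := by
    rw [← Real.rpow_natCast, ← Real.rpow_neg hx1.le, ← Real.rpow_mul hx1.le]; congr 1; ring
  rw [h3, h4, ← Real.mul_rpow hC0 (by positivity)]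
  refine Real.rpow_le_rpow (by positivity) ?_ (by positivity)
  rw [← div_eq_mul_inv, le_div_iff₀ (by positivity)]
  exact key

/-- The decay exponent dq/2 exceeds the dimension precisely when q > 2; the mass is the borderline
case that fails. -/
theorem integrable_decay (hd : 1 ≤ d) {q : ℝ} (hq : 2 < q) (C : ℝ) :
    Integrable fun x : Space d => C * (1 + ‖x‖) ^ (-((d : ℝ) * q / 2)) := by
  have hd0 : (0 : ℝ) < d := by exact_mod_cast hd
  refine (integrable_one_add_norm (by rw [finrank_euclideanSpace_fin]; nlinarith)).const_mul C

/-- Compactness of sequences of radially nonincreasing bumps. -/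
theorem Admissible.exists_radial_limit {a b p₁ p₀ : ℝ} (h : Admissible d a b (p₁ + 2) (p₀ + 2))
    {v : ℕ → Space d → ℝ} (hv : ∀ n, IsLipBump (v n)) (hr : ∀ n, RadiallyAntitone (v n))
    {B : ℝ} (hB : ∀ n x, v n x ≤ B) {A E : ℕ → ℝ} {A₀ E₀ : ℝ} (hA : ∀ n, ∫ x, v n x ^ 2 ≤ A n)
    (hA₀ : Tendsto A atTop (𝓝 A₀))
    (hE : ∀ n, functional a b (p₁ + 2) (p₀ + 2) (fun x => (v n x : ℂ)) ≤ E n)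
    (hE₀ : Tendsto E atTop (𝓝 E₀)) :
    ∃ φ : ℕ → ℕ, StrictMono φ ∧ ∃ g : ℝ → ℝ, Antitone g ∧ (∀ r, g r ∈ Icc 0 B) ∧
      (∀ᵐ x : Space d, Tendsto (fun n => v (φ n) x) atTop (𝓝 (g ‖x‖))) ∧
      (fun x : Space d => (g ‖x‖ : ℂ)) ∈ massShell d p₀ (mass fun x : Space d => (g ‖x‖ : ℂ)) ∧
      mass (fun x : Space d => (g ‖x‖ : ℂ)) ≤ A₀ ∧
      functional a b (p₁ + 2) (p₀ + 2) (fun x : Space d => (g ‖x‖ : ℂ)) ≤ E₀ := by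
  obtain ⟨φ, hφ, g, hg, hgB, hlim⟩ := exists_subseq_radial h.dim hr
    (fun n x => ⟨(hv n).nonneg x, hB n x⟩)
  obtain ⟨A', hA'⟩ := hA₀.bddAbove_range
  have hAA' : ∀ n, ∫ x, v n x ^ 2 ≤ A' := fun n => (hA n).trans (hA' ⟨n, rfl⟩)
  have hgm : Measurable fun x : Space d => g ‖x‖ := hg.measurable.comp measurable_norm
  have hpow : ∀ q : ℝ, 2 < q → (Integrable fun x : Space d => g ‖x‖ ^ q) ∧
      Tendsto (fun n => ∫ x, v (φ n) x ^ q) atTop (𝓝 (∫ x : Space d, g ‖x‖ ^ q)) := by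
    intro q hq
    have hdom := integrable_decay h.dim hq ((2 ^ d * max (B ^ 2) (A' / ballVol d)) ^ (q / 2))
    have hlimq : ∀ᵐ x : Space d, Tendsto (fun n => v (φ n) x ^ q) atTop (𝓝 (g ‖x‖ ^ q)) := by
      filter_upwards [hlim] with x hx using hx.rpow_const (Or.inr (by linarith))
    have hle : ∀ n x, v (φ n) x ^ q ≤ _ := fun n x =>
      (hr (φ n)).rpow_le (hv (φ n)) (by linarith) (hB _) (hAA' _) x
    refine ⟨hdom.mono' (hgm.pow_const q).aestronglyMeasurable ?_, ?_⟩
    · filter_upwards [hlimq] with x hx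
      rw [Real.norm_of_nonneg (Real.rpow_nonneg (hgB _).1 _)]
      exact le_of_tendsto' hx fun n => hle n x
    · refine tendsto_integral_of_dominated_convergence _ (fun n => ?_) hdom (fun n => ?_) hlimq
      · exact ((hv _).integrable_rpow (by linarith)).aestronglyMeasurable
      · refine Eventually.of_forall fun x => ?_
        rw [Real.norm_of_nonneg (Real.rpow_nonneg ((hv _).nonneg x) _)]
        exact hle n x
  obtain ⟨i1, t1⟩ := hpow _ h.two_lt
  obtain ⟨i0, t0⟩ := hpow _ h.two_lt'
  have hnorm : ∀ x : Space d, ‖(g ‖x‖ : ℂ)‖ = g ‖x‖ := fun x => by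
    rw [Complex.norm_real, Real.norm_of_nonneg (hgB _).1]
  have hmeas : AEStronglyMeasurable (fun x : Space d => (g ‖x‖ : ℂ)) volume :=
    (Complex.measurable_ofReal.comp hgm).aestronglyMeasurable
  -- No domination is available for the square, so mass may be lost in the limit and only Fatou's
  -- inequality remains.
  have hfatou : ∫⁻ x : Space d, ENNReal.ofReal (g ‖x‖ ^ 2) ≤ ENNReal.ofReal A₀ := by
    have h1 : ∀ᵐ x : Space d, ENNReal.ofReal (g ‖x‖ ^ 2)
        = liminf (fun n => ENNReal.ofReal (v (φ n) x ^ 2)) atTop := by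
      filter_upwards [hlim] with x hx
      exact ((ENNReal.continuous_ofReal.tendsto _).comp (hx.pow 2)).liminf_eq.symm
    rw [lintegral_congr_ae h1]
    refine (lintegral_liminf_le fun n =>
      ((hv _).continuous.pow 2).measurable.ennreal_ofReal).trans ?_
    have h2 : Tendsto (fun n => ENNReal.ofReal (A (φ n))) atTop (𝓝 (ENNReal.ofReal A₀)) :=
      (ENNReal.continuous_ofReal.tendsto _).comp (hA₀.comp hφ.tendsto_atTop)
    rw [← h2.liminf_eq]
    refine liminf_le_liminf (Eventually.of_forall fun n => ?_)
    change ∫⁻ x, ENNReal.ofReal (v (φ n) x ^ 2) ≤ _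
    rw [← ofReal_integral_eq_lintegral_ofReal (hv _).integrable_sq
      (Eventually.of_forall fun x => sq_nonneg _)]
    exact ENNReal.ofReal_le_ofReal (hA _)
  have hA₀0 : 0 ≤ A₀ := ge_of_tendsto' hA₀ fun n =>
    (integral_nonneg fun x => sq_nonneg _).trans (hA n)
  have i2 : Integrable fun x : Space d => g ‖x‖ ^ 2 := by
    refine ⟨(hgm.pow_const 2).aestronglyMeasurable, ?_⟩
    rw [hasFiniteIntegral_iff_ofReal (Eventually.of_forall fun x => sq_nonneg _)]
    exact hfatou.trans_lt ENNReal.ofReal_lt_top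
  have hmass : mass (fun x : Space d => (g ‖x‖ : ℂ)) ≤ A₀ := by
    unfold mass
    simp_rw [hnorm]
    rw [← ENNReal.ofReal_le_ofReal_iff hA₀0, ofReal_integral_eq_lintegral_ofReal i2
      (Eventually.of_forall fun x => sq_nonneg _)]
    exact hfatou
  set N : ℕ → ℝ := fun n => -a * (∫ x, v (φ n) x ^ (p₁ + 2)) + b * ∫ x, v (φ n) x ^ (p₀ + 2)
  set N₀ : ℝ := -a * (∫ x : Space d, g ‖x‖ ^ (p₁ + 2)) + b * ∫ x : Space d, g ‖x‖ ^ (p₀ + 2)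
  have hN : Tendsto N atTop (𝓝 N₀) := (t1.const_mul _).add (t0.const_mul _)
  -- Since the potential part converges, the energy bound becomes a convergent bound on the
  -- Dirichlet integrals, ready for lower semicontinuity.
  obtain ⟨G, hG2, hG, hGle⟩ := exists_weakGradient_of_tendsto (C := fun n => E (φ n) - N n)
    (fun n => hv (φ n)) (fun n => by
      have h1 := hE (φ n)
      unfold functional at h1
      rw [(hv _).gradNormSq_eq, (hv _).powInt_eq, (hv _).powInt_eq] at h1
      simp only [N]
      linarith) ((hE₀.comp hφ.tendsto_atTop).sub hN) (fun n => hB (φ n)) hlim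
  have hL2 : MemLp (fun x : Space d => (g ‖x‖ : ℂ)) 2 volume := by
    refine (memLp_two_iff_integrable_sq_norm hmeas).2 ?_
    simpa only [hnorm] using i2
  have hL0 : MemLp (fun x : Space d => (g ‖x‖ : ℂ)) (ENNReal.ofReal (p₀ + 2)) volume := by
    have hp : 0 < p₀ + 2 := by linarith [h.two_lt']
    refine (integrable_norm_rpow_iff hmeas (by simpa using hp) ENNReal.ofReal_ne_top).1 ?_
    rw [ENNReal.toReal_ofReal hp.le]
    simpa only [hnorm] using i0
  refine ⟨φ, hφ, g, hg, hgB, hlim, ⟨⟨hL2, G, hG2, hG⟩, hL0, rfl⟩, hmass, ?_⟩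
  unfold functional
  rw [DoublePowerNLS.gradNormSq_eq hG]
  unfold powInt
  simp_rw [hnorm]
  simp only [N₀] at hGle
  linarith

/-! ### Existence of minimisers -/

theorem volume_ball_le_half (hd : 1 ≤ d) {r : ℝ} (hr : 0 < r) :
    volume (Metric.ball (0 : Space d) r) ≤ volume (Metric.ball (0 : Space d) (2 * r)) / 2 := by
  have hω := ballVol_pos d
  rw [volume_ball_eq d hr, volume_ball_eq d (by positivity : 0 < 2 * r),
    show (volume (Metric.ball (0 : Space d) 1)).toReal = ballVol d from rfl,
    ENNReal.le_div_iff_mul_le (by simp) (by simp),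
    show (2 : ℝ≥0∞) = ENNReal.ofReal 2 by simp, ← ENNReal.ofReal_mul (by positivity)]
  refine ENNReal.ofReal_le_ofReal ?_
  have h2 : (2 : ℝ) ≤ 2 ^ d := by
    calc (2 : ℝ) = 2 ^ 1 := by norm_num
      _ ≤ 2 ^ d := pow_le_pow_right₀ (by norm_num) hd
  rw [mul_pow]
  have : 0 ≤ r ^ d * ballVol d := by positivity
  nlinarith

theorem powInt_pos {u : Space d → ℂ} {q : ℝ} (hq : 0 < q) (hu : MemLp u (ENNReal.ofReal q) volume)
    (hm : 0 < mass u) : 0 < powInt q u := by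
  refine (powInt_nonneg q u).lt_of_ne' fun h0 => hm.ne' ?_
  have h1 := (integral_eq_zero_iff_of_nonneg (fun x => Real.rpow_nonneg (norm_nonneg (u x)) q)
    (integrable_rpow_of_memLp hq hu)).1 h0
  refine integral_eq_zero_of_ae ?_
  filter_upwards [h1] with x hx
  have : ‖u x‖ = 0 := (Real.rpow_eq_zero (norm_nonneg _) hq.ne').1 hx
  simp [this]

namespace Admissible
variable {a b p₁ p₀ : ℝ} (h : Admissible d a b (p₁ + 2) (p₀ + 2))
include h

/-- A bounded radial bump which is small close to the origin has nonnegative energy. -/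
theorem functional_nonneg_of_small {A K : ℝ} (hA : 0 < A) (hK : 0 < K) :
    ∃ t : ℝ, 0 < t ∧ ∃ ε : ℝ, 0 < ε ∧ ∀ v : Space d → ℝ, IsLipBump v → RadiallyAntitone v →
      ∫ x, v x ^ 2 ≤ A → (∀ x, v x ≤ K) → ∀ x₀, ‖x₀‖ < ε → v x₀ ≤ t →
      0 ≤ functional a b (p₁ + 2) (p₀ + 2) (fun x => (v x : ℂ)) := by
  have hθ : 0 < p₁ + 2 - 2 - 4 / (d : ℝ) := by linarith [h.supercritical]
  have hq : 0 < p₁ + 2 := by linarith [h.two_lt]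
  have ha := h.ha
  have h1 : Tendsto (fun t : ℝ => a * ((p₁ + 2) * weakConst d * A ^ (2 / (d : ℝ))
      * t ^ (p₁ + 2 - 2 - 4 / (d : ℝ)) / (p₁ + 2 - 2 - 4 / (d : ℝ)))) (𝓝[>] 0) (𝓝 0) := by
    have : Tendsto (fun t : ℝ => t ^ (p₁ + 2 - 2 - 4 / (d : ℝ))) (𝓝[>] 0) (𝓝 0) := by
      have := (Real.continuous_rpow_const hθ.le).tendsto (0 : ℝ)
      rw [Real.zero_rpow hθ.ne'] at this
      exact this.mono_left nhdsWithin_le_nhds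
    simpa using (((this.const_mul ((p₁ + 2) * weakConst d * A ^ (2 / (d : ℝ)))).div_const
      (p₁ + 2 - 2 - 4 / (d : ℝ))).const_mul a)
  -- Levels below t₀ use up less than half of the Dirichlet integral; ε is chosen afterwards,
  -- depending on t₀, so that the levels above use up less than the other half.
  obtain ⟨t₀, ⟨ht, ht0⟩, htK⟩ := ((h1.eventually (gt_mem_nhds (show (0 : ℝ) < 1 / 2 by norm_num))).and
    self_mem_nhdsWithin).and (Ioc_mem_nhdsGT hK) |>.exists
  have h2 : Tendsto (fun ε : ℝ => a * (8 * (2 * ε) ^ 2 / t₀ ^ 2 * K ^ (p₁ + 2))) (𝓝[>] 0) (𝓝 0) := by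
    have : Continuous fun ε : ℝ => a * (8 * (2 * ε) ^ 2 / t₀ ^ 2 * K ^ (p₁ + 2)) := by fun_prop
    have h3 := this.tendsto 0
    simp only [mul_zero, ne_eq, OfNat.ofNat_ne_zero, not_false_eq_true, zero_pow, zero_div,
      zero_mul] at h3
    exact h3.mono_left nhdsWithin_le_nhds
  obtain ⟨ε, hε, hε0⟩ := ((h2.eventually (gt_mem_nhds (show (0 : ℝ) < 1 / 2 by norm_num))).and
    self_mem_nhdsWithin).exists
  have ht0' : 0 < t₀ := ht0
  have hε0' : 0 < ε := hε0
  refine ⟨t₀ / 2, half_pos ht0', ε, hε0', fun v hv hr hvA hvK x₀ hx₀ hvx₀ => ?_⟩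
  have hD := dirichlet_nonneg v
  have h4 := hv.integral_rpow_le h.dim hA hvA hvK ht0' htK.2 h.supercritical
    (B := 8 * (2 * ε) ^ 2 / t₀ ^ 2) (by positivity) fun t htt htK' => by
      have ht' : 0 < t := ht0'.trans htt
      refine (hv.measure_superlevel_le ht' (r := 2 * ε) (by positivity) ?_).trans ?_
      -- At radius ε and beyond, v ≤ v x₀ ≤ t₀/2 < t/2, so the superlevel set of t/2 lies in the
      -- ball of radius ε, at most half of the ball of radius 2ε.
      · refine (measure_mono fun x hx => ?_).trans (volume_ball_le_half h.dim hε0')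
        rw [mem_ball_zero_iff]
        by_contra hcon
        have h5 := hr x₀ x (hx₀.le.trans (not_lt.1 hcon))
        have h6 : t / 2 < v x := hx
        linarith
      · refine ENNReal.ofReal_le_ofReal ?_
        gcongr
  refine le_trans (mul_nonneg ?_ hD) (h.functional_bump_lower hv h4)
  rw [mul_add]
  linarith

/-- A near-optimal bump is truncated, then symmetrized; neither raises the functional. Truncation
may lower the mass, hence only an upper bound on it. -/
theorem exists_radial_bump {K : ℝ} (hK : 0 < K)
    (hcut : ∀ s, 0 ≤ s → -a * (min s K) ^ (p₁ + 2) + b * (min s K) ^ (p₀ + 2)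
      ≤ -a * s ^ (p₁ + 2) + b * s ^ (p₀ + 2)) {m : ℝ} (hm : 0 < m) {E : ℝ}
    (hE : groundInf d a b p₁ p₀ m < E) :
    ∃ v : Space d → ℝ, IsLipBump v ∧ RadiallyAntitone v ∧ (∀ x, v x ≤ K) ∧ ∫ x, v x ^ 2 ≤ m ∧
      functional a b (p₁ + 2) (p₀ + 2) (fun x => (v x : ℂ)) < E := by
  obtain ⟨f, hf, hfm, hfE⟩ := h.exists_bump_lt hm hE
  obtain ⟨hw, -⟩ := hf.truncate hK.le
  obtain ⟨v, hv, hvK, hvq, hvD, hvr⟩ := hw.exists_symmetrization fun x => min_le_right (f x) K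
  refine ⟨v, hv, hvr, hvK, ?_, ?_⟩
  · have h2 := hvq 2 two_pos
    simp only [Real.rpow_two] at h2
    rw [h2]
    exact (integral_min_sq_le hf hK.le).trans hfm.le
  · refine lt_of_le_of_lt ?_ hfE
    refine le_trans ?_ (h.functional_truncate_le hK hcut hf)
    unfold functional
    rw [hv.gradNormSq_eq, hw.gradNormSq_eq, hv.powInt_eq, hv.powInt_eq, hw.powInt_eq, hw.powInt_eq,
      hvq _ (by linarith [h.two_lt]), hvq _ (by linarith [h.two_lt'])]
    linarith

/-- Minimisers of critical mass and of supercritical mass exist. -/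
theorem exists_minimizer {mc : ℝ} (hmc0 : 0 < mc) (hmc : ∀ m ∈ Icc 0 mc, groundInf d a b p₁ p₀ m = 0)
    (hneg : ∀ m ∈ Ioi mc, groundInf d a b p₁ p₀ m < 0)
    (hanti : StrictAntiOn (groundInf d a b p₁ p₀) (Ioi mc)) {m : ℝ} (hm : mc ≤ m) :
    ∃ g : ℝ → ℝ, Antitone g ∧ (∃ K, ∀ r, g r ∈ Icc 0 K) ∧
      (fun x : Space d => (g ‖x‖ : ℂ)) ∈ massShell d p₀ m ∧
      functional a b (p₁ + 2) (p₀ + 2) (fun x : Space d => (g ‖x‖ : ℂ)) = groundInf d a b p₁ p₀ m := by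
  obtain ⟨K, hK, hcut⟩ := h.exists_cutoff
  have hlim0 : Tendsto (fun n : ℕ => 1 / ((n : ℝ) + 1)) atTop (𝓝 0) :=
    tendsto_one_div_add_atTop_nhds_zero_nat
  have hpos : ∀ n : ℕ, 0 < 1 / ((n : ℝ) + 1) := fun n => by positivity
  rcases hm.eq_or_lt with rfl | hm
  -- At the critical mass a minimising sequence could simply vanish. Mass bounds slightly above mc
  -- allow strictly negative energies, which is what excludes the zero limit.
  · have hex : ∀ n : ℕ, ∃ v : Space d → ℝ, IsLipBump v ∧ RadiallyAntitone v ∧ (∀ x, v x ≤ K) ∧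
        ∫ x, v x ^ 2 ≤ mc + 1 / ((n : ℝ) + 1) ∧
        functional a b (p₁ + 2) (p₀ + 2) (fun x => (v x : ℂ)) < 0 := fun n =>
      h.exists_radial_bump hK hcut (by linarith [hpos n])
        (hneg _ (by simpa using hpos n))
    choose v hv hr hvK hvm hvE using hex
    have hI : groundInf d a b p₁ p₀ mc = 0 := hmc mc ⟨hmc0.le, le_rfl⟩
    obtain ⟨φ, hφ, g, hg, hgK, hlim, hmem, hM, hF⟩ := h.exists_radial_limit hv hr hvK
      (A := fun n => mc + 1 / ((n : ℝ) + 1)) (E := fun _ => 0) (A₀ := mc) (E₀ := 0) hvm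
      (by simpa using hlim0.const_add mc) (fun n => (hvE n).le) tendsto_const_nhds
    set u : Space d → ℂ := fun x => (g ‖x‖ : ℂ) with hu
    have hM0 : mass u ≠ 0 := by
      intro h0
      obtain ⟨t, ht, ε, hε, hsm⟩ := h.functional_nonneg_of_small (A := mc + 1) (by positivity) hK
      have h1 := (integral_eq_zero_iff_of_nonneg (fun x => sq_nonneg ‖u x‖)
        (integrable_sq_of_memLp hmem.1.1)).1 h0
      have h2 : ∀ᵐ x : Space d, Tendsto (fun n => v (φ n) x) atTop (𝓝 0) := by
        filter_upwards [hlim, h1] with x hx h1x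
        have : u x = 0 := by simpa using h1x
        have : g ‖x‖ = 0 := by simpa [hu] using this
        rwa [this] at hx
      have h3 : ∃ x₀ ∈ Metric.ball (0 : Space d) ε, Tendsto (fun n => v (φ n) x₀) atTop (𝓝 0) := by
        by_contra hcon
        push Not at hcon
        -- Almost everywhere convergence to 0 must hold at some point of the ball of radius ε, since
        -- that ball has positive measure.
        refine (Metric.measure_ball_pos volume (0 : Space d) hε).ne' (measure_mono_null ?_ (ae_iff.1 h2))
        exact fun x hx => hcon x hx
      obtain ⟨x₀, hx₀, hx₀l⟩ := h3
      obtain ⟨n, hn⟩ := (hx₀l.eventually (gt_mem_nhds ht)).exists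
      have hle : 1 / (((φ n : ℕ) : ℝ) + 1) ≤ 1 := by
        rw [div_le_one (by positivity)]
        linarith [(Nat.cast_nonneg (φ n) : (0 : ℝ) ≤ _)]
      exact (hvE (φ n)).not_ge (hsm _ (hv _) (hr _) ((hvm _).trans (by linarith)) (hvK _) x₀
        (mem_ball_zero_iff.1 hx₀) hn.le)
    have hMpos : 0 < mass u := (mass_nonneg u).lt_of_ne' hM0
    rcases hM.eq_or_lt with hMeq | hMlt
    · refine ⟨g, hg, ⟨K, hgK⟩, hMeq ▸ hmem, le_antisymm (hF.trans hI.ge) (h.groundInf_le (hMeq ▸ hmem))⟩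
    -- A limit of mass below mc has nonpositive energy, so coercivity forces its gradient to vanish
    -- and its two potential terms to balance.
    · exfalso
      obtain ⟨δ, hδ, hco⟩ := h.subcritical_coercive hI hMpos hMlt
      have h1 := hco u hmem
      have hD0 := gradNormSq_nonneg u
      have hD : gradNormSq u = 0 := by nlinarith
      have hq0 : 0 < p₀ + 2 := by linarith [h.two_lt']
      have hP0 := powInt_pos hq0 hmem.2.1 hMpos
      have hbal : a * powInt (p₁ + 2) u = b * powInt (p₀ + 2) u := by
        have h2 : functional a b (p₁ + 2) (p₀ + 2) u = 0 := by
          rw [hD, mul_zero] at h1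
          exact le_antisymm hF h1
        unfold functional at h2
        linarith
      -- Halving the amplitude upsets the balance in favour of the lower power, giving negative
      -- energy at a still smaller mass, where the infimum is 0.
      have h3 := h.groundInf_le (mem_massShell_dilate hmem (1 / 2) one_pos)
      rw [functional_dilate hmem.1 (by norm_num) one_pos, hD, hmc _ ⟨by positivity, by
        rw [one_pow, inv_one]; nlinarith⟩] at h3
      have h4 : (1 / 2 : ℝ) ^ (p₀ + 2) < (1 / 2 : ℝ) ^ (p₁ + 2) :=
        Real.rpow_lt_rpow_of_exponent_gt (by norm_num) (by norm_num) h.lt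
      have h5 : 0 < b * powInt (p₀ + 2) u := mul_pos h.hb hP0
      have h6 : a * (1 / 2 : ℝ) ^ (p₁ + 2) * powInt (p₁ + 2) u
          = (1 / 2 : ℝ) ^ (p₁ + 2) * (b * powInt (p₀ + 2) u) := by rw [← hbal]; ring
      rw [h6, one_pow, inv_one] at h3
      nlinarith
  · set I := groundInf d a b p₁ p₀ with hIdef
    have hm0 : 0 < m := hmc0.trans hm
    have hex : ∀ n : ℕ, ∃ v : Space d → ℝ, IsLipBump v ∧ RadiallyAntitone v ∧ (∀ x, v x ≤ K) ∧
        ∫ x, v x ^ 2 ≤ m ∧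
        functional a b (p₁ + 2) (p₀ + 2) (fun x => (v x : ℂ)) < I m + 1 / ((n : ℝ) + 1) := fun n =>
      h.exists_radial_bump hK hcut hm0 (by linarith [hpos n])
    choose v hv hr hvK hvm hvE using hex
    obtain ⟨φ, hφ, g, hg, hgK, hlim, hmem, hM, hF⟩ := h.exists_radial_limit hv hr hvK
      (A := fun n => m) (E := fun n => I m + 1 / ((n : ℝ) + 1)) (A₀ := m) (E₀ := I m) hvm
      tendsto_const_nhds (fun n => (hvE n).le) (by simpa using hlim0.const_add (I m))
    set u : Space d → ℂ := fun x => (g ‖x‖ : ℂ) with hu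
    have h1 : I (mass u) ≤ I m := (h.groundInf_le hmem).trans hF
    -- The limit has energy at most I m < 0, so its mass is supercritical; strict monotonicity of I
    -- then leaves no room for a loss of mass.
    have h2 : mc < mass u := by
      by_contra hcon
      have h3 : I (mass u) = 0 := hmc _ ⟨mass_nonneg u, not_lt.1 hcon⟩
      have h4 : I m < 0 := hneg m hm
      linarith
    have hMeq : mass u = m := by
      by_contra hne
      exact (hanti h2 hm (lt_of_le_of_ne hM hne)).not_ge h1
    exact ⟨g, hg, ⟨K, hgK⟩, hMeq ▸ hmem, le_antisymm hF (h.groundInf_le (hMeq ▸ hmem))⟩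

end Admissible

/-! ### First variation and the Euler–Lagrange equation -/

/-- The Laplacian in coordinates. -/
noncomputable def lap (φ : Space d → ℝ) (x : Space d) : ℝ :=
  ∑ i, fderiv ℝ (fun y => fderiv ℝ φ y (EuclideanSpace.single i 1)) x (EuclideanSpace.single i 1)

theorem integral_add_mul_add_mul {α : Type*} [MeasurableSpace α] {μ : Measure α} {f g k : α → ℝ}
    (hf : Integrable f μ) (hg : Integrable g μ) (hk : Integrable k μ) (c e : ℝ) :
    ∫ x, f x + c * g x + e * k x ∂μ = (∫ x, f x ∂μ) + c * (∫ x, g x ∂μ) + e * ∫ x, k x ∂μ := by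
  have h1 : Integrable (fun x => c * g x) μ := hg.const_mul c
  have h2 : Integrable (fun x => e * k x) μ := hk.const_mul e
  have h3 : Integrable (fun x => f x + c * g x) μ := hf.add h1
  rw [integral_add h3 h2, integral_add hf h1, integral_const_mul, integral_const_mul]

section TestFunction
variable {φ : Space d → ℝ} (hφ : ContDiff ℝ ∞ φ) (hc : HasCompactSupport φ)
include hφ

theorem contDiff_partial (i : Fin d) :
    ContDiff ℝ ∞ fun y => fderiv ℝ φ y (EuclideanSpace.single i 1) :=
  (hφ.fderiv_right (m := ∞) (by simp)).clm_apply contDiff_const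

include hc

omit hφ in
theorem hasCompactSupport_partial (i : Fin d) :
    HasCompactSupport fun y => fderiv ℝ φ y (EuclideanSpace.single i 1) :=
  hc.fderiv_apply (𝕜 := ℝ) _

theorem memLp_gradC_of_contDiff : MemLp (gradC φ) 2 volume := by
  have h1 : MemLp (fderiv ℝ φ) 2 volume :=
    (hφ.continuous_fderiv (by simp)).memLp_of_hasCompactSupport (hc.fderiv (𝕜 := ℝ))
  exact h1.mono (measurable_gradC φ).aestronglyMeasurable
    (Eventually.of_forall fun x => (norm_gradC φ x).le)

/-- Use the partial derivatives of φ as test functions, take real parts and sum. -/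
theorem integral_inner_gradC {w : Space d → ℝ} {G : Space d → EuclideanSpace ℂ (Fin d)}
    (hG : IsWeakGradient (fun x => (w x : ℂ)) G) :
    (Integrable fun x => ∑ i, (G x i).re * fderiv ℝ φ x (EuclideanSpace.single i 1)) ∧
      ∫ x, ∑ i, (G x i).re * fderiv ℝ φ x (EuclideanSpace.single i 1) = - ∫ x, w x * lap φ x := by
  have hGi : ∀ i, LocallyIntegrable (fun x => G x i) volume := fun i x => by
    obtain ⟨s, hs, hi⟩ := hG.2.1 x
    exact ⟨s, hs, (EuclideanSpace.proj (𝕜 := ℂ) i).integrable_comp hi⟩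
  have hw : LocallyIntegrable w volume := fun x => by
    obtain ⟨s, hs, hi⟩ := hG.1 x
    exact ⟨s, hs, hi.re⟩
  have hi1 : ∀ i, Integrable fun x => fderiv ℝ φ x (EuclideanSpace.single i 1) • G x i := fun i =>
    (hGi i).integrable_smul_left_of_hasCompactSupport (contDiff_partial hφ i).continuous
      (hasCompactSupport_partial hc i)
  have hi2 : ∀ i, Integrable fun x => (G x i).re * fderiv ℝ φ x (EuclideanSpace.single i 1) :=
    fun i => (hi1 i).re.congr (Eventually.of_forall fun x => by simp [mul_comm])
  have hi3 : ∀ i, Integrable fun x => w x * fderiv ℝ (fun y => fderiv ℝ φ y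
      (EuclideanSpace.single i 1)) x (EuclideanSpace.single i 1) := fun i =>
    (hw.integrable_smul_left_of_hasCompactSupport (contDiff_partial (contDiff_partial hφ i) i).continuous
      (hasCompactSupport_partial (hasCompactSupport_partial hc i) i)).congr
      (Eventually.of_forall fun x => mul_comm _ _)
  refine ⟨integrable_finsetSum _ fun i _ => hi2 i, ?_⟩
  unfold lap
  simp_rw [Finset.mul_sum]
  rw [integral_finsetSum _ fun i _ => hi2 i, integral_finsetSum _ fun i _ => hi3 i,
    ← Finset.sum_neg_distrib]
  refine Finset.sum_congr rfl fun i _ => ?_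
  have h1 := hG.2.2 _ (contDiff_partial hφ i) (hasCompactSupport_partial hc i) i
  have h2 : ∫ x, (fderiv ℝ (fun y => fderiv ℝ φ y (EuclideanSpace.single i 1)) x
      (EuclideanSpace.single i 1)) • (w x : ℂ) = ((∫ x, w x * fderiv ℝ (fun y => fderiv ℝ φ y
      (EuclideanSpace.single i 1)) x (EuclideanSpace.single i 1) : ℝ) : ℂ) := by
    rw [← integral_complex_ofReal]
    refine integral_congr_ae (Eventually.of_forall fun x => ?_)
    simp [mul_comm]
  rw [h2] at h1
  have h3 := congrArg Complex.re h1
  rw [Complex.ofReal_re, Complex.neg_re] at h3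
  rw [h3, neg_neg]
  have h4 := integral_re (hi1 i)
  rw [show (∫ x, fderiv ℝ φ x (EuclideanSpace.single i 1) • G x i).re
    = RCLike.re (∫ x, fderiv ℝ φ x (EuclideanSpace.single i 1) • G x i) from rfl, ← h4]
  refine integral_congr_ae (Eventually.of_forall fun x => ?_)
  simp [mul_comm]

theorem isWeakGradient_add_smul {u : Space d → ℂ} {G : Space d → EuclideanSpace ℂ (Fin d)}
    (hG : IsWeakGradient u G) (t : ℝ) :
    IsWeakGradient (fun x => u x + ((t * φ x : ℝ) : ℂ)) (fun x => G x + t • gradC φ x) := by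
  obtain ⟨L, hL⟩ := ContDiff.lipschitzWith_of_hasCompactSupport hc hφ (by simp)
  obtain ⟨a1, a2, a3⟩ := isWeakGradient_of_lipschitz hL
  have e0 : ∀ x, ((t * φ x : ℝ) : ℂ) = t • (φ x : ℂ) := fun x => by simp
  simp_rw [e0]
  have hcoord : ∀ {K : Space d → EuclideanSpace ℂ (Fin d)}, LocallyIntegrable K volume →
      ∀ i : Fin d, LocallyIntegrable (fun x => K x i) volume := by
    intro K hK i x
    obtain ⟨s, hs, hi⟩ := hK x
    exact ⟨s, hs, (EuclideanSpace.proj (𝕜 := ℂ) i).integrable_comp hi⟩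
  refine ⟨hG.1.add (a1.smul t), hG.2.1.add (a2.smul t), fun ψ hψ hψc i => ?_⟩
  have h1 := hG.2.2 ψ hψ hψc i
  have h2 := a3 ψ hψ hψc i
  have hs := contDiff_partial hψ i
  have hsc := hasCompactSupport_partial hψc i
  have i1 := hG.1.integrable_smul_left_of_hasCompactSupport hs.continuous hsc
  have i2 := a1.integrable_smul_left_of_hasCompactSupport hs.continuous hsc
  have i3 := (hcoord hG.2.1 i).integrable_smul_left_of_hasCompactSupport hψ.continuous hψc
  have i4 := (hcoord a2 i).integrable_smul_left_of_hasCompactSupport hψ.continuous hψc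
  have e1 : ∀ x, (fderiv ℝ ψ x (EuclideanSpace.single i 1)) • (u x + t • (φ x : ℂ))
      = (fderiv ℝ ψ x (EuclideanSpace.single i 1)) • u x
        + t • ((fderiv ℝ ψ x (EuclideanSpace.single i 1)) • (φ x : ℂ)) := fun x => by
    rw [smul_add, smul_comm]
  have e2 : ∀ x, ψ x • (G x + t • gradC φ x) i = ψ x • G x i + t • (ψ x • gradC φ x i) := fun x => by
    rw [PiLp.add_apply, PiLp.smul_apply, smul_add, smul_comm]
  simp_rw [e1, e2]
  have i2' : Integrable fun x => t • ((fderiv ℝ ψ x (EuclideanSpace.single i 1)) • (φ x : ℂ)) := i2.smul t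
  have i4' : Integrable fun x => t • (ψ x • gradC φ x i) := i4.smul t
  rw [integral_add i1 i2', integral_add i3 i4', integral_smul, integral_smul, h1, h2,
    smul_neg, neg_add]

theorem gradNormSq_add_smul {w : Space d → ℝ} (hw : MemH1 fun x => (w x : ℂ)) (t : ℝ) :
    gradNormSq (fun x => ((w x + t * φ x : ℝ) : ℂ)) = gradNormSq (fun x => (w x : ℂ))
      - 2 * t * (∫ x, w x * lap φ x) + t ^ 2 * dirichlet φ := by
  obtain ⟨hw2, G, hG2, hG⟩ := hw
  obtain ⟨i1, e1⟩ := integral_inner_gradC hφ hc hG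
  have e2 : (fun x => ((w x + t * φ x : ℝ) : ℂ)) = fun x => (w x : ℂ) + ((t * φ x : ℝ) : ℂ) := by
    ext x; push_cast; ring
  have i2 : Integrable fun x => ‖gradC φ x‖ ^ 2 :=
    (memLp_two_iff_integrable_sq_norm (measurable_gradC φ).aestronglyMeasurable).1
      (memLp_gradC_of_contDiff hφ hc)
  have i3 : Integrable fun x => ‖G x‖ ^ 2 :=
    (memLp_two_iff_integrable_sq_norm hG2.1).1 hG2
  have e3 : ∀ x, ‖G x + t • gradC φ x‖ ^ 2 = ‖G x‖ ^ 2
      + 2 * t * (∑ i, (G x i).re * fderiv ℝ φ x (EuclideanSpace.single i 1))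
      + t ^ 2 * ‖gradC φ x‖ ^ 2 := by
    intro x
    rw [EuclideanSpace.norm_sq_eq, EuclideanSpace.norm_sq_eq, EuclideanSpace.norm_sq_eq,
      Finset.mul_sum, Finset.mul_sum, ← Finset.sum_add_distrib, ← Finset.sum_add_distrib]
    refine Finset.sum_congr rfl fun i _ => ?_
    simp only [PiLp.add_apply, PiLp.smul_apply, gradC, Complex.sq_norm, Complex.normSq_apply,
      Complex.add_re, Complex.add_im, Complex.real_smul, Complex.re_ofReal_mul, Complex.im_ofReal_mul,
      Complex.ofReal_re, Complex.ofReal_im]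
    ring
  rw [e2, gradNormSq_eq (isWeakGradient_add_smul hφ hc hG t), gradNormSq_eq hG]
  simp_rw [e3]
  rw [integral_add_mul_add_mul i3 i1 i2, e1]
  simp_rw [norm_gradC]
  unfold dirichlet
  ring

theorem mass_add_smul {w : Space d → ℝ} (hw : MemLp (fun x => (w x : ℂ)) 2 volume) (t : ℝ) :
    mass (fun x => ((w x + t * φ x : ℝ) : ℂ)) = mass (fun x => (w x : ℂ))
      + 2 * t * (∫ x, w x * φ x) + t ^ 2 * ∫ x, φ x ^ 2 := by
  have hwl : LocallyIntegrable w volume := fun x => by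
    obtain ⟨s, hs, hi⟩ := (hw.locallyIntegrable (by norm_num)) x
    exact ⟨s, hs, hi.re⟩
  have i1 : Integrable fun x => w x ^ 2 := by simpa using integrable_sq_of_memLp hw
  have i2 : Integrable fun x => w x * φ x :=
    (hwl.integrable_smul_left_of_hasCompactSupport hφ.continuous hc).congr
      (Eventually.of_forall fun x => mul_comm _ _)
  have i3 : Integrable fun x => φ x ^ 2 :=
    (hφ.continuous.memLp_of_hasCompactSupport hc (p := 2)).integrable_sq
  unfold mass
  have e : ∀ x, ‖((w x + t * φ x : ℝ) : ℂ)‖ ^ 2 = w x ^ 2 + 2 * t * (w x * φ x) + t ^ 2 * φ x ^ 2 :=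
    fun x => by rw [Complex.norm_real, Real.norm_eq_abs, sq_abs]; ring
  have e' : ∀ x, ‖(w x : ℂ)‖ ^ 2 = w x ^ 2 := fun x => by
    rw [Complex.norm_real, Real.norm_eq_abs, sq_abs]
  simp_rw [e, e']
  rw [integral_add_mul_add_mul i1 i2 i3]

/-- Boundedness of `w` and compact support of φ dominate the derivative for |t| < 1, so
differentiation passes under the integral. -/
theorem hasDerivAt_powInt_add_smul {w : Space d → ℝ} {K q : ℝ} (hwK : ∀ x, w x ∈ Icc 0 K) (hq : 2 < q)
    (hw : MemLp (fun x => (w x : ℂ)) (ENNReal.ofReal q) volume) :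
    HasDerivAt (fun t : ℝ => powInt q (fun x => ((w x + t * φ x : ℝ) : ℂ)))
      (q * ∫ x, w x ^ (q - 1) * φ x) 0 := by
  have hwm : AEStronglyMeasurable w volume := by
    have := Complex.continuous_re.comp_aestronglyMeasurable hw.1
    simpa [Function.comp_def] using this
  obtain ⟨S, hS⟩ := hφ.continuous.bounded_above_of_compact_support hc
  have hq0 : 0 < q := by linarith
  have e : ∀ t : ℝ, powInt q (fun x => ((w x + t * φ x : ℝ) : ℂ)) = ∫ x, |w x + t * φ x| ^ q :=
    fun t => by unfold powInt; simp_rw [Complex.norm_real, Real.norm_eq_abs]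
  simp_rw [e]
  have hm : ∀ t : ℝ, AEMeasurable (fun x => w x + t * φ x) volume := fun t =>
    hwm.aemeasurable.add ((hφ.continuous.measurable.const_mul t).aemeasurable)
  have hK0 : 0 ≤ K := (hwK 0).1.trans (hwK 0).2
  have hS0 : 0 ≤ S := (norm_nonneg _).trans (hS 0)
  have h := hasDerivAt_integral_of_dominated_loc_of_deriv_le (μ := (volume : Measure (Space d)))
    (F := fun t x => |w x + t * φ x| ^ q) (x₀ := (0 : ℝ)) (s := Metric.ball 0 1)
    (F' := fun t x => q * |w x + t * φ x| ^ (q - 2) * (w x + t * φ x) * φ x)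
    (bound := fun x => q * (K + S) ^ (q - 2) * (K + S) * ‖φ x‖)
    (Metric.ball_mem_nhds _ one_pos)
    (Eventually.of_forall fun t => ((continuous_abs.measurable.comp_aemeasurable (hm t)).pow_const
      q).aestronglyMeasurable)
    (by
      have := integrable_rpow_of_memLp hq0 hw
      simpa [Complex.norm_real, Real.norm_eq_abs] using this)
    (by
      have h1 := hm 0
      exact (((((continuous_abs.measurable.comp_aemeasurable h1).pow_const (q - 2)).const_mul q).mul
        h1).mul hφ.continuous.measurable.aemeasurable).aestronglyMeasurable)
    (Eventually.of_forall fun x t ht => by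
      have ht1 : |t| ≤ 1 := by
        have := Metric.mem_ball.1 ht
        rw [Real.dist_eq, sub_zero] at this
        exact this.le
      have hle : |w x + t * φ x| ≤ K + S := by
        refine (abs_add_le _ _).trans (add_le_add ?_ ?_)
        · rw [abs_of_nonneg (hwK x).1]; exact (hwK x).2
        · rw [abs_mul]
          have := hS x
          rw [Real.norm_eq_abs] at this
          nlinarith [abs_nonneg t, abs_nonneg (φ x)]
      rw [norm_mul, norm_mul, norm_mul, Real.norm_of_nonneg hq0.le,
        Real.norm_of_nonneg (Real.rpow_nonneg (abs_nonneg _) _), Real.norm_eq_abs (w x + t * φ x)]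
      have := Real.rpow_le_rpow (abs_nonneg _) hle (show 0 ≤ q - 2 by linarith)
      gcongr)
    ((hφ.continuous.integrable_of_hasCompactSupport hc).norm.const_mul _)
    (Eventually.of_forall fun x t _ => by
      have h1 : HasDerivAt (fun t : ℝ => w x + t * φ x) (φ x) t := by
        simpa using ((hasDerivAt_id t).mul_const (φ x)).const_add (w x)
      exact (hasDerivAt_abs_rpow (w x + t * φ x) (by linarith : 1 < q)).comp t h1)
  refine h.2.congr_deriv ?_
  rw [← integral_const_mul]
  refine integral_congr_ae (Eventually.of_forall fun x => ?_)
  simp only [zero_mul, add_zero]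
  rw [abs_of_nonneg (hwK x).1]
  have : w x ^ (q - 1) = w x ^ (q - 2) * w x := by
    rcases (hwK x).1.eq_or_lt with h0 | h0
    · rw [← h0, mul_zero, Real.zero_rpow (by linarith)]
    · rw [← Real.rpow_add_one h0.ne']; congr 1; ring
  rw [this]
  ring

end TestFunction

/-- The Euler-Lagrange equation of a bounded nonnegative minimiser. -/
theorem Admissible.euler_lagrange {a b p₁ p₀ : ℝ} (h : Admissible d a b (p₁ + 2) (p₀ + 2)) {m : ℝ}
    (hm : 0 < m) {w : Space d → ℝ} {K : ℝ} (hwK : ∀ x, w x ∈ Icc 0 K)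
    (hmem : (fun x => (w x : ℂ)) ∈ massShell d p₀ m)
    (hmin : functional a b (p₁ + 2) (p₀ + 2) (fun x => (w x : ℂ)) = groundInf d a b p₁ p₀ m) :
    ∃ c : ℝ, ∀ φ : Space d → ℝ, ContDiff ℝ ∞ φ → HasCompactSupport φ →
      ∫ x, w x * lap φ x = c * (∫ x, w x * φ x)
        - a * (p₁ + 2) / 2 * (∫ x, w x ^ (p₁ + 1) * φ x)
        + b * (p₀ + 2) / 2 * ∫ x, w x ^ (p₀ + 1) * φ x := by
  set I := groundInf d a b p₁ p₀ m with hI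
  set D := gradNormSq (fun x => (w x : ℂ)) with hD
  -- The multiplier collects the two contributions of the varying mass to the dilation inequality:
  -- the weight on the gradient and the right-hand side.
  refine ⟨(2 / (d : ℝ) * D - I) / m, fun φ hφ hc => ?_⟩
  have hwp : ∀ q : ℝ, 2 < q → q ≤ p₀ + 2 → MemLp (fun x => (w x : ℂ)) (ENNReal.ofReal q) volume := by
    intro q hq hq'
    have := integrable_rpow_of_massShell (q₁ := q) hq.le hq' hmem.1.1 hmem.2.1
    refine (integrable_norm_rpow_iff hmem.1.1.1 (by simpa using by linarith) ENNReal.ofReal_ne_top).1 ?_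
    rwa [ENNReal.toReal_ofReal (by linarith)]
  set v : ℝ → Space d → ℂ := fun t x => ((w x + t * φ x : ℝ) : ℂ) with hv
  have hv0 : v 0 = fun x => (w x : ℂ) := by ext x; simp [hv]
  have hMe : ∀ t, mass (v t) = m + 2 * t * (∫ x, w x * φ x) + t ^ 2 * ∫ x, φ x ^ 2 := fun t => by
    rw [hv, mass_add_smul hφ hc hmem.1.1, hmem.2.2]
  have hDe : ∀ t, gradNormSq (v t) = D - 2 * t * (∫ x, w x * lap φ x) + t ^ 2 * dirichlet φ :=
    fun t => gradNormSq_add_smul hφ hc hmem.1 t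
  have hvmem : ∀ t, v t ∈ massShell d p₀ (mass (v t)) := fun t => by
    obtain ⟨⟨h2, G, hG2, hG⟩, hp, -⟩ := hmem
    have e2 : v t = fun x => (w x : ℂ) + ((t * φ x : ℝ) : ℂ) := by
      ext x; simp [hv]
    have hφL : ∀ p : ℝ≥0∞, MemLp (fun x => ((t * φ x : ℝ) : ℂ)) p volume := fun p =>
      (((hφ.continuous.memLp_of_hasCompactSupport hc (p := p)).const_mul t)).ofReal
    refine ⟨⟨?_, _, hG2.add ((memLp_gradC_of_contDiff hφ hc).const_smul t), ?_⟩, ?_, rfl⟩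
    · rw [e2]; exact h2.add (hφL 2)
    · rw [e2]; exact isWeakGradient_add_smul hφ hc hG t
    · rw [e2]; exact hp.add (hφL _)
  have hM0 : mass (v 0) = m := by rw [hv0, hmem.2.2]
  have hMd : HasDerivAt (fun t => mass (v t)) (2 * ∫ x, w x * φ x) 0 := by
    simp_rw [hMe]
    have := (((hasDerivAt_id (0 : ℝ)).const_mul 2).mul_const (∫ x, w x * φ x)).const_add m |>.add
      (((hasDerivAt_id (0 : ℝ)).pow 2).mul_const (∫ x, φ x ^ 2))
    refine this.congr_deriv ?_
    simp
  have hDd : HasDerivAt (fun t => gradNormSq (v t)) (-(2 * ∫ x, w x * lap φ x)) 0 := by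
    simp_rw [hDe]
    have := (((hasDerivAt_id (0 : ℝ)).const_mul 2).mul_const (∫ x, w x * lap φ x)).const_sub D |>.add
      (((hasDerivAt_id (0 : ℝ)).pow 2).mul_const (dirichlet φ))
    refine this.congr_deriv ?_
    simp
  have hP1 := hasDerivAt_powInt_add_smul hφ hc hwK h.two_lt (hwp _ h.two_lt h.lt.le)
  have hP0 := hasDerivAt_powInt_add_smul hφ hc hwK h.two_lt' (hwp _ h.two_lt' le_rfl)
  have hD0 : gradNormSq (v 0) = D := by rw [hv0]
  have hr : HasDerivAt (fun t => (mass (v t) / m) ^ (2 / (d : ℝ)))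
      (2 / (d : ℝ) * ((2 * ∫ x, w x * φ x) / m)) 0 := by
    have h1 := (hMd.div_const m).rpow_const (p := 2 / (d : ℝ))
      (Or.inl (by rw [hM0, div_self hm.ne']; exact one_ne_zero))
    refine h1.congr_deriv ?_
    rw [hM0, div_self hm.ne', Real.one_rpow]
    ring
  have hJ := ((((hr.mul hDd).sub (hP1.const_mul a)).add (hP0.const_mul b)).sub
    ((hMd.div_const m).const_mul I))
  -- By the dilation inequality this is nonnegative whenever v t has positive mass, and it vanishes
  -- at t = 0; the variations need not preserve mass.
  have hmin' : IsLocalMin (fun t => (mass (v t) / m) ^ (2 / (d : ℝ)) * gradNormSq (v t)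
      - a * powInt (p₁ + 2) (v t) + b * powInt (p₀ + 2) (v t) - I * (mass (v t) / m)) 0 := by
    have h1 : ∀ᶠ t in 𝓝 (0 : ℝ), 0 < mass (v t) :=
      hMd.continuousAt.eventually (lt_mem_nhds (hM0.symm ▸ hm : 0 < mass (v 0)))
    filter_upwards [h1] with t ht
    have h2 := h.dilation_inequality ht hm (hvmem t)
    have h3 : (mass (v 0) / m) ^ (2 / (d : ℝ)) * gradNormSq (v 0)
        - a * powInt (p₁ + 2) (v 0) + b * powInt (p₀ + 2) (v 0) - I * (mass (v 0) / m) = 0 := by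
      rw [hM0, div_self hm.ne', Real.one_rpow, hv0, mul_one, ← hmin]
      unfold functional
      ring
    rw [h3]
    linarith
  have hz := hmin'.hasDerivAt_eq_zero hJ
  rw [hM0, hD0, div_self hm.ne', Real.one_rpow] at hz
  have e1 : p₁ + 2 - 1 = p₁ + 1 := by ring
  have e0 : p₀ + 2 - 1 = p₀ + 1 := by ring
  rw [e1, e0] at hz
  linear_combination (-1 / 2 : ℝ) * hz

/-! ### Reduction to the radial system -/

/-- Smooth functions on the line which vanish off `[ε, R]`. -/
structure IsTestOn (ζ : ℝ → ℝ) (ε R : ℝ) : Prop where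
  smooth : ContDiff ℝ ∞ ζ
  zero : ∀ r, r ∉ Icc ε R → ζ r = 0

namespace IsTestOn
variable {ζ : ℝ → ℝ} {ε R : ℝ}

theorem deriv (h : IsTestOn ζ ε R) : IsTestOn (deriv ζ) ε R := by
  refine ⟨(contDiff_infty_iff_deriv.1 h.smooth).2, fun r hr => ?_⟩
  have h1 : ζ =ᶠ[𝓝 r] fun _ => 0 := by
    filter_upwards [isClosed_Icc.isOpen_compl.mem_nhds hr] with s hs using h.zero s hs
  rw [h1.deriv_eq, deriv_const]

theorem hasDerivAt (h : IsTestOn ζ ε R) (r : ℝ) : HasDerivAt ζ (_root_.deriv ζ r) r :=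
  ((contDiff_infty_iff_deriv.1 h.smooth).1 r).hasDerivAt

theorem integrable_mul (h : IsTestOn ζ ε R) (hε : 0 < ε) {f : ℝ → ℝ}
    (hf : LocallyIntegrableOn f (Ioi 0) volume) : Integrable fun r => f r * ζ r := by
  have h1 : IntegrableOn f (Icc ε R) volume :=
    hf.integrableOn_compact_subset (fun x hx => hε.trans_le hx.1) isCompact_Icc
  have h2 : IntegrableOn (fun r => f r * ζ r) (Icc ε R) volume :=
    h1.mul_continuousOn h.smooth.continuous.continuousOn isCompact_Icc
  refine (integrableOn_iff_integrable_of_support_subset fun r hr => ?_).1 h2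
  by_contra hcon
  exact hr (by simp [h.zero r hcon])

theorem integrable (h : IsTestOn ζ ε R) (hε : 0 < ε) : Integrable ζ := by
  simpa using h.integrable_mul hε ((locallyIntegrable_const (1 : ℝ)).locallyIntegrableOn _)

end IsTestOn

theorem setIntegral_Ioi_eq_interval {F : ℝ → ℝ} {α β : ℝ} (hα : 0 ≤ α) (hαβ : α ≤ β)
    (hF : ∀ r, 0 < r → r ∉ Ioc α β → F r = 0) : ∫ r in Ioi 0, F r = ∫ r in α..β, F r := by
  rw [intervalIntegral.integral_of_le hαβ]
  refine setIntegral_eq_of_subset_of_forall_sdiff_eq_zero measurableSet_Ioi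
    (fun r hr => hα.trans_lt hr.1) fun r hr => hF r hr.1 hr.2

/-- The du Bois-Reymond lemma on the half line. -/
theorem ae_eq_const_of_integral_deriv_eq_zero {f : ℝ → ℝ}
    (hf : LocallyIntegrableOn f (Ioi 0) volume)
    (h : ∀ ζ ε R, 0 < ε → ε < R → IsTestOn ζ ε R → ∫ r, f r * deriv ζ r = 0) :
    ∃ c, ∀ᵐ r, r ∈ Ioi (0 : ℝ) → f r = c := by
  set β : ContDiffBump (2 : ℝ) := ⟨1 / 2, 1, by norm_num, by norm_num⟩ with hβ
  set ζ₀ : ℝ → ℝ := β.normed volume with hζ₀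
  have h0s : ContDiff ℝ ∞ ζ₀ := β.contDiff_normed
  have h0z : ∀ r, r ∉ Icc (1 : ℝ) 3 → ζ₀ r = 0 := fun r hr => by
    by_contra hcon
    have h1 : r ∈ Function.support ζ₀ := hcon
    rw [hζ₀, β.support_normed_eq, Metric.mem_ball, Real.dist_eq, abs_lt] at h1
    have h2 : β.rOut = 1 := rfl
    rw [h2] at h1
    exact hr ⟨by linarith [h1.1], by linarith [h1.2]⟩
  have h0i : ∫ r, ζ₀ r = 1 := β.integral_normed
  set c := ∫ r, f r * ζ₀ r with hc
  refine ⟨c, ?_⟩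
  have key := isOpen_Ioi.ae_eq_zero_of_integral_contDiff_smul_eq_zero (f := fun r => f r - c)
    (μ := (volume : Measure ℝ)) (U := Ioi (0 : ℝ))
    (hf.sub ((locallyIntegrable_const c).locallyIntegrableOn _)) ?_
  · filter_upwards [key] with r hr hr0 using sub_eq_zero.1 (hr hr0)
  intro η hη hηc hηs
  obtain ⟨ε, R, hε, hε1, hR3, hηz⟩ : ∃ ε R : ℝ, 0 < ε ∧ ε ≤ 1 ∧ 3 ≤ R ∧ ∀ r, r ∉ Icc ε R → η r = 0 := by
    rcases (tsupport η).eq_empty_or_nonempty with he | hne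
    · exact ⟨1, 3, one_pos, le_rfl, le_rfl, fun r _ =>
        image_eq_zero_of_notMem_tsupport (by simp [he])⟩
    · obtain ⟨x, hx, hxl⟩ := IsCompact.exists_isLeast (s := tsupport η) hηc hne
      obtain ⟨y, hy, hyg⟩ := IsCompact.exists_isGreatest (s := tsupport η) hηc hne
      refine ⟨min x 1, max y 3, lt_min (hηs hx) one_pos, min_le_right _ _, le_max_right _ _,
        fun r hr => image_eq_zero_of_notMem_tsupport fun hrs => hr ?_⟩
      exact ⟨(min_le_left _ _).trans (hxl hrs), (hyg hrs).trans (le_max_left _ _)⟩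
  have hεR : ε < R := by linarith
  have h0t : IsTestOn ζ₀ ε R := ⟨h0s, fun r hr => h0z r fun h => hr ⟨hε1.trans h.1, h.2.trans hR3⟩⟩
  have hηt : IsTestOn η ε R := ⟨hη, hηz⟩
  -- Subtracting a multiple of a fixed bump makes the mean zero, so the primitive again vanishes off
  -- [ε, R] and is admissible in the hypothesis.
  set θ : ℝ → ℝ := fun r => η r - (∫ s, η s) * ζ₀ r with hθ
  have hθs : ContDiff ℝ ∞ θ := hη.sub (contDiff_const.mul h0s)
  have hθz : ∀ r, r ∉ Icc ε R → θ r = 0 := fun r hr => by simp [hθ, hηz r hr, h0t.zero r hr]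
  have hθi : ∫ r, θ r = 0 := by
    rw [hθ, integral_sub (hηt.integrable hε) ((h0t.integrable hε).const_mul _), integral_const_mul,
      h0i, mul_one, sub_self]
  set ζ : ℝ → ℝ := fun r => ∫ s in 0..r, θ s with hζ
  have hζd : ∀ r, HasDerivAt ζ (θ r) r := fun r => hθs.continuous.integral_hasStrictDerivAt 0 r |>.hasDerivAt
  have hζe : deriv ζ = θ := funext fun r => (hζd r).deriv
  have hζt : IsTestOn ζ ε R := by
    refine ⟨contDiff_infty_iff_deriv.2 ⟨fun r => (hζd r).differentiableAt, hζe ▸ hθs⟩, fun r hr => ?_⟩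
    by_cases hrR : R < r
    · rw [hζ]
      simp only
      rw [intervalIntegral.integral_of_le (by linarith)]
      refine Eq.trans ?_ hθi
      refine setIntegral_eq_integral_of_forall_compl_eq_zero fun s hs => hθz s fun hs' => hs ?_
      exact ⟨hε.trans_le hs'.1, hs'.2.trans hrR.le⟩
    · have hrε : r < ε := by
        by_contra hcon
        exact hr ⟨not_lt.1 hcon, not_lt.1 hrR⟩
      refine intervalIntegral.integral_zero_ae (Eventually.of_forall fun s hs => hθz s fun hs' => ?_)
      have h1 : s ≤ max 0 r := hs.2
      have h2 : max 0 r < ε := max_lt hε hrε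
      linarith [hs'.1]
  have hmain := h ζ ε R hε hεR hζt
  rw [hζe] at hmain
  have i1 := hηt.integrable_mul hε hf
  have i2 := h0t.integrable_mul hε hf
  have e1 : ∫ r, f r * θ r = (∫ r, f r * η r) - (∫ s, η s) * c := by
    rw [hc, ← integral_const_mul, ← integral_sub i1 (i2.const_mul _)]
    refine integral_congr_ae (Eventually.of_forall fun r => ?_)
    simp only [hθ]
    ring
  have e2 : ∫ r, η r • (f r - c) = (∫ r, f r * η r) - (∫ s, η s) * c := by
    rw [← integral_mul_const, ← integral_sub i1 ((hηt.integrable hε).mul_const _)]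
    refine integral_congr_ae (Eventually.of_forall fun r => ?_)
    simp only [smul_eq_mul]
    ring
  rw [e2, ← e1, hmain]

/-- Functions of ‖x‖² are smooth at the origin and their Laplacian contains no division by the
radius. -/
theorem lap_comp_norm_sq {Ψ E : ℝ → ℝ} (hE : Differentiable ℝ E) (hΨ : ∀ r, HasDerivAt Ψ (E r) r)
    (x : Space d) : lap (fun x : Space d => Ψ (‖x‖ ^ 2)) x
      = 4 * ‖x‖ ^ 2 * deriv E (‖x‖ ^ 2) + 2 * d * E (‖x‖ ^ 2) := by
  have hn : ∀ x : Space d, HasFDerivAt (fun x : Space d => ‖x‖ ^ 2) (2 • innerSL ℝ x) x := fun x =>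
    (hasStrictFDerivAt_norm_sq x).hasFDerivAt
  have h1 : ∀ (i : Fin d) (y : Space d), fderiv ℝ (fun x : Space d => Ψ (‖x‖ ^ 2)) y
      (EuclideanSpace.single i 1) = E (‖y‖ ^ 2) * (2 * y i) := fun i y => by
    have a1 : HasFDerivAt (fun x : Space d => Ψ (‖x‖ ^ 2)) (E (‖y‖ ^ 2) • 2 • innerSL ℝ y) y :=
      (hΨ _).comp_hasFDerivAt y (hn y)
    rw [a1.fderiv]
    simp [EuclideanSpace.inner_single_right]
  unfold lap
  simp_rw [h1]
  have h2 : ∀ i : Fin d, fderiv ℝ (fun y : Space d => E (‖y‖ ^ 2) * (2 * y i)) x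
      (EuclideanSpace.single i 1) = 4 * deriv E (‖x‖ ^ 2) * (x i) ^ 2 + 2 * E (‖x‖ ^ 2) := fun i => by
    have a1 := (hE (‖x‖ ^ 2)).hasDerivAt.comp_hasFDerivAt x (hn x)
    have a2 : HasFDerivAt (fun y : Space d => 2 * y i)
        ((2 : ℝ) • (EuclideanSpace.proj i : Space d →L[ℝ] ℝ)) x :=
      (EuclideanSpace.proj i : Space d →L[ℝ] ℝ).hasFDerivAt.const_mul 2
    have a3 := a1.mul a2
    rw [show (fun y : Space d => E (‖y‖ ^ 2) * (2 * y i))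
      = ((E ∘ fun x : Space d => ‖x‖ ^ 2) * fun y : Space d => 2 * y i) from rfl, a3.fderiv]
    simp [EuclideanSpace.inner_single_right]
    ring
  simp_rw [h2]
  rw [Finset.sum_add_distrib, ← Finset.mul_sum, EuclideanSpace.norm_sq_eq]
  simp
  ring

/-- The radial part of a weak equation for the Laplacian. -/
theorem radial_weak_form (hd : 1 ≤ d) {g q : ℝ → ℝ}
    (hqi : ∀ x y, IntervalIntegrable (fun r => r ^ (d - 1) * q r) volume x y)
    (hqc : {r | ¬ ContinuousAt q r}.Countable)
    (hEL : ∀ φ : Space d → ℝ, ContDiff ℝ ∞ φ → HasCompactSupport φ →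
      ∫ x : Space d, g ‖x‖ * lap φ x = ∫ x : Space d, q ‖x‖ * φ x)
    {ζ : ℝ → ℝ} {ε R : ℝ} (hε : 0 < ε) (hεR : ε < R) (hζ : IsTestOn ζ ε R) :
    ∫ r in Ioi 0, g r * deriv ζ r
      = - ∫ r in Ioi 0, (∫ s in 0..r, s ^ (d - 1) * q s) / r ^ (d - 1) * ζ r := by
  have : Nontrivial (Space d) := by
    obtain ⟨e, he⟩ := exists_unit_vector hd
    exact ⟨e, 0, fun h => by simp [h] at he⟩
  set H : ℝ → ℝ := fun r => ∫ s in 0..r, s ^ (d - 1) * q s with hH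
  -- Chosen so that 2 r^d E(r²) = ζ(r): if Ψ' = E, then r^{d−1} times the Laplacian of Ψ(‖x‖²) is
  -- exactly ζ'(r).
  set E : ℝ → ℝ := fun ρ => ζ (√ρ) / (2 * √ρ ^ d) with hE
  have hR : 0 < R := hε.trans hεR
  have hE0 : ∀ ρ, ρ < ε ^ 2 → E ρ = 0 := fun ρ hρ => by
    have : √ρ < ε := (Real.sqrt_lt' hε).2 hρ
    simp [hE, hζ.zero _ fun h => absurd h.1 (not_le.2 this)]
  have hER : ∀ ρ, R ^ 2 < ρ → E ρ = 0 := fun ρ hρ => by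
    have : R < √ρ := (Real.lt_sqrt hR.le).2 hρ
    simp [hE, hζ.zero _ fun h => absurd h.2 (not_le.2 this)]
  have hEs : ContDiff ℝ ∞ E := by
    refine contDiff_iff_contDiffAt.2 fun ρ => ?_
    rcases lt_or_ge ρ (ε ^ 2) with h | h
    · refine (contDiffAt_const (c := (0 : ℝ))).congr_of_eventuallyEq ?_
      filter_upwards [Iio_mem_nhds h] with s hs using hE0 s hs
    · have hρ : 0 < ρ := lt_of_lt_of_le (by positivity) h
      have hs : ContDiffAt ℝ ∞ (fun x => √x) ρ := Real.contDiffAt_sqrt hρ.ne'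
      refine ContDiffAt.div (hζ.smooth.contDiffAt.comp ρ hs) (contDiffAt_const.mul (hs.pow d)) ?_
      have := Real.sqrt_pos.2 hρ
      positivity
  have hEc : ∀ r, 0 < r → 2 * r ^ d * E (r ^ 2) = ζ r := fun r hr => by
    simp only [hE]
    rw [Real.sqrt_sq hr.le]
    field_simp
  have hpow : ∀ r : ℝ, r ^ d = r ^ (d - 1) * r := fun r => (pow_sub_one_mul (by omega) r).symm
  -- Based at R², so that Ψ(‖x‖²) vanishes outside the ball of radius R and is a legitimate test
  -- function.
  set Ψ : ℝ → ℝ := fun ρ => ∫ s in (R ^ 2)..ρ, E s with hΨ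
  have hΨd : ∀ ρ, HasDerivAt Ψ (E ρ) ρ := fun ρ =>
    (hEs.continuous.integral_hasStrictDerivAt _ ρ).hasDerivAt
  have hΨs : ContDiff ℝ ∞ Ψ := contDiff_infty_iff_deriv.2 ⟨fun r => (hΨd r).differentiableAt, by
    rwa [show deriv Ψ = E from funext fun r => (hΨd r).deriv]⟩
  have hΨ0 : ∀ ρ, R ^ 2 ≤ ρ → Ψ ρ = 0 := fun ρ hρ => by
    refine intervalIntegral.integral_zero_ae (Eventually.of_forall fun s hs => hER s ?_)
    rw [uIoc_of_le hρ] at hs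
    exact hs.1
  have hEL' := hEL (fun x => Ψ (‖x‖ ^ 2)) (hΨs.comp (contDiff_norm_sq ℝ)) (by
    refine HasCompactSupport.of_support_subset_isCompact (isCompact_closedBall (0 : Space d) R)
      fun x hx => ?_
    rw [mem_closedBall_zero_iff]
    by_contra hcon
    exact hx (hΨ0 _ (pow_le_pow_left₀ hR.le (not_le.1 hcon).le 2)))
  simp_rw [lap_comp_norm_sq (hEs.differentiable (by simp)) hΨd] at hEL'
  have p1 := integral_fun_norm_addHaar (volume : Measure (Space d)) fun r : ℝ =>
    g r * (4 * r ^ 2 * deriv E (r ^ 2) + 2 * d * E (r ^ 2))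
  have p2 := integral_fun_norm_addHaar (volume : Measure (Space d)) fun r : ℝ => q r * Ψ (r ^ 2)
  simp only [finrank_euclideanSpace_fin, smul_eq_mul, nsmul_eq_mul] at p1 p2
  rw [p1, p2] at hEL'
  have hω : volume.real (Metric.ball (0 : Space d) 1) ≠ 0 := (ballVol_pos d).ne'
  have hd0 : (d : ℝ) ≠ 0 := by exact_mod_cast (by omega : d ≠ 0)
  have hEL'' := mul_left_cancel₀ hω (mul_left_cancel₀ hd0 hEL')
  have e1 : ∫ r in Ioi 0, g r * deriv ζ r = ∫ r in Ioi 0, r ^ (d - 1) * (g r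
      * (4 * r ^ 2 * deriv E (r ^ 2) + 2 * d * E (r ^ 2))) := by
    refine setIntegral_congr_fun measurableSet_Ioi fun r hr => ?_
    have hr0 : 0 < r := hr
    have a1 : HasDerivAt (fun r : ℝ => E (r ^ 2)) (deriv E (r ^ 2) * (2 * r)) r := by
      have := ((hEs.differentiable (by simp)) (r ^ 2)).hasDerivAt.comp r (hasDerivAt_pow 2 r)
      exact this.congr_deriv (by simp)
    have a2 := ((hasDerivAt_pow d r).const_mul 2).mul a1
    have a3 : ζ =ᶠ[𝓝 r] ((fun r => 2 * r ^ d) * fun r => E (r ^ 2)) := by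
      filter_upwards [Ioi_mem_nhds hr0] with s hs using (hEc s hs).symm
    rw [(a2.congr_of_eventuallyEq a3).deriv, hpow r]
    ring
  have e2 : ∫ r in Ioi 0, r ^ (d - 1) * (q r * Ψ (r ^ 2)) = ∫ r in 0..R, r ^ (d - 1) * (q r * Ψ (r ^ 2)) := by
    refine setIntegral_Ioi_eq_interval le_rfl hR.le fun r hr hr' => ?_
    have : R < r := by
      by_contra hcon
      exact hr' ⟨hr, not_lt.1 hcon⟩
    rw [hΨ0 _ (pow_le_pow_left₀ hR.le this.le 2)]
    ring
  have e3 : ∫ r in Ioi 0, H r / r ^ (d - 1) * ζ r = ∫ r in 0..R, H r / r ^ (d - 1) * ζ r := by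
    refine setIntegral_Ioi_eq_interval le_rfl hR.le fun r hr hr' => ?_
    have : R < r := by
      by_contra hcon
      exact hr' ⟨hr, not_lt.1 hcon⟩
    rw [hζ.zero r fun h => absurd h.2 (not_le.2 this), mul_zero]
  have hHc : Continuous H := intervalIntegral.continuous_primitive hqi 0
  have hΨc : Continuous fun r : ℝ => Ψ (r ^ 2) := hΨs.continuous.comp (continuous_pow 2)
  have hEcont : Continuous fun r : ℝ => E (r ^ 2) * (2 * r) :=
    (hEs.continuous.comp (continuous_pow 2)).mul (by fun_prop)
  have j1 : IntervalIntegrable (fun r => r ^ (d - 1) * q r * Ψ (r ^ 2)) volume 0 R :=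
    (hqi 0 R).mul_continuousOn hΨc.continuousOn
  have j2 : IntervalIntegrable (fun r => H r * (E (r ^ 2) * (2 * r))) volume 0 R :=
    (hHc.mul hEcont).intervalIntegrable _ _
  -- `q` comes from a monotone profile and may jump, so `H` is differentiable only off a countable
  -- set.
  have parts := integral_eq_of_hasDerivAt_off_countable (fun r => H r * Ψ (r ^ 2))
    (fun r => r ^ (d - 1) * q r * Ψ (r ^ 2) + H r * (E (r ^ 2) * (2 * r))) (a := 0) (b := R) hqc
    (hHc.mul hΨc).continuousOn (fun r hr => by
      have hcont : ContinuousAt q r := not_not.1 hr.2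
      have a1 : HasDerivAt H (r ^ (d - 1) * q r) r := by
        refine intervalIntegral.integral_hasDerivAt_right (hqi 0 r) ?_
          ((continuous_pow (d - 1)).continuousAt.mul hcont)
        have hm : AEStronglyMeasurable (fun r => r ^ (d - 1) * q r) (volume.restrict (Ioc (r - 1) (r + 1))) :=
          ((hqi (r - 1) (r + 1)).1).aestronglyMeasurable
        exact ⟨Ioc (r - 1) (r + 1), Ioc_mem_nhds (by linarith) (by linarith), hm⟩
      have a2 : HasDerivAt (fun r : ℝ => Ψ (r ^ 2)) (E (r ^ 2) * (2 * r)) r := by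
        have := (hΨd (r ^ 2)).comp r (hasDerivAt_pow 2 r)
        exact this.congr_deriv (by simp)
      exact a1.mul a2) (j1.add j2)
  have hH0 : H 0 = 0 := by simp [hH]
  rw [intervalIntegral.integral_add j1 j2, hΨ0 _ le_rfl, hH0, mul_zero, zero_mul, sub_zero] at parts
  have e4 : ∫ r in 0..R, H r / r ^ (d - 1) * ζ r = ∫ r in 0..R, H r * (E (r ^ 2) * (2 * r)) := by
    rw [intervalIntegral.integral_of_le hR.le, intervalIntegral.integral_of_le hR.le]
    refine setIntegral_congr_fun measurableSet_Ioc fun r hr => ?_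
    have hr0 : 0 < r := hr.1
    rw [← hEc r hr0, hpow r]
    field_simp
  rw [e1, hEL'', e2, e3, e4]
  simp_rw [← mul_assoc] at parts ⊢
  linarith

/-- A strict inequality at r would persist on a one-sided interval, on the left if `g` is larger and
on the right if it is smaller, and such an interval has positive measure. -/
theorem antitone_eq_of_ae_eq {g J : ℝ → ℝ} (hg : Antitone g) (hJ : ContinuousOn J (Ioi 0))
    (h : ∀ᵐ r, r ∈ Ioi (0 : ℝ) → g r = J r) {r : ℝ} (hr : 0 < r) : g r = J r := by
  have hJr : ContinuousAt J r := hJ.continuousAt (Ioi_mem_nhds hr)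
  have hfreq : ∀ x y : ℝ, x < y → ∃ s ∈ Ioo x y, s ∈ Ioi (0 : ℝ) → g s = J s := by
    intro x y hxy
    by_contra hcon
    push Not at hcon
    have h1 : volume (Ioo x y) = 0 := measure_mono_null (show Ioo x y ⊆
      {r | ¬ (r ∈ Ioi (0 : ℝ) → g r = J r)} from fun s hs hs' =>
        (hcon s hs).2 (hs' (hcon s hs).1)) (ae_iff.1 h)
    rw [Real.volume_Ioo] at h1
    exact absurd h1 (by simpa using hxy)
  refine le_antisymm (le_of_not_gt fun hlt => ?_) (le_of_not_gt fun hlt => ?_)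
  · obtain ⟨x, hx, hxs⟩ := exists_Ioc_subset_of_mem_nhds ((hJr.eventually (gt_mem_nhds hlt)).and
      (Ioi_mem_nhds hr)) ⟨r - 1, by linarith⟩
    obtain ⟨s, hs, hsg⟩ := hfreq x r hx
    have h2 := hxs ⟨hs.1, hs.2.le⟩
    have h3 : J s < g r := h2.1
    have h4 := hg hs.2.le
    rw [hsg h2.2] at h4
    linarith
  · obtain ⟨y, hy, hys⟩ := exists_Ico_subset_of_mem_nhds ((hJr.eventually (lt_mem_nhds hlt)).and
      (Ioi_mem_nhds hr)) ⟨r + 1, by linarith⟩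
    obtain ⟨s, hs, hsg⟩ := hfreq r y hy
    have h2 := hys ⟨hs.1.le, hs.2⟩
    have h3 : g r < J s := h2.1
    have h4 := hg hs.1.le
    rw [hsg h2.2] at h4
    linarith

/-- Bounded radially nonincreasing weak solutions of a semilinear equation solve the radial system. -/
theorem exists_radial_system (hd : 1 ≤ d) {g k : ℝ → ℝ} {K : ℝ} (hg : Antitone g)
    (hgK : ∀ r, g r ∈ Icc 0 K) (hk : Continuous k)
    (hEL : ∀ φ : Space d → ℝ, ContDiff ℝ ∞ φ → HasCompactSupport φ →
      ∫ x : Space d, g ‖x‖ * lap φ x = ∫ x : Space d, k (g ‖x‖) * φ x) :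
    ∃ H : ℝ → ℝ, ∀ r, 0 < r → HasDerivAt g (H r / r ^ (d - 1)) r ∧
      HasDerivAt H (r ^ (d - 1) * k (g r)) r := by
  obtain ⟨M, hM⟩ := isCompact_Icc.exists_bound_of_continuousOn (hk.continuousOn (s := Icc 0 K))
  have hql : LocallyIntegrable (fun r => k (g r)) volume :=
    (locallyIntegrable_const M).mono (hk.measurable.comp hg.measurable).aestronglyMeasurable
      (Eventually.of_forall fun r => (hM _ (hgK r)).trans (le_abs_self M))
  have hqi : ∀ x y, IntervalIntegrable (fun r => r ^ (d - 1) * k (g r)) volume x y := fun x y =>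
    ((hql.integrableOn_isCompact isCompact_uIcc).intervalIntegrable).continuousOn_mul (continuous_pow (d - 1)).continuousOn
  have hqc : {r | ¬ ContinuousAt (fun r => k (g r)) r}.Countable :=
    hg.countable_not_continuousAt.mono fun r hr hc => hr (hk.continuousAt.comp hc)
  set H : ℝ → ℝ := fun r => ∫ s in 0..r, s ^ (d - 1) * k (g s) with hH
  have hHc : Continuous H := intervalIntegral.continuous_primitive hqi 0
  have hΓc : ContinuousOn (fun r => H r / r ^ (d - 1)) (Ioi 0) :=
    hHc.continuousOn.div (continuous_pow (d - 1)).continuousOn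
      fun r hr => pow_ne_zero _ (ne_of_gt (show (0 : ℝ) < r from hr))
  have hΓi : ∀ x y : ℝ, 0 < x → 0 < y → IntervalIntegrable (fun r => H r / r ^ (d - 1)) volume x y :=
    fun x y hx hy => (hΓc.mono fun s hs => (lt_min hx hy).trans_le hs.1).intervalIntegrable
  -- `J` has the weak derivative that the radial equation assigns to `g`, so g − J is constant by du
  -- Bois-Reymond, first almost everywhere and then, by monotonicity, everywhere on (0, ∞).
  set J : ℝ → ℝ := fun r => ∫ s in 1..r, H s / s ^ (d - 1) with hJ
  have hJd : ∀ r, 0 < r → HasDerivAt J (H r / r ^ (d - 1)) r := fun r hr =>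
    intervalIntegral.integral_hasDerivAt_right (hΓi 1 r one_pos hr)
      (hΓc.stronglyMeasurableAtFilter isOpen_Ioi r hr) (hΓc.continuousAt (Ioi_mem_nhds hr))
  have hJc : ContinuousOn J (Ioi 0) := fun r hr => (hJd r hr).continuousAt.continuousWithinAt
  have hgl : LocallyIntegrableOn g (Ioi 0) volume :=
    ((locallyIntegrable_const K).mono hg.measurable.aestronglyMeasurable
      (Eventually.of_forall fun r => by
        rw [Real.norm_of_nonneg (hgK r).1]
        exact (hgK r).2.trans (le_abs_self K))).locallyIntegrableOn _
  have hJl : LocallyIntegrableOn J (Ioi 0) volume := hJc.locallyIntegrableOn measurableSet_Ioi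
  obtain ⟨c, hc⟩ := ae_eq_const_of_integral_deriv_eq_zero (f := fun r => g r - J r) (hgl.sub hJl) (by
    intro ζ ε R hε hεR hζ
    have hz : ∀ {r}, r ∉ Ioc (ε / 2) (2 * R) → ζ r = 0 ∧ deriv ζ r = 0 := fun {r} hr => by
      have : r ∉ Icc ε R := fun h => hr ⟨by linarith [h.1], by linarith [h.2]⟩
      exact ⟨hζ.zero r this, hζ.deriv.zero r this⟩
    have h1 := radial_weak_form hd hqi hqc hEL hε hεR hζ
    have h2 : ∫ r in Ioi 0, J r * deriv ζ r = - ∫ r in Ioi 0, H r / r ^ (d - 1) * ζ r := by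
      have hle : ε / 2 ≤ 2 * R := by linarith
      rw [setIntegral_Ioi_eq_interval (by positivity) hle fun r _ hr => by rw [(hz hr).2, mul_zero],
        setIntegral_Ioi_eq_interval (by positivity) hle fun r _ hr => by rw [(hz hr).1, mul_zero]]
      have hsub : uIcc (ε / 2) (2 * R) ⊆ Ioi 0 := fun s hs => by
        rw [uIcc_of_le hle] at hs
        exact lt_of_lt_of_le (by positivity) hs.1
      have i1 : IntervalIntegrable (fun r => H r / r ^ (d - 1) * ζ r) volume (ε / 2) (2 * R) :=
        ((hΓc.mono hsub).mul hζ.smooth.continuous.continuousOn).intervalIntegrable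
      have i2 : IntervalIntegrable (fun r => J r * deriv ζ r) volume (ε / 2) (2 * R) :=
        ((hJc.mono hsub).mul hζ.deriv.smooth.continuous.continuousOn).intervalIntegrable
      have h3 := intervalIntegral.integral_eq_sub_of_hasDerivAt (f := fun r => J r * ζ r)
        (fun r hr => (hJd r (hsub hr)).mul (hζ.hasDerivAt r)) (i1.add i2)
      have z1 : ζ (ε / 2) = 0 := hζ.zero _ fun h => by linarith [h.1]
      have z2 : ζ (2 * R) = 0 := hζ.zero _ fun h => by linarith [h.2]
      rw [z1, z2, mul_zero, mul_zero, sub_zero, intervalIntegral.integral_add i1 i2] at h3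
      linarith
    have e : ∀ f : ℝ → ℝ, ∫ r in Ioi 0, f r * deriv ζ r = ∫ r, f r * deriv ζ r := fun f =>
      setIntegral_eq_integral_of_forall_compl_eq_zero fun r hr => by
        rw [hζ.deriv.zero r fun h => hr (hε.trans_le h.1), mul_zero]
    rw [e] at h1 h2
    simp_rw [sub_mul]
    rw [integral_sub (hζ.deriv.integrable_mul hε hgl) (hζ.deriv.integrable_mul hε hJl), h1, h2, sub_self])
  have hgJ : ∀ r, 0 < r → g r = J r + c := fun r hr =>
    antitone_eq_of_ae_eq (J := fun r => J r + c) hg (hJc.add continuousOn_const) (by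
      filter_upwards [hc] with s hs hs0
      rw [← hs hs0]
      ring) hr
  have hgd : ∀ r, 0 < r → HasDerivAt g (H r / r ^ (d - 1)) r := fun r hr =>
    ((hJd r hr).add_const c).congr_of_eventuallyEq (by
      filter_upwards [Ioi_mem_nhds hr] with s hs using hgJ s hs)
  refine ⟨H, fun r hr => ⟨hgd r hr, ?_⟩⟩
  refine intervalIntegral.integral_hasDerivAt_right (hqi 0 r) ?_
    ((continuous_pow (d - 1)).continuousAt.mul (hk.continuousAt.comp (hgd r hr).continuousAt))
  have hm : AEStronglyMeasurable (fun r => r ^ (d - 1) * k (g r))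
      (volume.restrict (Ioc (r - 1) (r + 1))) := ((hqi (r - 1) (r + 1)).1).aestronglyMeasurable
  exact ⟨Ioc (r - 1) (r + 1), Ioc_mem_nhds (by linarith) (by linarith), hm⟩

/-! ### Strict monotonicity and positivity of minimisers -/

/-- A solution of the radial system which is constant on an interval is constant. -/
theorem eq_const_of_flat {n : ℕ} {g H k : ℝ → ℝ} {K : ℝ} {L : ℝ≥0} (hg : Antitone g)
    (hgK : ∀ r, g r ∈ Icc 0 K) (hk : LipschitzOnWith L k (Icc 0 K))
    (hsys : ∀ r, 0 < r → HasDerivAt g (H r / r ^ n) r ∧ HasDerivAt H (r ^ n * k (g r)) r)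
    {r₁ r₂ : ℝ} (h1 : 0 < r₁) (h12 : r₁ < r₂) (hflat : g r₁ = g r₂) {r : ℝ} (hr : 0 < r) :
    g r = g r₁ := by
  have hconst : ∀ s ∈ Ioo r₁ r₂, g s = g r₁ := fun s hs =>
    le_antisymm (hg hs.1.le) (hflat.trans_le (hg hs.2.le))
  have hH0 : ∀ s ∈ Ioo r₁ r₂, H s = 0 := fun s hs => by
    have hs0 : 0 < s := h1.trans hs.1
    have h2 : g =ᶠ[𝓝 s] fun _ => g r₁ := by
      filter_upwards [Ioo_mem_nhds hs.1 hs.2] with t ht using hconst t ht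
    have h3 := (hsys s hs0).1.unique ((hasDerivAt_const s (g r₁)).congr_of_eventuallyEq h2)
    exact (div_eq_zero_iff.1 h3).resolve_right (pow_ne_zero _ hs0.ne')
  set s₀ := (r₁ + r₂) / 2 with hs₀
  have hm : s₀ ∈ Ioo r₁ r₂ := ⟨by rw [hs₀]; linarith, by rw [hs₀]; linarith⟩
  have hs₀0 : 0 < s₀ := h1.trans hm.1
  -- On the flat piece `H` vanishes, hence so does its derivative; therefore the constant pair (g
  -- r₁, 0) solves the same system.
  have hk0 : k (g r₁) = 0 := by
    have h2 : H =ᶠ[𝓝 s₀] fun _ => 0 := by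
      filter_upwards [Ioo_mem_nhds hm.1 hm.2] with t ht using hH0 t ht
    have h3 := (hsys s₀ hs₀0).2.unique ((hasDerivAt_const s₀ (0 : ℝ)).congr_of_eventuallyEq h2)
    rw [hconst s₀ hm] at h3
    exact (mul_eq_zero.1 h3).resolve_left (pow_ne_zero _ hs₀0.ne')
  -- The window (x, y) contains both r and s₀ and stays away from the singularity at 0, so the
  -- vector field is uniformly Lipschitz on it.
  set x := min r s₀ / 2 with hx
  set y := max r s₀ + 1 with hy
  have hx0 : 0 < x := by rw [hx]; exact half_pos (lt_min hr hs₀0)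
  have hy0 : 0 < y := by rw [hy]; linarith [hr.trans_le (le_max_left r s₀)]
  have hxr : x < r := by rw [hx]; linarith [min_le_left r s₀, lt_min hr hs₀0]
  have hxs : x < s₀ := by rw [hx]; linarith [min_le_right r s₀, lt_min hr hs₀0]
  have hry : r < y := by rw [hy]; linarith [le_max_left r s₀]
  have hsy : s₀ < y := by rw [hy]; linarith [le_max_right r s₀]
  set V : ℝ → ℝ × ℝ → ℝ × ℝ := fun t z => (z.2 / t ^ n, t ^ n * k z.1) with hV
  have hlip : ∀ t ∈ Ioo x y, LipschitzOnWith (max ((x ^ n)⁻¹.toNNReal) ((y ^ n).toNNReal * L)) (V t)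
      (Icc 0 K ×ˢ univ) := by
    intro t ht
    have ht0 : 0 < t := hx0.trans ht.1
    refine LipschitzOnWith.of_dist_le_mul fun z hz z' hz' => ?_
    have hxn : (((x ^ n)⁻¹.toNNReal : ℝ≥0) : ℝ) = (x ^ n)⁻¹ := Real.coe_toNNReal _ (by positivity)
    have hyn : (((y ^ n).toNNReal : ℝ≥0) : ℝ) = y ^ n := Real.coe_toNNReal _ (by positivity)
    have hd1 : dist z.1 z'.1 ≤ dist z z' := le_max_left _ _
    have hd2 : dist z.2 z'.2 ≤ dist z z' := le_max_right _ _
    rw [NNReal.coe_max, NNReal.coe_mul, hxn, hyn]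
    refine max_le ?_ ?_
    · have e : dist (V t z).1 (V t z').1 = (t ^ n)⁻¹ * dist z.2 z'.2 := by
        simp only [hV, Real.dist_eq]
        rw [← sub_div, abs_div, abs_of_pos (by positivity : 0 < t ^ n)]
        ring
      rw [e]
      refine mul_le_mul (le_trans ?_ (le_max_left _ _)) hd2 dist_nonneg (by positivity)
      exact inv_anti₀ (by positivity) (pow_le_pow_left₀ hx0.le ht.1.le n)
    · have e : dist (V t z).2 (V t z').2 = t ^ n * dist (k z.1) (k z'.1) := by
        simp only [hV, Real.dist_eq]
        rw [← mul_sub, abs_mul, abs_of_pos (by positivity : 0 < t ^ n)]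
      rw [e]
      have h2 := hk.dist_le_mul z.1 hz.1 z'.1 hz'.1
      calc t ^ n * dist (k z.1) (k z'.1) ≤ y ^ n * (L * dist z z') := by
            refine mul_le_mul (pow_le_pow_left₀ ht0.le ht.2.le n) (h2.trans ?_) dist_nonneg
              (by positivity)
            gcongr
        _ = y ^ n * L * dist z z' := by ring
        _ ≤ _ := by gcongr; exact le_max_right _ _
  have huniq := ODE_solution_unique_of_mem_Ioo (f := fun t => (g t, H t)) (g := fun _ => (g r₁, 0))
    hlip ⟨hxs, hsy⟩ (fun t ht => ⟨(hsys t (hx0.trans ht.1)).1.prodMk (hsys t (hx0.trans ht.1)).2,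
      hgK t, mem_univ _⟩)
    (fun t ht => ⟨by
      simp only [hV, hk0, mul_zero, zero_div]
      exact hasDerivAt_const t _, hgK _, mem_univ _⟩)
    (by rw [hconst s₀ hm, hH0 s₀ hm])
  exact congrArg Prod.fst (huniq ⟨hxr, hry⟩)

/-- Bounded radially nonincreasing minimisers are positive and strictly decreasing. -/
theorem Admissible.isPositiveRadialDecreasing {a b p₁ p₀ : ℝ}
    (h : Admissible d a b (p₁ + 2) (p₀ + 2)) {m : ℝ} (hm : 0 < m) {g : ℝ → ℝ} {K : ℝ}
    (hg : Antitone g) (hgK : ∀ r, g r ∈ Icc 0 K)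
    (hmem : (fun x : Space d => (g ‖x‖ : ℂ)) ∈ massShell d p₀ m)
    (hmin : functional a b (p₁ + 2) (p₀ + 2) (fun x : Space d => (g ‖x‖ : ℂ))
      = groundInf d a b p₁ p₀ m) :
    IsPositiveRadialDecreasing fun x : Space d => (g ‖x‖ : ℂ) := by
  have hp1 : 0 < p₁ := by linarith [h.two_lt]
  have hp0 : 0 < p₀ := by linarith [h.two_lt']
  obtain ⟨c, hc⟩ := h.euler_lagrange hm (fun x => hgK ‖x‖) hmem hmin
  set k : ℝ → ℝ := fun s => c * s - a * (p₁ + 2) / 2 * s ^ (p₁ + 1) + b * (p₀ + 2) / 2 * s ^ (p₀ + 1)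
    with hk
  -- Both powers p₁ + 1 and p₀ + 1 exceed 1, which gives the Lipschitz bound on [0, K] needed for
  -- uniqueness.
  have hkC : ContDiff ℝ 1 k := by
    have h1 : ContDiff ℝ 1 fun s : ℝ => s ^ (p₁ + 1) := by
      have := Real.contDiff_rpow_const_of_le (p := p₁ + 1) (n := 1) (by simpa using hp1.le)
      simpa using this
    have h0 : ContDiff ℝ 1 fun s : ℝ => s ^ (p₀ + 1) := by
      have := Real.contDiff_rpow_const_of_le (p := p₀ + 1) (n := 1) (by simpa using hp0.le)
      simpa using this
    exact ((contDiff_const.mul contDiff_id).sub (contDiff_const.mul h1)).add (contDiff_const.mul h0)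
  obtain ⟨L, hL⟩ := hkC.contDiffOn.exists_lipschitzOnWith one_ne_zero (convex_Icc 0 K) isCompact_Icc
  have hgm : Measurable fun x : Space d => g ‖x‖ := hg.measurable.comp measurable_norm
  have hint : ∀ q : ℝ, 0 ≤ q → ∀ φ : Space d → ℝ, ContDiff ℝ ∞ φ → HasCompactSupport φ →
      Integrable fun x : Space d => g ‖x‖ ^ q * φ x := fun q hq φ hφ hφc =>
    (hφ.continuous.integrable_of_hasCompactSupport hφc).bdd_mul (c := K ^ q)
      (hgm.pow_const q).aestronglyMeasurable (Eventually.of_forall fun x => by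
        rw [Real.norm_of_nonneg (Real.rpow_nonneg (hgK _).1 _)]
        exact Real.rpow_le_rpow (hgK _).1 (hgK _).2 hq)
  obtain ⟨H, hH⟩ := exists_radial_system h.dim hg hgK hkC.continuous (fun φ hφ hφc => by
    rw [hc φ hφ hφc]
    have i := hint 1 zero_le_one φ hφ hφc
    simp only [Real.rpow_one] at i
    have i1 := (hint (p₁ + 1) (by linarith) φ hφ hφc).const_mul (a * (p₁ + 2) / 2)
    have i0 := (hint (p₀ + 1) (by linarith) φ hφ hφc).const_mul (b * (p₀ + 2) / 2)
    have i2 := (i.const_mul c).sub i1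
    have e : ∀ x : Space d, k (g ‖x‖) * φ x = (c * (g ‖x‖ * φ x)
        - a * (p₁ + 2) / 2 * (g ‖x‖ ^ (p₁ + 1) * φ x)) + b * (p₀ + 2) / 2 * (g ‖x‖ ^ (p₀ + 1) * φ x) :=
      fun x => by simp only [hk]; ring
    simp_rw [e]
    rw [integral_add (by exact i2) i0, integral_sub (i.const_mul c) i1, integral_const_mul,
      integral_const_mul, integral_const_mul])
  -- Equality would make the profile constant on (0, ∞); a constant in L² of a space of infinite
  -- measure is zero, against m > 0.
  have hnc : ∀ r₁ r₂ : ℝ, 0 < r₁ → r₁ < r₂ → g r₂ < g r₁ := by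
    intro r₁ r₂ h1 h12
    refine lt_of_le_of_ne (hg h12.le) fun heq => ?_
    have hconst := fun r (hr : 0 < r) => eq_const_of_flat hg hgK hL hH h1 h12 heq.symm hr
    have hae : (fun x : Space d => (g ‖x‖ : ℂ)) =ᵐ[volume] fun _ => (g r₁ : ℂ) := by
      filter_upwards [ae_norm_notMem_countable h.dim (countable_singleton (0 : ℝ))] with x hx
      have : 0 < ‖x‖ := (norm_nonneg x).lt_of_ne fun h0 => hx h0.symm
      rw [hconst _ this]
    have hL2 := (memLp_congr_ae hae).1 hmem.1.1
    have : Nontrivial (Space d) := by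
      obtain ⟨e, he⟩ := exists_unit_vector h.dim
      exact ⟨e, 0, fun h => by simp [h] at he⟩
    have hvol : volume (univ : Set (Space d)) = ⊤ := by
      have : NoncompactSpace (Space d) := NormedSpace.noncompactSpace ℝ _
      exact measure_univ_of_isAddLeftInvariant _
    have hz : (g r₁ : ℂ) = 0 := by
      rcases (memLp_const_iff (by norm_num) (by norm_num)).1 hL2 with h0 | h0
      · exact h0
      · rw [hvol] at h0
        exact absurd h0 (lt_irrefl _)
    refine hm.ne' ?_
    rw [← hmem.2.2]
    refine integral_eq_zero_of_ae ?_
    filter_upwards [hae] with x hx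
    rw [hx, hz]
    simp
  have hanti : StrictAntiOn g (Ici 0) := by
    intro r hr s hs hrs
    have hr0 : (0 : ℝ) ≤ r := hr
    have h1 : g s < g ((r + s) / 2) := hnc _ _ (by linarith) (by linarith)
    exact h1.trans_le (hg (by linarith))
  refine ⟨g, fun r hr => ?_, hanti, fun x => rfl⟩
  have hr0 : (0 : ℝ) ≤ r := hr
  exact (hgK (r + 1)).1.trans_lt (hanti hr (show (0 : ℝ) ≤ r + 1 by linarith) (by linarith))

/-! ### Scaling between the energy and the virial functional -/

/-- The two relations on `A` and `B` say that the dilation multiplies all three terms by one common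
factor, the new coefficients absorbing the discrepancy between powers. -/
theorem groundInf_dilate_le {a b a' b' p₁ p₀ : ℝ} (h : Admissible d a b (p₁ + 2) (p₀ + 2))
    (h' : Admissible d a' b' (p₁ + 2) (p₀ + 2)) {A B : ℝ} (hA : 0 < A) (hB : 0 < B)
    (ha : a' * A ^ (p₁ + 2) = A ^ 2 * B ^ 2 * a) (hb : b' * A ^ (p₀ + 2) = A ^ 2 * B ^ 2 * b)
    {m : ℝ} (hm : 0 ≤ m) : groundInf d a' b' p₁ p₀ (A ^ 2 * (B ^ d)⁻¹ * m)
      ≤ (B ^ d)⁻¹ * (A ^ 2 * B ^ 2) * groundInf d a b p₁ p₀ m := by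
  have hκ : 0 < (B ^ d)⁻¹ * (A ^ 2 * B ^ 2) := by positivity
  rw [← div_le_iff₀' hκ]
  refine (h.isGLB hm).2 ?_
  rintro _ ⟨u, hu, rfl⟩
  rw [div_le_iff₀' hκ]
  refine (h'.groundInf_le (mem_massShell_dilate hu A hB)).trans_eq ?_
  rw [functional_dilate hu.1 hA.le hB, ha, hb]
  unfold functional
  ring

/-- The inverse dilation satisfies the same relations with the functionals exchanged, which gives
the reverse inequality. -/
theorem groundInf_dilate {a b a' b' p₁ p₀ : ℝ} (h : Admissible d a b (p₁ + 2) (p₀ + 2))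
    (h' : Admissible d a' b' (p₁ + 2) (p₀ + 2)) {A B : ℝ} (hA : 0 < A) (hB : 0 < B)
    (ha : a' * A ^ (p₁ + 2) = A ^ 2 * B ^ 2 * a) (hb : b' * A ^ (p₀ + 2) = A ^ 2 * B ^ 2 * b)
    {m : ℝ} (hm : 0 ≤ m) : groundInf d a' b' p₁ p₀ (A ^ 2 * (B ^ d)⁻¹ * m)
      = (B ^ d)⁻¹ * (A ^ 2 * B ^ 2) * groundInf d a b p₁ p₀ m := by
  refine le_antisymm (groundInf_dilate_le h h' hA hB ha hb hm) ?_
  have inv : ∀ {x y q : ℝ}, y * A ^ q = A ^ 2 * B ^ 2 * x →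
      x * A⁻¹ ^ q = A⁻¹ ^ 2 * B⁻¹ ^ 2 * y := by
    intro x y q hxy
    have : 0 < A ^ q := Real.rpow_pos_of_pos hA q
    rw [Real.inv_rpow hA.le]
    field_simp
    linarith
  have h1 := groundInf_dilate_le h' h (inv_pos.2 hA) (inv_pos.2 hB) (inv ha) (inv hb)
    (m := A ^ 2 * (B ^ d)⁻¹ * m) (by positivity)
  rw [show (B⁻¹ ^ d)⁻¹ = B ^ d by rw [inv_pow, inv_inv]] at h1
  have e : A⁻¹ ^ 2 * B ^ d * (A ^ 2 * (B ^ d)⁻¹ * m) = m := by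
    field_simp
  rw [e] at h1
  have h2 := mul_le_mul_of_nonneg_left h1 (show 0 ≤ (B ^ d)⁻¹ * (A ^ 2 * B ^ 2) by positivity)
  refine h2.trans_eq ?_
  field_simp

/-- The dilation which turns the energy into a multiple of the virial functional. -/
theorem exists_dilation_parameters (hd : 1 ≤ d) {p₀ p₁ : ℝ} (hp₁ : 0 < p₁) (hp₀ : p₁ < p₀) :
    ∃ A B : ℝ, 0 < A ∧ 0 < B ∧
      d * p₁ / (2 * (p₁ + 2)) * A ^ (p₁ + 2) = A ^ 2 * B ^ 2 * (2 / (p₁ + 2)) ∧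
      d * p₀ / (2 * (p₀ + 2)) * A ^ (p₀ + 2) = A ^ 2 * B ^ 2 * (2 / (p₀ + 2)) ∧
      ∀ m, tildeMass d p₀ p₁ m = A ^ 2 * (B ^ d)⁻¹ * m := by
  have hd0 := Admissible.dim_pos hd
  have hp₀' : 0 < p₀ := hp₁.trans hp₀
  have hδ : 0 < p₀ - p₁ := sub_pos.2 hp₀
  -- The two requirements read B² = (d p₁/4) A^{p₁} and B² = (d p₀/4) A^{p₀}; their quotient
  -- determines `A`, and the first then gives B = √T.
  set A := (p₁ / p₀) ^ (p₀ - p₁)⁻¹ with hAdef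
  have hA : 0 < A := Real.rpow_pos_of_pos (by positivity) _
  have hAδ : A ^ (p₀ - p₁) = p₁ / p₀ := by
    rw [hAdef, ← Real.rpow_mul (by positivity), inv_mul_cancel₀ hδ.ne', Real.rpow_one]
  have hAp : 0 < A ^ p₁ := Real.rpow_pos_of_pos hA _
  set T := d * p₁ / 4 * A ^ p₁ with hT
  have hT0 : 0 < T := by positivity
  have hB2 : √T ^ 2 = T := Real.sq_sqrt hT0.le
  refine ⟨A, √T, hA, Real.sqrt_pos.2 hT0, ?_, ?_, fun m => ?_⟩
  · rw [hB2, hT, Real.rpow_add hA, Real.rpow_two]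
    field_simp
    ring
  · have e : A ^ p₀ = A ^ p₁ * (p₁ / p₀) := by
      rw [← hAδ, ← Real.rpow_add hA]
      congr 1
      ring
    rw [hB2, hT, Real.rpow_add hA, Real.rpow_two, e]
    field_simp
    ring
  · unfold tildeMass
    congr 1
    have e1 : ((√T) ^ d)⁻¹ = (4 / (d * p₁)) ^ ((d : ℝ) / 2) * A ^ (-(p₁ * d / 2)) := by
      rw [Real.sqrt_eq_rpow, ← Real.rpow_natCast, ← Real.rpow_mul hT0.le, ← Real.inv_rpow hT0.le, hT,
        mul_inv, Real.mul_rpow (by positivity) (by positivity), ← Real.rpow_neg hA.le,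
        ← Real.rpow_mul hA.le]
      congr 2
      · rw [inv_div]
      · ring
      · ring
    have e2 : (p₀ / p₁) ^ ((p₁ * d - 4) / (2 * (p₀ - p₁))) = A ^ 2 * A ^ (-(p₁ * d / 2)) := by
      rw [← Real.rpow_two, ← Real.rpow_add hA, hAdef, ← Real.rpow_mul (by positivity),
        ← inv_div p₁ p₀, Real.inv_rpow (by positivity), ← Real.rpow_neg (by positivity)]
      congr 1
      field_simp
      ring
    rw [e1, e2]
    ring

end DoublePowerNLS

/-! ### The main theorem -/

theorem corollary3p4 (d : ℕ) (hd : 1 ≤ d) (p₀ p₁ : ℝ) (hp₁ : 4 / (d : ℝ) < p₁) (hp₀ : p₁ < p₀) :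
    -- both infima are genuine infima of nonempty sets that are bounded below
    (∀ m : ℝ, 0 ≤ m →
      IsGLB (DoublePowerNLS.energy p₀ p₁ '' DoublePowerNLS.massShell d p₀ m)
          (DoublePowerNLS.energyInf d p₀ p₁ m) ∧
        IsGLB (DoublePowerNLS.virial p₀ p₁ '' DoublePowerNLS.massShell d p₀ m)
          (DoublePowerNLS.virialInf d p₀ p₁ m)) ∧
    ConcaveOn ℝ (Set.Ici 0) (DoublePowerNLS.virialInf d p₀ p₁) ∧
    AntitoneOn (DoublePowerNLS.virialInf d p₀ p₁) (Set.Ici 0) ∧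
    ∃ mc : ℝ, DoublePowerNLS.IsCriticalMass d p₀ p₁ mc ∧
      0 < DoublePowerNLS.tildeMass d p₀ p₁ mc ∧
      (∀ m ∈ Set.Icc 0 (DoublePowerNLS.tildeMass d p₀ p₁ mc),
        DoublePowerNLS.virialInf d p₀ p₁ m = 0) ∧
      (∀ m ∈ Set.Ioi (DoublePowerNLS.tildeMass d p₀ p₁ mc),
        DoublePowerNLS.virialInf d p₀ p₁ m < 0) ∧
      StrictAntiOn (DoublePowerNLS.virialInf d p₀ p₁)
        (Set.Ioi (DoublePowerNLS.tildeMass d p₀ p₁ mc)) ∧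
      (∀ m ∈ Set.Ici (DoublePowerNLS.tildeMass d p₀ p₁ mc),
        ∃ u ∈ DoublePowerNLS.massShell d p₀ m,
          DoublePowerNLS.virial p₀ p₁ u = DoublePowerNLS.virialInf d p₀ p₁ m ∧
          DoublePowerNLS.IsPositiveRadialDecreasing u) ∧
      (∀ m ∈ Set.Ioo 0 (DoublePowerNLS.tildeMass d p₀ p₁ mc),
        ∃ δ : ℝ, 0 < δ ∧ ∀ u ∈ DoublePowerNLS.massShell d p₀ m,
          δ * DoublePowerNLS.gradNormSq u ≤ DoublePowerNLS.virial p₀ p₁ u) := by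
  have hd0 := DoublePowerNLS.Admissible.dim_pos hd
  have hp1 : 0 < p₁ := lt_trans (by positivity) hp₁
  have hp0 : 0 < p₀ := hp1.trans hp₀
  have hE : DoublePowerNLS.Admissible d (2 / (p₁ + 2)) (2 / (p₀ + 2)) (p₁ + 2) (p₀ + 2) :=
    ⟨hd, by positivity, by positivity, by linarith, by linarith⟩
  have hV : DoublePowerNLS.Admissible d (d * p₁ / (2 * (p₁ + 2))) (d * p₀ / (2 * (p₀ + 2)))
      (p₁ + 2) (p₀ + 2) := ⟨hd, by positivity, by positivity, by linarith, by linarith⟩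
  -- The energy and virial infima are, by unfolding definitions, `groundInf` with the two sets of
  -- coefficients.
  refine ⟨fun m hm => ⟨hE.isGLB hm, hV.isGLB hm⟩, hV.concaveOn_groundInf, hV.antitoneOn_groundInf, ?_⟩
  obtain ⟨mt, hmt, hzero, hneg, hanti⟩ := hV.exists_criticalMass
  obtain ⟨A, B, hA, hB, ha, hb, htilde⟩ := DoublePowerNLS.exists_dilation_parameters hd hp1 hp₀
  have hμ : 0 < A ^ 2 * (B ^ d)⁻¹ := by positivity
  have hκ : 0 < (B ^ d)⁻¹ * (A ^ 2 * B ^ 2) := by positivity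
  have hinf := fun (m : ℝ) (hm : 0 ≤ m) =>
    DoublePowerNLS.groundInf_dilate hE hV hA hB ha hb hm
  -- The critical mass is found for the virial functional and transported back to the energy, so
  -- that `tildeMass` of the witness is `mt` itself.
  refine ⟨mt / (A ^ 2 * (B ^ d)⁻¹), ⟨by positivity, fun m hm => ?_, fun m hm => ?_⟩, ?_⟩
  · have h1 := hinf m hm.1
    rw [hzero _ ⟨mul_nonneg hμ.le hm.1, (le_div_iff₀' hμ).1 hm.2⟩] at h1
    exact (mul_eq_zero.1 h1.symm).resolve_left hκ.ne'
  · have hm' : mt / (A ^ 2 * (B ^ d)⁻¹) < m := hm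
    have h1 := hinf m ((by positivity : 0 ≤ mt / (A ^ 2 * (B ^ d)⁻¹)).trans hm'.le)
    have h2 := hneg _ (show mt < A ^ 2 * (B ^ d)⁻¹ * m from (div_lt_iff₀' hμ).1 hm')
    rw [h1] at h2
    exact (mul_neg_iff.1 h2).resolve_right (fun h => absurd h.1 hκ.not_gt) |>.2
  · rw [htilde, mul_div_cancel₀ _ hμ.ne']
    refine ⟨hmt, hzero, hneg, hanti, fun m hm => ?_, fun m hm => ?_⟩
    · have hm' : mt ≤ m := hm
      obtain ⟨g, hg, ⟨K, hgK⟩, hmem, hmin⟩ := hV.exists_minimizer hmt hzero hneg hanti hm'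
      exact ⟨_, hmem, hmin, hV.isPositiveRadialDecreasing (hmt.trans_le hm') hg hgK hmem hmin⟩
    · exact hV.subcritical_coercive (hzero mt ⟨hmt.le, le_rfl⟩) hm.1 hm.2
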